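/- Work over $\mathbb F_2$; a space is a simplicial set, and an $E_\infty$ operad is a symmetric operad $\mathcal C$ of spaces with every $\mathcal C(n)$ contractible and with free $\Sigma_n$-action. Let $X$ be a cosimplicial $\mathcal C$-space. Let $T=T(CN\,\mathbb F_2X)$ be the product total complex of its bicomplex of chains, conormalized in the cosimplicial degree $p$ and normalized in the simplicial degree $q$, with bidegree $(-p,q)$, total degree $q-p$ and differential $\partial$. Let $F^{-s}T$ consist of the elements that vanish in all columns $p<s$, and let $T_{s-1}=T/F^{-s}T$. Put $Z^r_{-s,t}=\{x\in F^{-s}T_{t-s}\mid \partial x\in F^{-s-r}T\}$ (lower index of $T$: total degree) and $B^r_{-s,t}=\partial Z^{r-1}_{-s+r-1,t-r+2}+Z^{r-1}_{-s-1,t+1}$. The spectral sequence of this filtration has $E^r=Z^r/B^r$ and $E^\infty_{-s,t}=\bigcap_r(Z^r_{-s,t}+F^{-s-1}T_{t-s})\big/\bigcup_r(B^r_{-s,t}+F^{-s-1}T_{t-s})$. Let $\varphi\colon H_*(\operatorname{Tot}X)\to H_*(T)$ be induced by sending a simplex $f\colon\Delta^\bullet\times\Delta^n\to X$ of $\operatorname{Tot}X$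 to the family $\big(f_*(\imath_p\wedge\imath_n)\big)_{p\ge0}$, where $\imath_p\wedge\imath_n$ is the shuffle product of the fundamental chains of $\Delta^p$ and $\Delta^n$. Set \[ F^{-s}H_n(\operatorname{Tot}X)=\ker\big(H_n(\operatorname{Tot}X)\xrightarrow{\ \varphi\ }H_n(T)\to H_n(T_{s-1})\big), \] and let $\iota\colon (F^{-s}/F^{-s-1})H_{t-s}(\operatorname{Tot}X)\to E^\infty_{-s,t}$ send the class of $a$ to the class of a cycle in $F^{-s}T$ that represents $\varphi(a)$. Choose a vertex of $\mathcal C(2)$; it gives a map $X\times X\to X$ of cosimplicial spaces and, through the induced (levelwise) $\mathcal C$-structure on $\operatorname{Tot}X$, a map $\operatorname{Tot}X\times\operatorname{Tot}X\to\operatorname{Tot}X$. Let $\mu$ on $H_*(\operatorname{Tot}X)$ be the cross product followed by the latter map. Let $\mu$ on $E^\infty$ be induced by the Alexander--Whitney product in the cosimplicial direction and the shuffle map in the simplicial direction, $T(CN\,\mathbb F_2X)\otimes T(CN\,\mathbb F_2X)\to T(CN\,\mathbb F_2(X\times X))$, followed by $X\times X\to X$. Then, for all $s,s'$, \[ \mu(F^{-s}\otimes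 F^{-s'})\subset F^{-s-s'}. \] Furthermore, $\mu$ descends to a map \[ (F^{-s}/F^{-s-1})H_{t-s}(\operatorname{Tot}X)\otimes(F^{-s'}/F^{-s'-1})H_{t'-s'}(\operatorname{Tot}X)\to(F^{-s-s'}/F^{-s-s'-1})H_{t+t'-s-s'}(\operatorname{Tot}X), \] and \[ \iota(\mu(a\otimes b))=\mu(\iota(a)\otimes\iota(b))\in E^\infty_{-s-s',t+t'} \] for all $a,b$ in these quotients. -/

import Mathlib

open CategoryTheory Simplicial Opposite MonoidalCategory

universe u

namespace CosimplicialSS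

noncomputable section

section

/-- The ground field `𝔽₂`. -/
abbrev K : Type := ZMod 2

/-- The `(p,q)`-shuffles, as lattice paths: pairs of monotone maps `α : [n] → [p]` and
`β : [n] → [q]` with `α i + β i = i`. For `n = p + q` these are the paths from `(0,0)` to `(p,q)`
with unit steps; the iterated degeneracies of the usual formula for the shuffle map are `α^*`
and `β^*`. -/
def shuffles (n p q : ℕ) : Finset ((⦋n⦌ ⟶ ⦋p⦌) × (⦋n⦌ ⟶ ⦋q⦌)) :=
  (Set.toFinite {s | ∀ i : Fin (n + 1),
    (s.1.toOrderHom i : ℕ) + (s.2.toOrderHom i : ℕ) = (i : ℕ)}).toFinset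

lemma mem_shuffles {n p q : ℕ} {s : (⦋n⦌ ⟶ ⦋p⦌) × (⦋n⦌ ⟶ ⦋q⦌)} :
    s ∈ shuffles n p q ↔ ∀ i : Fin (n + 1),
      (s.1.toOrderHom i : ℕ) + (s.2.toOrderHom i : ℕ) = (i : ℕ) := by
  simp [shuffles]

/-- The value of a simplicial operator at `i`, as a natural number. -/
def val {n p : ℕ} (α : ⦋n⦌ ⟶ ⦋p⦌) (i : Fin (n + 1)) : ℕ := (α.toOrderHom i : Fin (p + 1))

lemma val_mono {n p : ℕ} (α : ⦋n⦌ ⟶ ⦋p⦌) {i j : Fin (n + 1)} (h : (i : ℕ) ≤ j) :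
    val α i ≤ val α j := α.toOrderHom.monotone h

lemma val_le {n p : ℕ} (α : ⦋n⦌ ⟶ ⦋p⦌) (i : Fin (n + 1)) : val α i ≤ p :=
  Nat.lt_succ_iff.mp (α.toOrderHom i : Fin (p + 1)).2

lemma hom_ext_val {n p : ℕ} {α β : ⦋n⦌ ⟶ ⦋p⦌} (h : ∀ i, val α i = val β i) : α = β := by
  ext i
  exact h i

/-- A simplicial operator with given values. -/
def homOfNat {n p : ℕ} (f : Fin (n + 1) → ℕ) (hf : ∀ i j : Fin (n + 1), (i : ℕ) ≤ j → f i ≤ f j)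
    (hb : ∀ i, f i ≤ p) : ⦋n⦌ ⟶ ⦋p⦌ :=
  SimplexCategory.Hom.mk ⟨fun i => ⟨f i, Nat.lt_succ_iff.mpr (hb i)⟩, fun i j h => hf i j h⟩

lemma val_homOfNat {n p : ℕ} (f : Fin (n + 1) → ℕ) (hf hb) (i : Fin (n + 1)) :
    val (homOfNat (p := p) f hf hb) i = f i := rfl

lemma mem_shuffles_val {n p q : ℕ} {s : (⦋n⦌ ⟶ ⦋p⦌) × (⦋n⦌ ⟶ ⦋q⦌)} :
    s ∈ shuffles n p q ↔ ∀ i : Fin (n + 1), val s.1 i + val s.2 i = (i : ℕ) := mem_shuffles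

lemma val_comp {n m p : ℕ} (β : ⦋n⦌ ⟶ ⦋m⦌) (α : ⦋m⦌ ⟶ ⦋p⦌) (i : Fin (n + 1)) :
    val (β ≫ α) i = val α (β.toOrderHom i) := rfl

lemma val_δ {n : ℕ} (k : Fin (n + 2)) (i : Fin (n + 1)) :
    val (SimplexCategory.δ k) i = if (i : ℕ) < k then (i : ℕ) else i + 1 := by
  change ((Fin.succAbove k i : Fin (n+2)) : ℕ) = _
  simp only [Fin.succAbove, Fin.lt_def]
  split_ifs <;> simp_all

lemma val_σ {n : ℕ} (k : Fin (n + 1)) (i : Fin (n + 2)) :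
    val (SimplexCategory.σ k) i = if (i : ℕ) ≤ k then (i : ℕ) else i - 1 := by
  change ((Fin.predAbove k i : Fin (n+1)) : ℕ) = _
  simp only [Fin.predAbove, Fin.lt_def]
  split_ifs <;> simp_all <;> simp_all; omega

lemma toOrderHom_eq {n p : ℕ} (α : ⦋n⦌ ⟶ ⦋p⦌) (i : Fin (n + 1)) :
    α.toOrderHom i = (⟨val α i, Nat.lt_succ_iff.mpr (val_le α i)⟩ : Fin (p + 1)) := rfl

lemma add_self_K {M : Type*} [AddCommGroup M] [Module K M] (x : M) : x + x = 0 := by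
  have : ((1 : K) + 1) • x = 0 := by
    rw [show (1 : K) + 1 = 0 from rfl, zero_smul]
  simpa [add_smul] using this

/-- The values of a simplicial operator, with natural numbers as arguments. -/
def ev {n p : ℕ} (α : ⦋n⦌ ⟶ ⦋p⦌) (i : ℕ) : ℕ := val α ⟨min i n, by omega⟩

lemma val_eq_ev {n p : ℕ} (α : ⦋n⦌ ⟶ ⦋p⦌) (i : Fin (n + 1)) : val α i = ev α i := by
  unfold ev; congr 1; ext; simp; omega

lemma ev_mono {n p : ℕ} (α : ⦋n⦌ ⟶ ⦋p⦌) {i j : ℕ} (h : i ≤ j) : ev α i ≤ ev α j :=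
  val_mono α (by simp; omega)

lemma ev_le {n p : ℕ} (α : ⦋n⦌ ⟶ ⦋p⦌) (i : ℕ) : ev α i ≤ p := val_le α _

lemma hom_ext_ev {n p : ℕ} {α β : ⦋n⦌ ⟶ ⦋p⦌} (h : ∀ i ≤ n, ev α i = ev β i) : α = β :=
  hom_ext_val fun i => by rw [val_eq_ev, val_eq_ev]; exact h i (by omega)

/-- A simplicial operator with given values. -/
def homOfEv {n p : ℕ} (f : ℕ → ℕ) (hf : ∀ i j, i ≤ j → j ≤ n → f i ≤ f j)
    (hb : ∀ i ≤ n, f i ≤ p) : ⦋n⦌ ⟶ ⦋p⦌ :=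
  homOfNat (fun i => f i) (fun i j h => hf i j h (by omega)) (fun i => hb i (by omega))

lemma ev_homOfEv {n p : ℕ} (f : ℕ → ℕ) (hf hb) (i : ℕ) (hi : i ≤ n) :
    ev (homOfEv (n := n) (p := p) f hf hb) i = f i := by
  change f (min i n) = f i
  rw [min_eq_left hi]

lemma ev_comp {n m p : ℕ} (β : ⦋n⦌ ⟶ ⦋m⦌) (α : ⦋m⦌ ⟶ ⦋p⦌) (i : ℕ) :
    ev (β ≫ α) i = ev α (ev β i) := by
  unfold ev
  rw [val_comp, val_eq_ev, toOrderHom_eq, ev]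

lemma ev_δ {n : ℕ} (k : Fin (n + 2)) (i : ℕ) (hi : i ≤ n) :
    ev (SimplexCategory.δ k) i = if i < (k : ℕ) then i else i + 1 := by
  unfold ev; rw [val_δ]; simp [min_eq_left hi]

lemma ev_σ {n : ℕ} (k : Fin (n + 1)) (i : ℕ) (hi : i ≤ n + 1) :
    ev (SimplexCategory.σ k) i = if i ≤ (k : ℕ) then i else i - 1 := by
  unfold ev; rw [val_σ]; simp [min_eq_left hi]

lemma mem_shuffles_ev {n p q : ℕ} {s : (⦋n⦌ ⟶ ⦋p⦌) × (⦋n⦌ ⟶ ⦋q⦌)} :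
    s ∈ shuffles n p q ↔ ∀ i ≤ n, ev s.1 i + ev s.2 i = i := by
  rw [mem_shuffles_val]
  constructor
  · intro h i hi
    have := h ⟨i, by omega⟩
    simpa [val_eq_ev] using this
  · intro h i
    rw [val_eq_ev, val_eq_ev]; exact h i (by omega)

/-- `α` takes its value at `k` only once. -/
def Iso1 {n p : ℕ} (α : ⦋n⦌ ⟶ ⦋p⦌) (k : ℕ) : Prop := ∀ i ≤ n, i ≠ k → ev α i ≠ ev α k

lemma ins_aux {n p q : ℕ} (h : p + 1 + q = n + 1) (j : Fin (p + 2)) (α : ⦋n⦌ ⟶ ⦋p⦌)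
    (β : ⦋n⦌ ⟶ ⦋q⦌) (hs : ∀ i ≤ n, ev α i + ev β i = i) :
    ∃ (k : Fin (n + 2)) (α' : ⦋n + 1⦌ ⟶ ⦋p + 1⦌) (β' : ⦋n + 1⦌ ⟶ ⦋q⦌),
      (∀ i ≤ n + 1, ev α' i + ev β' i = i) ∧ Iso1 α' k ∧ ev α' k = j ∧
      SimplexCategory.δ k ≫ α' = α ≫ SimplexCategory.δ j ∧
      SimplexCategory.δ k ≫ β' = β := by
  classical
  have hex : ∃ k, n < k ∨ (j : ℕ) ≤ ev α k := ⟨n + 1, Or.inl (by omega)⟩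
  obtain ⟨k, hk1, hk2, hk3⟩ : ∃ k ≤ n + 1, (∀ i < k, ev α i < j) ∧
      (k ≤ n → (j : ℕ) ≤ ev α k) := by
    refine ⟨Nat.find hex, Nat.find_min' hex (Or.inl (by omega)), fun i hi => ?_, fun hk => ?_⟩
    · have := Nat.find_min hex hi
      push Not at this; exact this.2
    · rcases Nat.find_spec hex with h' | h'
      · omega
      · exact h'
  have hj : (j : ℕ) ≤ p + 1 := by omega
  have hn := hs n le_rfl
  have hβn := ev_le β n
  have hαn := ev_le α n
  have hjk : (j : ℕ) ≤ k := by
    by_cases hkn : k ≤ n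
    · have := hk3 hkn; have := hs k hkn; omega
    · omega
  -- value just before `k`
  have hb1 : ∀ i, i < k → ev β i + j ≤ k := by
    intro i hi
    have h1 : ev β i ≤ ev β (k - 1) := ev_mono β (by omega)
    have h2 := hs (k - 1) (by omega)
    by_cases hkn : k ≤ n
    · have h3 := hk3 hkn; have h4 := hs k hkn
      have h5 : ev β (k-1) ≤ ev β k := ev_mono β (by omega)
      omega
    · have : k - 1 = n := by omega
      rw [this] at h1 h2
      omega
  have hb2 : ∀ i, k ≤ i → i ≤ n → k ≤ ev β i + j := by
    intro i hi hin
    have h1 : ev β k ≤ ev β i := ev_mono β hi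
    have h2 := hs k (by omega)
    rcases Nat.eq_zero_or_pos k with h0 | h0
    · omega
    · have h3 := hk2 (k-1) (by omega)
      have h4 := hs (k-1) (by omega)
      have h5 : ev β (k-1) ≤ ev β k := ev_mono β (by omega)
      omega
  have ha2 : ∀ i, k ≤ i → i ≤ n → (j : ℕ) ≤ ev α i := fun i hi hin =>
    (hk3 (by omega)).trans (ev_mono α hi)
  let fa : ℕ → ℕ := fun i => if i < k then ev α i else if i = k then j else ev α (i - 1) + 1
  let fb : ℕ → ℕ := fun i => if i < k then ev β i else if i = k then k - j else ev β (i - 1)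
  have hfa : ∀ i l, i ≤ l → l ≤ n + 1 → fa i ≤ fa l := by
    intro i l hil hl
    simp only [fa]
    have m1 := ev_mono α hil
    have m2 : ev α (i - 1) ≤ ev α (l - 1) := ev_mono α (by omega)
    have h1 := hk2 i
    have h2 := ha2 (l - 1)
    split_ifs <;> omega
  have hfa' : ∀ i ≤ n + 1, fa i ≤ p + 1 := by
    intro i hi
    simp only [fa]
    have := ev_le α i
    have := ev_le α (i - 1)
    split_ifs <;> omega
  have hfb : ∀ i l, i ≤ l → l ≤ n + 1 → fb i ≤ fb l := by
    intro i l hil hl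
    simp only [fb]
    have m1 := ev_mono β hil
    have m2 : ev β (i - 1) ≤ ev β (l - 1) := ev_mono β (by omega)
    have h1 := hb1 i
    have h2 := hb2 (l - 1)
    have m3 := @ev_mono _ _ β i (l-1)
    split_ifs <;> omega
  have hfb' : ∀ i ≤ n + 1, fb i ≤ q := by
    intro i hi
    simp only [fb]
    have := ev_le β i
    have := ev_le β (i - 1)
    have h2 := hb2 k le_rfl
    have h3 := ev_le β k
    have h4 := hk2 n
    split_ifs <;> omega
  refine ⟨⟨k, by omega⟩, homOfEv fa hfa hfa', homOfEv fb hfb hfb', ?_, ?_, ?_, ?_, ?_⟩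
  · intro i hi
    rw [ev_homOfEv _ _ _ _ hi, ev_homOfEv _ _ _ _ hi]
    simp only [fa, fb]
    have h1 := hs i
    have h2 := hs (i - 1)
    split_ifs <;> omega
  · intro i hi hik
    rw [ev_homOfEv _ _ _ _ hi, ev_homOfEv _ _ _ _ hk1]
    simp only [fa]
    have h1 := hk2 i
    have h2 := ha2 (i - 1)
    have hik' : i ≠ k := hik
    split_ifs <;> omega
  · rw [ev_homOfEv _ _ _ _ hk1]; simp [fa]
  · refine hom_ext_ev fun i hi => ?_
    rw [ev_comp, ev_comp, ev_δ _ _ hi, ev_δ _ _ (ev_le _ _), ev_homOfEv _ _ _ _ (by split_ifs <;> omega)]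
    simp only [fa]
    have h1 := hk2 i
    have h2 := ha2 i
    by_cases hik : i < k
    · rw [if_pos hik, if_pos hik, if_pos (h1 hik)]
    · rw [if_neg hik, if_neg (by omega), if_neg (by omega), if_neg (by omega)]; rfl
  · refine hom_ext_ev fun i hi => ?_
    rw [ev_comp, ev_δ _ _ hi, ev_homOfEv _ _ _ _ (by split_ifs <;> omega)]
    simp only [fb]
    by_cases hik : i < k
    · simp [hik]
    · rw [if_neg hik, if_neg (by omega), if_neg (by omega)]; rfl

lemma ins_unique {n p q : ℕ} (k k' : Fin (n + 2)) (α α' : ⦋n + 1⦌ ⟶ ⦋p⦌)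
    (β β' : ⦋n + 1⦌ ⟶ ⦋q⦌)
    (hs : ∀ i ≤ n + 1, ev α i + ev β i = i) (hs' : ∀ i ≤ n + 1, ev α' i + ev β' i = i)
    (hα : SimplexCategory.δ k ≫ α = SimplexCategory.δ k' ≫ α')
    (hβ : SimplexCategory.δ k ≫ β = SimplexCategory.δ k' ≫ β')
    (hk : ev α k = ev α' k') : k = k' ∧ α = α' ∧ β = β' := by
  have ea : ∀ i ≤ n, ev α (if i < (k : ℕ) then i else i + 1) =
      ev α' (if i < (k' : ℕ) then i else i + 1) := fun i hi => by
    have := congrArg (fun f => ev f i) hα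
    simpa only [ev_comp, ev_δ _ _ hi] using this
  have eb : ∀ i ≤ n, ev β (if i < (k : ℕ) then i else i + 1) =
      ev β' (if i < (k' : ℕ) then i else i + 1) := fun i hi => by
    have := congrArg (fun f => ev f i) hβ
    simpa only [ev_comp, ev_δ _ _ hi] using this
  have ek : (k : ℕ) = k' := by
    rcases lt_trichotomy (k : ℕ) k' with h | h | h
    · have h1 := ea k (by omega)
      have h2 := eb k (by omega)
      have h3 := hs (k + 1) (by omega)
      have h4 := hs' k (by omega)
      simp [h] at h1 h2
      omega
    · exact h
    · have h1 := ea k' (by omega)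
      have h2 := eb k' (by omega)
      have h3 := hs' (k' + 1) (by omega)
      have h4 := hs k' (by omega)
      simp [h] at h1 h2
      omega
  obtain rfl : k = k' := Fin.ext ek
  have eα : ∀ i ≤ n + 1, ev α i = ev α' i := by
    intro i hi
    rcases lt_trichotomy i (k : ℕ) with h | h | h
    · have := ea i (by omega); simpa [h] using this
    · rw [h, hk]
    · have := ea (i - 1) (by omega)
      rw [if_neg (by omega), show i - 1 + 1 = i by omega] at this
      exact this
  refine ⟨rfl, hom_ext_ev eα, hom_ext_ev fun i hi => ?_⟩
  have h1 := hs i hi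
  have h2 := hs' i hi
  have h3 := eα i hi
  omega

lemma del_aux {n p q : ℕ} (k : Fin (n + 2)) (α : ⦋n + 1⦌ ⟶ ⦋p + 1⦌) (β : ⦋n + 1⦌ ⟶ ⦋q⦌)
    (hs : ∀ i ≤ n + 1, ev α i + ev β i = i) (hk : Iso1 α k) (h : p + 1 + q = n + 1) :
    ∃ α' : ⦋n⦌ ⟶ ⦋p⦌, (∀ i ≤ n, ev α' i + ev (SimplexCategory.δ k ≫ β) i = i) ∧
      α' ≫ SimplexCategory.δ (⟨ev α k, Nat.lt_succ_iff.mpr (ev_le _ _)⟩ : Fin (p + 2)) =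
        SimplexCategory.δ k ≫ α := by
  let f : ℕ → ℕ := fun i => if i < (k : ℕ) then ev α i else ev α (i + 1) - 1
  have hlt : ∀ i < (k : ℕ), ev α i < ev α k := fun i hi =>
    lt_of_le_of_ne (ev_mono α hi.le) (hk i (by omega) (by omega))
  have hgt : ∀ i ≤ n + 1, (k : ℕ) < i → ev α k < ev α i := fun i hi hi' =>
    lt_of_le_of_ne (ev_mono α hi'.le) (hk i hi (by omega)).symm
  have hf : ∀ i j, i ≤ j → j ≤ n → f i ≤ f j := by
    intro i j hij hj
    have h1 := hlt i
    have h2 := hgt (j + 1) (by omega)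
    have h3 := ev_mono α hij
    have h4 : ev α (i + 1) ≤ ev α (j + 1) := ev_mono α (by omega)
    simp only [f]
    split_ifs <;> omega
  have hb : ∀ i ≤ n, f i ≤ p := by
    intro i hi
    have h1 := hlt i
    have h2 := ev_le α k
    have h3 := ev_le α (i + 1)
    simp only [f]
    split_ifs <;> omega
  refine ⟨homOfEv f hf hb, fun i hi => ?_, hom_ext_ev fun i hi => ?_⟩
  · rw [ev_homOfEv _ _ _ _ hi, ev_comp, ev_δ _ _ hi]
    have h1 := hs i
    have h2 := hs (i + 1)
    have h3 := hgt (i + 1)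
    simp only [f]
    split_ifs <;> omega
  · rw [ev_comp, ev_comp, ev_δ _ _ hi, ev_δ _ _ (ev_le _ _), ev_homOfEv _ _ _ _ hi]
    have h1 := hlt i
    have h3 := hgt (i + 1)
    simp only [f]
    split_ifs <;> omega

open Classical in
lemma sum_iso1 {M : Type*} [AddCommGroup M] {n p q : ℕ} (h : p + 1 + q = n + 1)
    (G : (⦋n⦌ ⟶ ⦋p + 1⦌) × (⦋n⦌ ⟶ ⦋q⦌) → M) :
    ∑ x ∈ (Finset.univ ×ˢ shuffles (n + 1) (p + 1) q).filter
        (fun x : Fin (n + 2) × _ => Iso1 x.2.1 x.1),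
      G (SimplexCategory.δ x.1 ≫ x.2.1, SimplexCategory.δ x.1 ≫ x.2.2) =
    ∑ y ∈ (Finset.univ : Finset (Fin (p + 2))) ×ˢ shuffles n p q,
      G (y.2.1 ≫ SimplexCategory.δ y.1, y.2.2) := by
  have hd := fun (x : Fin (n + 2) × ((⦋n + 1⦌ ⟶ ⦋p + 1⦌) × (⦋n + 1⦌ ⟶ ⦋q⦌)))
      (hx : x ∈ (Finset.univ ×ˢ shuffles (n + 1) (p + 1) q).filter
        (fun x : Fin (n + 2) × _ => Iso1 x.2.1 x.1)) =>
    del_aux x.1 x.2.1 x.2.2 (mem_shuffles_ev.mp (Finset.mem_product.mp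
      (Finset.mem_filter.mp hx).1).2) (Finset.mem_filter.mp hx).2 h
  choose f hf1 hf2 using hd
  refine Finset.sum_bij (fun x hx => (⟨ev x.2.1 x.1, Nat.lt_succ_iff.mpr (ev_le _ _)⟩,
    (f x hx, SimplexCategory.δ x.1 ≫ x.2.2))) ?_ ?_ ?_ ?_
  · intro x hx
    simp only [Finset.mem_product, Finset.mem_univ, true_and, mem_shuffles_ev]
    exact hf1 x hx
  · intro x hx x' hx' heq
    simp only [Prod.mk.injEq] at heq
    obtain ⟨h1, h2, h3⟩ := heq
    have e1 := hf2 x hx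
    have e2 := hf2 x' hx'
    rw [h1, h2] at e1
    have := ins_unique x.1 x'.1 x.2.1 x'.2.1 x.2.2 x'.2.2
      (mem_shuffles_ev.mp (Finset.mem_product.mp (Finset.mem_filter.mp hx).1).2)
      (mem_shuffles_ev.mp (Finset.mem_product.mp (Finset.mem_filter.mp hx').1).2)
      (e1.symm.trans e2) h3 (congrArg Fin.val h1)
    exact Prod.ext this.1 (Prod.ext this.2.1 this.2.2)
  · rintro ⟨j, α, β⟩ hy
    simp only [Finset.mem_product, Finset.mem_univ, true_and, mem_shuffles_ev] at hy
    obtain ⟨k, α', β', h1, h2, h3, h4, h5⟩ := ins_aux h j α β hy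
    have hx : (k, α', β') ∈ (Finset.univ ×ˢ shuffles (n + 1) (p + 1) q).filter
        (fun x : Fin (n + 2) × _ => Iso1 x.2.1 x.1) := by
      simp only [Finset.mem_filter, Finset.mem_product, Finset.mem_univ, true_and,
        mem_shuffles_ev]
      exact ⟨h1, h2⟩
    refine ⟨_, hx, ?_⟩
    have e := hf2 _ hx
    have hj : (⟨ev α' k, Nat.lt_succ_iff.mpr (ev_le _ _)⟩ : Fin (p + 2)) = j := Fin.ext h3
    refine Prod.ext hj (Prod.ext ?_ h5)
    simp only [hj] at e
    rw [h4] at e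
    exact (cancel_mono _).mp e
  · intro x hx
    rw [hf2 x hx]

lemma shuffles_swap {n p q : ℕ} {s : (⦋n⦌ ⟶ ⦋p⦌) × (⦋n⦌ ⟶ ⦋q⦌)} :
    s.swap ∈ shuffles n q p ↔ s ∈ shuffles n p q := by
  simp only [mem_shuffles, Prod.fst_swap, Prod.snd_swap, add_comm]

open Classical in
lemma sum_iso2 {M : Type*} [AddCommGroup M] {n p q : ℕ} (h : p + (q + 1) = n + 1)
    (G : (⦋n⦌ ⟶ ⦋p⦌) × (⦋n⦌ ⟶ ⦋q + 1⦌) → M) :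
    ∑ x ∈ (Finset.univ ×ˢ shuffles (n + 1) p (q + 1)).filter
        (fun x : Fin (n + 2) × _ => Iso1 x.2.2 x.1),
      G (SimplexCategory.δ x.1 ≫ x.2.1, SimplexCategory.δ x.1 ≫ x.2.2) =
    ∑ y ∈ (Finset.univ : Finset (Fin (q + 2))) ×ˢ shuffles n p q,
      G (y.2.1, y.2.2 ≫ SimplexCategory.δ y.1) := by
  refine Eq.trans ?_ ((sum_iso1 (by omega : q + 1 + p = n + 1) (fun s => G s.swap)).trans ?_)
  · refine Finset.sum_nbij' (fun x => (x.1, x.2.swap)) (fun x => (x.1, x.2.swap)) ?_ ?_ ?_ ?_ ?_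
    all_goals simp +contextual [shuffles_swap]
  · refine Finset.sum_nbij' (fun x => (x.1, x.2.swap)) (fun x => (x.1, x.2.swap)) ?_ ?_ ?_ ?_ ?_
    all_goals simp +contextual [shuffles_swap]

lemma flip_aux {n p q : ℕ} (k : Fin (n + 2)) (α : ⦋n + 1⦌ ⟶ ⦋p⦌) (β : ⦋n + 1⦌ ⟶ ⦋q⦌)
    (hs : ∀ i ≤ n + 1, ev α i + ev β i = i) (hα : ¬ Iso1 α k) (hβ : ¬ Iso1 β k) :
    ∃ (α' : ⦋n + 1⦌ ⟶ ⦋p⦌) (β' : ⦋n + 1⦌ ⟶ ⦋q⦌),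
      (∀ i ≤ n + 1, ev α' i + ev β' i = i) ∧ ¬ Iso1 α' k ∧ ¬ Iso1 β' k ∧
      (∀ i ≤ n + 1, i ≠ k → ev α' i = ev α i) ∧
      ev α' k + ev α k = ev α (k - 1) + ev α (k + 1) ∧ ev α' k ≠ ev α k ∧
      (1 ≤ (k : ℕ) ∧ (k : ℕ) ≤ n) := by
  unfold Iso1 at hα hβ
  push Not at hα hβ
  obtain ⟨i, hi, hik, ei⟩ := hα
  obtain ⟨i', hi', hik', ei'⟩ := hβ
  have hkn : (k : ℕ) ≤ n + 1 := by omega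
  have hsk := hs k hkn
  have ha0 : i < k → ev α (k - 1) = ev α k := fun h =>
    le_antisymm (ev_mono α (by omega)) (ei ▸ ev_mono α (by omega))
  have ha1 : (k : ℕ) < i → ev α (k + 1) = ev α k := fun h =>
    le_antisymm (ei ▸ ev_mono α (by omega)) (ev_mono α (by omega))
  have hb0 : i' < k → ev β (k - 1) = ev β k := fun h =>
    le_antisymm (ev_mono β (by omega)) (ei' ▸ ev_mono β (by omega))
  have hb1 : (k : ℕ) < i' → ev β (k + 1) = ev β k := fun h =>
    le_antisymm (ei' ▸ ev_mono β (by omega)) (ev_mono β (by omega))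
  have s0 := hs (k - 1)
  have s1 := hs (k + 1)
  have hk : 1 ≤ (k : ℕ) ∧ (k : ℕ) ≤ n := by omega
  have hA : (ev α (k - 1) = ev α k ∧ ev α (k + 1) = ev α k + 1 ∧ ev β (k - 1) + 1 = ev β k ∧
      ev β (k + 1) = ev β k) ∨ (ev α (k - 1) + 1 = ev α k ∧ ev α (k + 1) = ev α k ∧
      ev β (k - 1) = ev β k ∧ ev β (k + 1) = ev β k + 1) := by omega
  clear ha0 ha1 hb0 hb1 ei ei' hik hik' hi hi' i i'
  let fa : ℕ → ℕ := fun i => if i = k then ev α (k - 1) + ev α (k + 1) - ev α k else ev α i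
  let fb : ℕ → ℕ := fun i => if i = k then ev β (k - 1) + ev β (k + 1) - ev β k else ev β i
  have hfa : ∀ i j, i ≤ j → j ≤ n + 1 → fa i ≤ fa j := by
    intro i j hij hj
    have m1 := ev_mono α hij
    have m2 := @ev_mono _ _ α i (k - 1)
    have m3 := @ev_mono _ _ α (k + 1) j
    simp only [fa]
    split_ifs <;> omega
  have hfb : ∀ i j, i ≤ j → j ≤ n + 1 → fb i ≤ fb j := by
    intro i j hij hj
    have m1 := ev_mono β hij
    have m2 := @ev_mono _ _ β i (k - 1)
    have m3 := @ev_mono _ _ β (k + 1) j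
    simp only [fb]
    split_ifs <;> omega
  have hfa' : ∀ i ≤ n + 1, fa i ≤ p := by
    intro i hi
    have := ev_le α i
    have := ev_le α (k + 1)
    simp only [fa]
    split_ifs <;> omega
  have hfb' : ∀ i ≤ n + 1, fb i ≤ q := by
    intro i hi
    have := ev_le β i
    have := ev_le β (k + 1)
    simp only [fb]
    split_ifs <;> omega
  have e1 : ev (homOfEv fa hfa hfa') k = ev α (k - 1) + ev α (k + 1) - ev α k := by
    rw [ev_homOfEv _ _ _ _ hkn]; simp [fa]
  have e2 : ev (homOfEv fb hfb hfb') k = ev β (k - 1) + ev β (k + 1) - ev β k := by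
    rw [ev_homOfEv _ _ _ _ hkn]; simp [fb]
  have e3 : ∀ i ≤ n + 1, i ≠ k → ev (homOfEv fa hfa hfa') i = ev α i := fun i hi hik => by
    rw [ev_homOfEv _ _ _ _ hi]; simp [fa, hik]
  have e4 : ∀ i ≤ n + 1, i ≠ k → ev (homOfEv fb hfb hfb') i = ev β i := fun i hi hik => by
    rw [ev_homOfEv _ _ _ _ hi]; simp [fb, hik]
  refine ⟨homOfEv fa hfa hfa', homOfEv fb hfb hfb', ?_, ?_, ?_, e3, ?_, ?_, hk⟩
  · intro i hi
    by_cases hik : i = k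
    · rw [hik, e1, e2]; omega
    · rw [e3 i hi hik, e4 i hi hik]; exact hs i hi
  · unfold Iso1
    push Not
    rcases hA with h | h
    · refine ⟨k + 1, by omega, by omega, ?_⟩
      rw [e3 _ (by omega) (by omega), e1]; omega
    · refine ⟨k - 1, by omega, by omega, ?_⟩
      rw [e3 _ (by omega) (by omega), e1]; omega
  · unfold Iso1
    push Not
    rcases hA with h | h
    · refine ⟨k - 1, by omega, by omega, ?_⟩
      rw [e4 _ (by omega) (by omega), e2]; omega
    · refine ⟨k + 1, by omega, by omega, ?_⟩
      rw [e4 _ (by omega) (by omega), e2]; omega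
  · rw [e1]; omega
  · rw [e1]; omega

open Classical in
lemma sum_flip {M : Type*} [AddCommGroup M] [Module K M] {n p q : ℕ}
    (G : (⦋n⦌ ⟶ ⦋p⦌) × (⦋n⦌ ⟶ ⦋q⦌) → M) :
    ∑ x ∈ (Finset.univ ×ˢ shuffles (n + 1) p q).filter
        (fun x : Fin (n + 2) × _ => ¬ Iso1 x.2.1 x.1 ∧ ¬ Iso1 x.2.2 x.1),
      G (SimplexCategory.δ x.1 ≫ x.2.1, SimplexCategory.δ x.1 ≫ x.2.2) = 0 := by
  have hd := fun (x : Fin (n + 2) × ((⦋n + 1⦌ ⟶ ⦋p⦌) × (⦋n + 1⦌ ⟶ ⦋q⦌)))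
      (hx : x ∈ (Finset.univ ×ˢ shuffles (n + 1) p q).filter
        (fun x : Fin (n + 2) × _ => ¬ Iso1 x.2.1 x.1 ∧ ¬ Iso1 x.2.2 x.1)) =>
    flip_aux x.1 x.2.1 x.2.2 (mem_shuffles_ev.mp (Finset.mem_product.mp
      (Finset.mem_filter.mp hx).1).2) (Finset.mem_filter.mp hx).2.1 (Finset.mem_filter.mp hx).2.2
  have hm : ∀ x ∈ (Finset.univ ×ˢ shuffles (n + 1) p q).filter
        (fun x : Fin (n + 2) × _ => ¬ Iso1 x.2.1 x.1 ∧ ¬ Iso1 x.2.2 x.1),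
      ∀ i ≤ n + 1, ev x.2.1 i + ev x.2.2 i = i := fun x hx =>
    mem_shuffles_ev.mp (Finset.mem_product.mp (Finset.mem_filter.mp hx).1).2
  choose f g h1 h2 h3 h4 h5 h6 h7 using hd
  have hmem : ∀ x hx, (x.1, f x hx, g x hx) ∈ (Finset.univ ×ˢ shuffles (n + 1) p q).filter
        (fun x : Fin (n + 2) × _ => ¬ Iso1 x.2.1 x.1 ∧ ¬ Iso1 x.2.2 x.1) := by
    intro x hx
    simp only [Finset.mem_filter, Finset.mem_product, Finset.mem_univ, true_and, mem_shuffles_ev]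
    exact ⟨h1 x hx, h2 x hx, h3 x hx⟩
  have hβ : ∀ x hx, ∀ i ≤ n + 1, i ≠ x.1 → ev (g x hx) i = ev x.2.2 i := by
    intro x hx i hi hik
    have e1 := hm x hx i hi
    have e2 := h1 x hx i hi
    have e3 := h4 x hx i hi hik
    omega
  refine Finset.sum_involution (fun x hx => (x.1, f x hx, g x hx)) ?_ ?_ hmem ?_
  · intro x hx
    have ea : SimplexCategory.δ x.1 ≫ f x hx = SimplexCategory.δ x.1 ≫ x.2.1 := by
      refine hom_ext_ev fun i hi => ?_
      rw [ev_comp, ev_comp, ev_δ _ _ hi]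
      exact h4 x hx _ (by split_ifs <;> omega) (by split_ifs <;> omega)
    have eb : SimplexCategory.δ x.1 ≫ g x hx = SimplexCategory.δ x.1 ≫ x.2.2 := by
      refine hom_ext_ev fun i hi => ?_
      rw [ev_comp, ev_comp, ev_δ _ _ hi]
      exact hβ x hx _ (by split_ifs <;> omega) (by split_ifs <;> omega)
    simp only [ea, eb]
    exact add_self_K _
  · intro x hx _ heq
    apply h6 x hx
    have := congrArg (fun y => ev y.2.1 x.1) heq
    exact this
  · intro x hx
    have hx' := hmem x hx
    have hk : ((x.1 : Fin (n + 2)) : ℕ) ≤ n + 1 := by omega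
    have a5 := h5 x hx
    have b5 : ev (f _ hx') x.1 + ev (f x hx) x.1 = ev (f x hx) (x.1 - 1) + ev (f x hx) (x.1 + 1) :=
      h5 _ hx'
    have c1 := h7 x hx
    have c2 := h4 x hx (x.1 - 1) (by omega) (by omega)
    have c3 := h4 x hx (x.1 + 1) (by omega) (by omega)
    have E : ∀ i ≤ n + 1, ev (f _ hx') i = ev x.2.1 i := by
      intro i hi
      by_cases hik : i = x.1
      · subst hik; omega
      · exact (h4 _ hx' i hi hik).trans (h4 x hx i hi hik)
    refine Prod.ext rfl (Prod.ext (hom_ext_ev E) (hom_ext_ev fun i hi => ?_))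
    have e1 := h1 _ hx' i hi
    have e2 := hm x hx i hi
    have e3 := E i hi
    simp only
    omega

/-- The faces of all `(p,q)`-shuffles, summed in characteristic two. -/
lemma sum_shuffles_face {M : Type*} [AddCommGroup M] [Module K M] {n p q : ℕ} (h : p + q = n + 1)
    (G : (⦋n⦌ ⟶ ⦋p⦌) × (⦋n⦌ ⟶ ⦋q⦌) → M) (A B : M)
    (hA : ∀ p' (e : p = p' + 1), A = ∑ y ∈ (Finset.univ : Finset (Fin (p' + 2))) ×ˢ shuffles n p' q,
      G (y.2.1 ≫ SimplexCategory.δ y.1 ≫ eqToHom (by rw [e]), y.2.2))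
    (hA0 : p = 0 → A = 0)
    (hB : ∀ q' (e : q = q' + 1), B = ∑ y ∈ (Finset.univ : Finset (Fin (q' + 2))) ×ˢ shuffles n p q',
      G (y.2.1, y.2.2 ≫ SimplexCategory.δ y.1 ≫ eqToHom (by rw [e])))
    (hB0 : q = 0 → B = 0) :
    ∑ k : Fin (n + 2), ∑ s ∈ shuffles (n + 1) p q,
      G (SimplexCategory.δ k ≫ s.1, SimplexCategory.δ k ≫ s.2) = A + B := by
  classical
  rw [← Finset.sum_product']
  have hiso : ∀ {p : ℕ} (α : ⦋n + 1⦌ ⟶ ⦋p⦌) (k : Fin (n + 2)), p = 0 → ¬ Iso1 α k := by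
    intro p α k hp hα
    have h1 := ev_le α (if (k : ℕ) = 0 then 1 else 0)
    have h2 := ev_le α k
    exact hα (if (k : ℕ) = 0 then 1 else 0) (by split_ifs <;> omega) (by split_ifs <;> omega)
      (by omega)
  have eA : A = ∑ x ∈ (Finset.univ ×ˢ shuffles (n + 1) p q).filter
        (fun x : Fin (n + 2) × _ => Iso1 x.2.1 x.1),
      G (SimplexCategory.δ x.1 ≫ x.2.1, SimplexCategory.δ x.1 ≫ x.2.2) := by
    rcases p with _ | p
    · rw [hA0 rfl]
      symm
      exact Finset.sum_eq_zero fun x hx => absurd (Finset.mem_filter.mp hx).2 (hiso _ _ rfl)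
    · rw [hA p rfl, sum_iso1 h]
      simp
  have eB : B = ∑ x ∈ (Finset.univ ×ˢ shuffles (n + 1) p q).filter
        (fun x : Fin (n + 2) × _ => Iso1 x.2.2 x.1),
      G (SimplexCategory.δ x.1 ≫ x.2.1, SimplexCategory.δ x.1 ≫ x.2.2) := by
    rcases q with _ | q
    · rw [hB0 rfl]
      symm
      exact Finset.sum_eq_zero fun x hx => absurd (Finset.mem_filter.mp hx).2 (hiso _ _ rfl)
    · rw [hB q rfl, sum_iso2 h]
      simp
  have hdis : ∀ x ∈ (Finset.univ : Finset (Fin (n + 2))) ×ˢ shuffles (n + 1) p q,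
      Iso1 x.2.1 x.1 → ¬ Iso1 x.2.2 x.1 := by
    intro x hx h1 h2
    have hs := mem_shuffles_ev.mp (Finset.mem_product.mp hx).2
    by_cases h0 : (x.1 : ℕ) = 0
    · have a := h1 1 (by omega) (by omega)
      have b := h2 1 (by omega) (by omega)
      have c := hs 1 (by omega)
      have d := hs 0 (by omega)
      rw [h0] at a b
      omega
    · have a := h1 (x.1 - 1) (by omega) (by omega)
      have b := h2 (x.1 - 1) (by omega) (by omega)
      have c := hs x.1 (by omega)
      have d := hs (x.1 - 1) (by omega)
      have e : ev x.2.1 (x.1 - 1) ≤ ev x.2.1 x.1 := ev_mono _ (by omega)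
      have f : ev x.2.2 (x.1 - 1) ≤ ev x.2.2 x.1 := ev_mono _ (by omega)
      omega
  rw [eA, eB, ← Finset.sum_filter_add_sum_filter_not _
    (fun x : Fin (n + 2) × _ => Iso1 x.2.1 x.1)]
  congr 1
  rw [← Finset.sum_filter_add_sum_filter_not _
    (fun x : Fin (n + 2) × _ => Iso1 x.2.2 x.1), Finset.filter_filter, Finset.filter_filter,
    sum_flip, add_zero]
  refine Finset.sum_congr (Finset.filter_congr fun x hx => ?_) fun _ _ => rfl
  exact ⟨fun h => h.2, fun h => ⟨fun h' => hdis x hx h' h, h⟩⟩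

end

section

/-! ### Subquotients -/

section SubQ
variable {A A' A'' : Type*} [AddCommGroup A] [Module K A] [AddCommGroup A'] [Module K A']
  [AddCommGroup A''] [Module K A'']

/-- The subquotient `Z / (Z ∩ B)` of a vector space, which is `Z / B` when `B ≤ Z`. -/
abbrev SubQ (Z B : Submodule K A) : Type _ := ↥Z ⧸ B.submoduleOf Z

/-- The class of an element of `Z`. -/
def SubQ.mk {Z : Submodule K A} (B : Submodule K A) (x : A) (hx : x ∈ Z) : SubQ Z B :=
  Submodule.Quotient.mk ⟨x, hx⟩

lemma SubQ.mk_eq_mk {Z B : Submodule K A} {x y : A} {hx : x ∈ Z} {hy : y ∈ Z} :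
    SubQ.mk B x hx = SubQ.mk B y hy ↔ x - y ∈ B := by
  unfold SubQ.mk
  rw [Submodule.Quotient.eq]
  rfl

lemma SubQ.mk_eq_zero {Z B : Submodule K A} {x : A} {hx : x ∈ Z} :
    SubQ.mk B x hx = 0 ↔ x ∈ B := by
  unfold SubQ.mk
  rw [Submodule.Quotient.mk_eq_zero]
  rfl

lemma SubQ.exists_rep {Z B : Submodule K A} (a : SubQ Z B) : ∃ x hx, SubQ.mk B x hx = a := by
  obtain ⟨⟨x, hx⟩, rfl⟩ := Submodule.Quotient.mk_surjective _ a
  exact ⟨x, hx, rfl⟩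

/-- The map induced on subquotients by a linear map. -/
def SubQ.map {Z B : Submodule K A} {Z' B' : Submodule K A'} (f : A →ₗ[K] A')
    (hZ : ∀ x ∈ Z, f x ∈ Z') (hB : ∀ x ∈ Z, x ∈ B → f x ∈ B') : SubQ Z B →ₗ[K] SubQ Z' B' :=
  Submodule.mapQ _ _ (f.restrict hZ) fun x hx => hB x.1 x.2 hx

lemma SubQ.map_mk {Z B : Submodule K A} {Z' B' : Submodule K A'} (f : A →ₗ[K] A')
    (hZ : ∀ x ∈ Z, f x ∈ Z') (hB : ∀ x ∈ Z, x ∈ B → f x ∈ B') (x : A) (hx : x ∈ Z) :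
    SubQ.map f hZ hB (SubQ.mk B x hx) = SubQ.mk B' (f x) (hZ x hx) := rfl

/-- The map induced on subquotients by a bilinear map. -/
def SubQ.map₂ {Z B : Submodule K A} {Z' B' : Submodule K A'} {Z'' B'' : Submodule K A''}
    (f : A →ₗ[K] A' →ₗ[K] A'') (hZ : ∀ x ∈ Z, ∀ y ∈ Z', f x y ∈ Z'')
    (hB : ∀ x ∈ Z, x ∈ B → ∀ y ∈ Z', f x y ∈ B'')
    (hB' : ∀ x ∈ Z, ∀ y ∈ Z', y ∈ B' → f x y ∈ B'') :
    SubQ Z B →ₗ[K] SubQ Z' B' →ₗ[K] SubQ Z'' B'' :=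
  Submodule.liftQ _
    (LinearMap.mk₂ K (fun (x : Z) (y : SubQ Z' B') =>
        SubQ.map (f x.1) (hZ x.1 x.2) (hB' x.1 x.2) y)
      (by
        intro x x' y; obtain ⟨y, hy, rfl⟩ := SubQ.exists_rep y
        simp only [SubQ.map_mk, Submodule.coe_add, map_add, LinearMap.add_apply]; rfl)
      (by
        intro c x y; obtain ⟨y, hy, rfl⟩ := SubQ.exists_rep y
        simp only [SubQ.map_mk, Submodule.coe_smul, map_smul, LinearMap.smul_apply]; rfl)
      (by intro x y y'; exact map_add _ _ _)
      (by intro c x y; exact map_smul _ _ _))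
    (by
      intro x hx
      rw [LinearMap.mem_ker]
      refine LinearMap.ext fun y => ?_
      obtain ⟨y, rfl⟩ := Submodule.Quotient.mk_surjective _ y
      exact SubQ.mk_eq_zero.mpr (hB x.1 x.2 hx y.1 y.2))

lemma SubQ.map₂_mk {Z B : Submodule K A} {Z' B' : Submodule K A'} {Z'' B'' : Submodule K A''}
    (f : A →ₗ[K] A' →ₗ[K] A'') (hZ : ∀ x ∈ Z, ∀ y ∈ Z', f x y ∈ Z'')
    (hB : ∀ x ∈ Z, x ∈ B → ∀ y ∈ Z', f x y ∈ B'')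
    (hB' : ∀ x ∈ Z, ∀ y ∈ Z', y ∈ B' → f x y ∈ B'') (x : A) (hx : x ∈ Z) (y : A') (hy : y ∈ Z') :
    SubQ.map₂ f hZ hB hB' (SubQ.mk B x hx) (SubQ.mk B' y hy) =
      SubQ.mk B'' (f x y) (hZ x hx y hy) := rfl

end SubQ

/-! ### Normalized chains -/

/-- The normalized chains `S_n(Z) = N_n(𝔽₂ Z)`: chains modulo degenerate simplices. -/
abbrev S (Z : SSet.{u}) (n : ℕ) : Type u :=
  (Z _⦋n⦌ →₀ K) ⧸ Submodule.span K ((fun x => Finsupp.single x (1 : K)) '' Z.degenerate n)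

/-- The normalized chain given by a simplex. -/
def sm {Z : SSet.{u}} {n : ℕ} (x : Z _⦋n⦌) : S Z n := Submodule.Quotient.mk (Finsupp.single x 1)

lemma sm_degenerate {Z : SSet.{u}} {n : ℕ} {x : Z _⦋n⦌} (hx : x ∈ Z.degenerate n) : sm x = 0 :=
  (Submodule.Quotient.mk_eq_zero _).mpr (Submodule.subset_span ⟨x, hx, rfl⟩)

/-- Linear maps out of `S Z n`. -/
def S.lift {Z : SSet.{u}} {n : ℕ} {M : Type*} [AddCommGroup M] [Module K M] (f : Z _⦋n⦌ → M)
    (hf : ∀ x ∈ Z.degenerate n, f x = 0) : S Z n →ₗ[K] M :=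
  Submodule.liftQ _ (Finsupp.linearCombination K f) (by
    rw [Submodule.span_le]
    rintro _ ⟨x, hx, rfl⟩
    simp [hf x hx])

lemma S.lift_sm {Z : SSet.{u}} {n : ℕ} {M : Type*} [AddCommGroup M] [Module K M] (f : Z _⦋n⦌ → M)
    (hf : ∀ x ∈ Z.degenerate n, f x = 0) (x : Z _⦋n⦌) : S.lift f hf (sm x) = f x := by
  change Finsupp.linearCombination K f (Finsupp.single x 1) = f x
  simp

lemma S.hom_ext {Z : SSet.{u}} {n : ℕ} {M : Type*} [AddCommGroup M] [Module K M]
    {f g : S Z n →ₗ[K] M} (h : ∀ x, f (sm x) = g (sm x)) : f = g := by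
  apply Submodule.linearMap_qext
  apply Finsupp.lhom_ext'
  intro x
  apply LinearMap.ext_ring
  exact h x

/-- Functoriality of normalized chains. -/
def S.map {Z Z' : SSet.{u}} (f : Z ⟶ Z') (n : ℕ) : S Z n →ₗ[K] S Z' n :=
  S.lift (fun x => sm (f.app _ x)) fun _ hx => sm_degenerate (SSet.degenerate_app_apply hx f)

lemma S.map_sm {Z Z' : SSet.{u}} (f : Z ⟶ Z') (n : ℕ) (x : Z _⦋n⦌) :
    S.map f n (sm x) = sm (f.app _ x) := S.lift_sm _ _ _

lemma S.map_comp {Z Z' Z'' : SSet.{u}} (f : Z ⟶ Z') (g : Z' ⟶ Z'') (n : ℕ) (x : S Z n) :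
    S.map (f ≫ g) n x = S.map g n (S.map f n x) := by
  have : S.map (f ≫ g) n = S.map g n ∘ₗ S.map f n := S.hom_ext fun x => by
    simp [S.map_sm]
  rw [this]; rfl

lemma S.map_id {Z : SSet.{u}} (n : ℕ) (x : S Z n) : S.map (𝟙 Z) n x = x := by
  have : S.map (𝟙 Z) n = LinearMap.id := S.hom_ext fun x => by
    simp [S.map_sm]
  rw [this]; rfl

/-- A simplicial operator which is constant on `{i, i + 1}` factors through `σ i`. -/
lemma factor_σ {n m : ℕ} (α : ⦋n + 1⦌ ⟶ ⦋m⦌) (i : Fin (n + 1)) (h : ev α i = ev α (i + 1)) :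
    SimplexCategory.σ i ≫ SimplexCategory.δ i.succ ≫ α = α := by
  refine hom_ext_ev fun j hj => ?_
  rw [ev_comp, ev_comp, ev_δ _ _ (ev_le _ _), ev_σ _ _ hj, Fin.val_succ]
  rcases lt_trichotomy j (i + 1 : ℕ) with h' | h' | h'
  · rw [if_pos (by omega : j ≤ i), if_pos h']
  · subst h'
    rw [if_neg (by omega : ¬ (i : ℕ) + 1 ≤ i), if_pos (by omega)]; exact h
  · rw [if_neg (by omega : ¬ j ≤ i), if_neg (by omega)]
    congr 1; omega

lemma map_degenerate {Z : SSet.{u}} {n m : ℕ} (α : ⦋n⦌ ⟶ ⦋m⦌) (i : ℕ) (hi : i < n)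
    (h : ev α i = ev α (i + 1)) (x : Z _⦋m⦌) : Z.map α.op x ∈ Z.degenerate n := by
  obtain ⟨n, rfl⟩ : ∃ n', n = n' + 1 := ⟨n - 1, by omega⟩
  rw [← factor_σ α ⟨i, hi⟩ h, op_comp, Functor.map_comp_apply]
  exact ⟨n, Nat.lt_succ_self n, SimplexCategory.σ ⟨i, hi⟩, _, rfl⟩

lemma ev_δσ_aux {n : ℕ} (i : Fin (n + 1)) (k : Fin (n + 2)) (h1 : k ≠ i.castSucc) (h2 : k ≠ i.succ) :
    ∃ j < n, ev (SimplexCategory.δ k ≫ SimplexCategory.σ i) j =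
      ev (SimplexCategory.δ k ≫ SimplexCategory.σ i) (j + 1) := by
  have h1' : (k : ℕ) ≠ i := fun h => h1 (Fin.ext h)
  have h2' : (k : ℕ) ≠ i + 1 := fun h => h2 (Fin.ext h)
  by_cases hk : (k : ℕ) < i
  · refine ⟨i - 1, by omega, ?_⟩
    rw [ev_comp, ev_comp, ev_δ _ _ (by omega), ev_δ _ _ (by omega), ev_σ _ _ (by split_ifs <;> omega),
      ev_σ _ _ (by split_ifs <;> omega)]
    split_ifs <;> omega
  · refine ⟨i, by omega, ?_⟩
    rw [ev_comp, ev_comp, ev_δ _ _ (by omega), ev_δ _ _ (by omega), ev_σ _ _ (by split_ifs <;> omega),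
      ev_σ _ _ (by split_ifs <;> omega)]
    split_ifs <;> omega

/-- The differential `∑ d_k` of the normalized chains (there are no signs over `𝔽₂`). -/
def bd (Z : SSet.{u}) (n : ℕ) : S Z (n + 1) →ₗ[K] S Z n :=
  S.lift (fun x => ∑ k : Fin (n + 2), sm (Z.δ k x)) (by
    intro x hx
    rw [SSet.degenerate_eq_iUnion_range_σ] at hx
    obtain ⟨i, hi⟩ := Set.mem_iUnion.mp hx
    obtain ⟨y, rfl⟩ := hi
    rw [Finset.sum_eq_add i.castSucc i.succ (by simp [Fin.ext_iff])]
    · have e1 : Z.δ i.castSucc (Z.σ i y) = y := SSet.δ_comp_σ_self_apply i y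
      have e2 : Z.δ i.succ (Z.σ i y) = y := SSet.δ_comp_σ_succ_apply i y
      rw [e1, e2]; exact add_self_K _
    · intro k _ hk
      obtain ⟨j, hj, hj'⟩ := ev_δσ_aux i k hk.1 hk.2
      have := map_degenerate (Z := Z) _ j hj hj' y
      rw [op_comp, Functor.map_comp_apply] at this
      exact sm_degenerate this
    · simp
    · simp)

lemma bd_sm (Z : SSet.{u}) (n : ℕ) (x : Z _⦋n + 1⦌) :
    bd Z n (sm x) = ∑ k : Fin (n + 2), sm (Z.δ k x) := S.lift_sm _ _ _

lemma bd_map {Z Z' : SSet.{u}} (f : Z ⟶ Z') (n : ℕ) (x : S Z (n + 1)) :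
    bd Z' n (S.map f (n + 1) x) = S.map f n (bd Z n x) := by
  have : bd Z' n ∘ₗ S.map f (n + 1) = S.map f n ∘ₗ bd Z n := S.hom_ext fun x => by
    simp only [LinearMap.comp_apply, S.map_sm, bd_sm, map_sum]
    refine Finset.sum_congr rfl fun k _ => ?_
    congr 1
    exact (SSet.δ_naturality_apply f k x).symm
  exact congrArg (fun g => g x) this

lemma sum_δδ {M : Type*} [AddCommGroup M] [Module K M] {n : ℕ} (G : (⦋n⦌ ⟶ ⦋n + 2⦌) → M) :
    ∑ j : Fin (n + 3), ∑ i : Fin (n + 2), G (SimplexCategory.δ i ≫ SimplexCategory.δ j) = 0 := by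
  rw [← Finset.sum_product']
  refine Finset.sum_involution (fun x _ =>
    if h : (x.1 : ℕ) ≤ x.2 then ((⟨x.2 + 1, by omega⟩ : Fin (n + 3)), (⟨x.1, by omega⟩ : Fin (n + 2)))
    else ((⟨x.2, by omega⟩ : Fin (n + 3)), (⟨x.1 - 1, by omega⟩ : Fin (n + 2)))) ?_ ?_ ?_ ?_
  · rintro ⟨j, i⟩ -
    have e : SimplexCategory.δ i ≫ SimplexCategory.δ j = (if h : (j : ℕ) ≤ i then
        SimplexCategory.δ (⟨j, by omega⟩ : Fin (n + 2)) ≫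
          SimplexCategory.δ (⟨i + 1, by omega⟩ : Fin (n + 3))
        else SimplexCategory.δ (⟨j - 1, by omega⟩ : Fin (n + 2)) ≫
          SimplexCategory.δ (⟨i, by omega⟩ : Fin (n + 3))) := by
      refine hom_ext_ev fun k hk => ?_
      split_ifs with h <;>
      · rw [ev_comp, ev_comp, ev_δ _ _ hk, ev_δ _ _ hk, ev_δ _ _ (by split_ifs <;> omega),
          ev_δ _ _ (by split_ifs <;> omega)]
        simp only
        split_ifs <;> omega
    simp only
    rw [e]
    split_ifs with h
    · exact add_self_K _
    · exact add_self_K _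
  · rintro ⟨j, i⟩ - -
    simp only
    split_ifs with h
    · intro h'
      have := congrArg (fun x : Fin (n + 3) × Fin (n + 2) => (x.1 : ℕ)) h'
      simp only at this
      omega
    · intro h'
      have := congrArg (fun x : Fin (n + 3) × Fin (n + 2) => (x.1 : ℕ)) h'
      simp only at this
      omega
  · intros; simp
  · rintro ⟨j, i⟩ -
    simp only
    by_cases h : (j : ℕ) ≤ i
    · simp only [h, dite_true]
      rw [dif_neg (by omega)]
      simp
    · simp only [h, dite_false]
      rw [dif_pos (by omega)]
      ext <;> simp
      omega

/-- The differential squares to zero. -/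
lemma bd_bd (Z : SSet.{u}) (n : ℕ) (x : S Z (n + 2)) : bd Z n (bd Z (n + 1) x) = 0 := by
  have : bd Z n ∘ₗ bd Z (n + 1) = 0 := S.hom_ext fun x => by
    rw [LinearMap.comp_apply, bd_sm, map_sum, LinearMap.zero_apply,
      ← sum_δδ (fun α => sm (Z.map α.op x))]
    refine Finset.sum_congr rfl fun j _ => ?_
    rw [bd_sm]
    refine Finset.sum_congr rfl fun i _ => ?_
    rw [op_comp, Functor.map_comp_apply]
    rfl
  exact congrArg (fun g => g x) this

/-- The differential in all degrees, zero in degree `0`. -/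
def dd (Z : SSet.{u}) (n : ℕ) : S Z n →ₗ[K] S Z (n - 1) :=
  match n with
  | 0 => 0
  | n + 1 => bd Z n

lemma dd_map {Z Z' : SSet.{u}} (f : Z ⟶ Z') (n : ℕ) (x : S Z n) :
    dd Z' n (S.map f n x) = S.map f (n - 1) (dd Z n x) := by
  cases n with
  | zero => simp [dd]
  | succ n => exact bd_map f n x

/-! ### The shuffle map -/

/-- A path from `(0,0)` to `(p,q)` crosses every level in the first coordinate. -/
lemma exists_step {n p q : ℕ} (h : p + q = n) (α : ⦋n⦌ ⟶ ⦋p⦌) (β : ⦋n⦌ ⟶ ⦋q⦌)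
    (hs : ∀ i ≤ n, ev α i + ev β i = i) (k : ℕ) (hk : k < p) :
    ∃ i < n, ev α i = k ∧ ev α (i + 1) = k + 1 ∧ ev β i = ev β (i + 1) := by
  have h0 := hs 0 (by omega)
  have hn := hs n le_rfl
  have hn' := ev_le α n
  have hn'' := ev_le β n
  have hex : ∃ i, k < ev α i := ⟨n, by omega⟩
  classical
  have h1 := Nat.find_spec hex
  have h2 : Nat.find hex ≤ n := Nat.find_min' hex (by omega)
  have h3 : Nat.find hex ≠ 0 := fun h => by rw [h] at h1; omega
  have h4 := Nat.find_min hex (m := Nat.find hex - 1) (by omega)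
  have h5 := hs _ h2
  have h6 := hs (Nat.find hex - 1) (by omega)
  have h7 : ev β (Nat.find hex - 1) ≤ ev β (Nat.find hex) := ev_mono β (by omega)
  refine ⟨Nat.find hex - 1, by omega, ?_, ?_, ?_⟩ <;>
    (try rw [show Nat.find hex - 1 + 1 = Nat.find hex by omega]) <;> omega

/-- Applying a shuffle to a simplex which is degenerate in the first factor. -/
lemma shuffle_degenerate {Z Z' : SSet.{u}} {n p q : ℕ} (h : p + q = n) (α : ⦋n⦌ ⟶ ⦋p⦌)
    (β : ⦋n⦌ ⟶ ⦋q⦌) (hs : ∀ i ≤ n, ev α i + ev β i = i) (x : Z _⦋p⦌) (hx : x ∈ Z.degenerate p)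
    (y : Z' _⦋q⦌) :
    ∃ (m : ℕ) (_ : m < n) (γ : ⦋n⦌ ⟶ ⦋m⦌) (a : Z _⦋m⦌) (b : Z' _⦋m⦌),
      Z.map γ.op a = Z.map α.op x ∧ Z'.map γ.op b = Z'.map β.op y := by
  rcases p with _ | p
  · simp at hx
  rw [SSet.degenerate_eq_iUnion_range_σ] at hx
  obtain ⟨k, hk⟩ := Set.mem_iUnion.mp hx
  obtain ⟨x', rfl⟩ := hk
  obtain ⟨i, hi, h1, h2, h3⟩ := exists_step h α β hs k (by omega)
  obtain ⟨n, rfl⟩ : ∃ n', n = n' + 1 := ⟨n - 1, by omega⟩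
  have h4 : ev (α ≫ SimplexCategory.σ k) (⟨i, hi⟩ : Fin (n + 1)) =
      ev (α ≫ SimplexCategory.σ k) ((⟨i, hi⟩ : Fin (n + 1)) + 1) := by
    simp only
    rw [ev_comp, ev_comp, ev_σ _ _ (ev_le _ _), ev_σ _ _ (ev_le _ _), h1, h2]
    simp
  refine ⟨n, Nat.lt_succ_self n, SimplexCategory.σ ⟨i, hi⟩,
    Z.map (SimplexCategory.δ (Fin.succ ⟨i, hi⟩) ≫ α ≫ SimplexCategory.σ k).op x',
    Z'.map (SimplexCategory.δ (Fin.succ ⟨i, hi⟩) ≫ β).op y, ?_, ?_⟩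
  · rw [← Functor.map_comp_apply, ← op_comp, factor_σ _ _ h4, op_comp, Functor.map_comp_apply]
    rfl
  · rw [← Functor.map_comp_apply, ← op_comp, factor_σ _ _ h3]

/-- The simplex `(a, b)` of a product. -/
abbrev pr {Z Z' : SSet.{u}} {n : SimplexCategoryᵒᵖ} (a : Z.obj n) (b : Z'.obj n) :
    (Z ⊗ Z').obj n := (a, b)

lemma shuffle_degenerate_left {Z Z' : SSet.{u}} {n p q : ℕ} (h : p + q = n)
    {s : (⦋n⦌ ⟶ ⦋p⦌) × (⦋n⦌ ⟶ ⦋q⦌)} (hs : s ∈ shuffles n p q) (x : Z _⦋p⦌)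
    (hx : x ∈ Z.degenerate p) (y : Z' _⦋q⦌) :
    sm (pr (Z.map s.1.op x) (Z'.map s.2.op y)) = 0 := by
  obtain ⟨m, hm, γ, a, b, ha, hb⟩ :=
    shuffle_degenerate h s.1 s.2 (mem_shuffles_ev.mp hs) x hx y
  refine sm_degenerate ⟨m, hm, γ, pr a b, ?_⟩
  rw [← ha, ← hb]; rfl

lemma shuffle_degenerate_right {Z Z' : SSet.{u}} {n p q : ℕ} (h : p + q = n)
    {s : (⦋n⦌ ⟶ ⦋p⦌) × (⦋n⦌ ⟶ ⦋q⦌)} (hs : s ∈ shuffles n p q) (x : Z _⦋p⦌)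
    (y : Z' _⦋q⦌) (hy : y ∈ Z'.degenerate q) :
    sm (pr (Z.map s.1.op x) (Z'.map s.2.op y)) = 0 := by
  obtain ⟨m, hm, γ, a, b, ha, hb⟩ :=
    shuffle_degenerate (by omega : q + p = n) s.2 s.1
      (fun i hi => (add_comm _ _).trans (mem_shuffles_ev.mp hs i hi)) y hy x
  refine sm_degenerate ⟨m, hm, γ, pr b a, ?_⟩
  rw [← ha, ← hb]; rfl

open Classical in
/-- The shuffle map `∇ : S_p(Z) ⊗ S_q(Z') → S_n(Z × Z')` for `n = p + q`; zero otherwise. -/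
def cross (Z Z' : SSet.{u}) (p q n : ℕ) : S Z p →ₗ[K] S Z' q →ₗ[K] S (Z ⊗ Z') n :=
  S.lift (fun x => S.lift
      (fun y => if p + q = n then
        ∑ s ∈ shuffles n p q, sm (pr (Z.map s.1.op x) (Z'.map s.2.op y)) else 0)
      (fun y hy => by
        split_ifs with h
        · exact Finset.sum_eq_zero fun s hs => shuffle_degenerate_right h hs x y hy
        · rfl))
    (fun x hx => S.hom_ext fun y => by
      rw [S.lift_sm]
      split_ifs with h
      · exact Finset.sum_eq_zero fun s hs => shuffle_degenerate_left h hs x hx y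
      · rfl)

lemma cross_sm {Z Z' : SSet.{u}} {p q n : ℕ} (h : p + q = n) (x : Z _⦋p⦌) (y : Z' _⦋q⦌) :
    cross Z Z' p q n (sm x) (sm y) =
      ∑ s ∈ shuffles n p q, sm (pr (Z.map s.1.op x) (Z'.map s.2.op y)) := by
  unfold cross
  rw [S.lift_sm, S.lift_sm, if_pos h]

lemma cross_eq_zero {Z Z' : SSet.{u}} {p q n : ℕ} (h : p + q ≠ n) (x : S Z p) (y : S Z' q) :
    cross Z Z' p q n x y = 0 := by
  have : cross Z Z' p q n = 0 := S.hom_ext fun x => S.hom_ext fun y => by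
    unfold cross
    rw [S.lift_sm, S.lift_sm, if_neg h]; rfl
  rw [this]; rfl

lemma cross_map {Z Z' W W' : SSet.{u}} (f : Z ⟶ W) (g : Z' ⟶ W') (p q n : ℕ) (x : S Z p)
    (y : S Z' q) :
    S.map (f ⊗ₘ g) n (cross Z Z' p q n x y) = cross W W' p q n (S.map f p x) (S.map g q y) := by
  by_cases h : p + q = n
  · have : (cross Z Z' p q n).compr₂ (S.map (f ⊗ₘ g) n) =
        (cross W W' p q n).compl₁₂ (S.map f p) (S.map g q) := by
      refine S.hom_ext fun x => S.hom_ext fun y => ?_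
      simp only [LinearMap.compr₂_apply, LinearMap.compl₁₂_apply, S.map_sm, cross_sm h, map_sum]
      refine Finset.sum_congr rfl fun s _ => ?_
      congr 1
      exact Prod.ext (NatTrans.naturality_apply f _ _) (NatTrans.naturality_apply g _ _)
    exact congrArg (fun F => F x y) this
  · rw [cross_eq_zero h, cross_eq_zero h, map_zero]

/-- The Leibniz rule for the shuffle map. -/
lemma bd_cross {Z Z' : SSet.{u}} {p q n : ℕ} (h : p + q = n + 1) (x : S Z p) (y : S Z' q) :
    bd (Z ⊗ Z') n (cross Z Z' p q (n + 1) x y) =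
      cross Z Z' (p - 1) q n (dd Z p x) y + cross Z Z' p (q - 1) n x (dd Z' q y) := by
  have : (cross Z Z' p q (n + 1)).compr₂ (bd (Z ⊗ Z') n) =
      (cross Z Z' (p - 1) q n).compl₁₂ (dd Z p) LinearMap.id +
        (cross Z Z' p (q - 1) n).compl₁₂ LinearMap.id (dd Z' q) := by
    refine S.hom_ext fun x => S.hom_ext fun y => ?_
    simp only [LinearMap.compr₂_apply, LinearMap.compl₁₂_apply, LinearMap.add_apply, cross_sm h,
      map_sum, bd_sm, LinearMap.id_apply]
    rw [Finset.sum_comm]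
    refine Eq.trans ?_ (sum_shuffles_face h (fun s => sm (pr (Z.map s.1.op x) (Z'.map s.2.op y)))
      _ _ ?_ ?_ ?_ ?_)
    · refine Finset.sum_congr rfl fun k _ => Finset.sum_congr rfl fun s _ => ?_
      congr 1
      rw [op_comp, Functor.map_comp_apply, op_comp, Functor.map_comp_apply]
      rfl
    · rintro p rfl
      change cross Z Z' p q n (bd Z p (sm x)) (sm y) = _
      rw [bd_sm, map_sum, LinearMap.sum_apply, Finset.sum_product]
      refine Finset.sum_congr rfl fun k _ => ?_
      rw [cross_sm (by omega)]
      refine Finset.sum_congr rfl fun s _ => ?_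
      congr 1
      simp only [eqToHom_refl, Category.comp_id]
      rw [op_comp, Functor.map_comp_apply]
      rfl
    · rintro rfl
      simp [dd]
    · rintro q rfl
      change cross Z Z' p q n (sm x) (bd Z' q (sm y)) = _
      rw [bd_sm, map_sum, Finset.sum_product]
      refine Finset.sum_congr rfl fun k _ => ?_
      rw [cross_sm (by omega)]
      refine Finset.sum_congr rfl fun s _ => ?_
      congr 1
      simp only [eqToHom_refl, Category.comp_id]
      rw [op_comp, Functor.map_comp_apply]
      rfl
    · rintro rfl
      simp [dd]
  exact congrArg (fun F => F x y) this

/-! ### Homology of a space and the cross product -/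

/-- `H_n(Z; 𝔽₂)`. -/
abbrev H (Z : SSet.{u}) (n : ℕ) : Type u :=
  SubQ (LinearMap.ker (dd Z n)) (LinearMap.range (bd Z n))

/-- The map induced in homology. -/
def H.map {Z Z' : SSet.{u}} (f : Z ⟶ Z') (n : ℕ) : H Z n →ₗ[K] H Z' n :=
  SubQ.map (S.map f n)
    (fun x hx => by
      rw [LinearMap.mem_ker] at hx ⊢
      rw [dd_map, hx, map_zero])
    (fun x _ hx => by
      obtain ⟨w, rfl⟩ := hx
      exact ⟨S.map f (n + 1) w, bd_map f n w⟩)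

/-- The homology cross product. -/
def H.cross (Z Z' : SSet.{u}) (p q : ℕ) : H Z p →ₗ[K] H Z' q →ₗ[K] H (Z ⊗ Z') (p + q) :=
  SubQ.map₂ (CosimplicialSS.cross Z Z' p q (p + q))
    (fun x hx y hy => by
      rw [LinearMap.mem_ker] at hx hy ⊢
      generalize hn : p + q = n
      cases n with
      | zero => rfl
      | succ n =>
        change bd _ n _ = 0
        rw [bd_cross hn, hx, hy]; simp)
    (fun x _ hx y hy => by
      obtain ⟨w, rfl⟩ := hx
      rw [LinearMap.mem_ker] at hy
      refine ⟨CosimplicialSS.cross Z Z' (p + 1) q (p + q + 1) w y, ?_⟩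
      rw [bd_cross (by omega), hy, map_zero, add_zero]; rfl)
    (fun x hx y _ hy => by
      obtain ⟨w, rfl⟩ := hy
      rw [LinearMap.mem_ker] at hx
      refine ⟨CosimplicialSS.cross Z Z' p (q + 1) (p + q + 1) x w, ?_⟩
      rw [bd_cross (by omega), hx, map_zero, LinearMap.zero_apply, zero_add]; rfl)

end

section

/-! ### The bicomplex of a cosimplicial space -/

/-- Cosimplicial spaces, a space being a simplicial set. -/
abbrev CosimplicialSpace : Type (u + 1) := SimplexCategory ⥤ SSet.{u}

/-- Families `x p q ∈ S_q(X^p)`, one chain in each bidegree `(-p, q)`. -/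
def Amb (X : CosimplicialSpace.{u}) : Type u := ∀ p q : ℕ, S (X.obj ⦋p⦌) q

instance (X : CosimplicialSpace.{u}) : AddCommGroup (Amb X) :=
  inferInstanceAs (AddCommGroup (∀ p q : ℕ, S (X.obj ⦋p⦌) q))

instance (X : CosimplicialSpace.{u}) : Module K (Amb X) :=
  inferInstanceAs (Module K (∀ p q : ℕ, S (X.obj ⦋p⦌) q))

@[ext] lemma Amb.ext {X : CosimplicialSpace.{u}} {x y : Amb X} (h : ∀ p q, x p q = y p q) : x = y :=
  funext fun p => funext fun q => h p q

@[simp] lemma Amb.zero_apply {X : CosimplicialSpace.{u}} (p q : ℕ) : (0 : Amb X) p q = 0 := rfl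

@[simp] lemma Amb.add_apply {X : CosimplicialSpace.{u}} (x y : Amb X) (p q : ℕ) :
    (x + y) p q = x p q + y p q := rfl

@[simp] lemma Amb.smul_apply {X : CosimplicialSpace.{u}} (c : K) (x : Amb X) (p q : ℕ) :
    (c • x) p q = c • x p q := rfl

/-- The family of chains with the given components. -/
def Amb.mk {X : CosimplicialSpace.{u}} (f : ∀ p q : ℕ, S (X.obj ⦋p⦌) q) : Amb X := f

@[simp] lemma Amb.mk_apply {X : CosimplicialSpace.{u}} (f : ∀ p q : ℕ, S (X.obj ⦋p⦌) q)
    (p q : ℕ) : Amb.mk f p q = f p q := rfl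

/-- The component in bidegree `(-p, q)`. -/
def Amb.proj (X : CosimplicialSpace.{u}) (p q : ℕ) : Amb X →ₗ[K] S (X.obj ⦋p⦌) q where
  toFun x := x p q
  map_add' _ _ := rfl
  map_smul' _ _ := rfl

@[simp] lemma Amb.proj_apply {X : CosimplicialSpace.{u}} (x : Amb X) (p q : ℕ) :
    Amb.proj X p q x = x p q := rfl

/-- A linear map given by its components. -/
def Amb.pi {M : Type*} [AddCommGroup M] [Module K M] {X : CosimplicialSpace.{u}}
    (f : ∀ p q, M →ₗ[K] S (X.obj ⦋p⦌) q) : M →ₗ[K] Amb X where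
  toFun m p q := f p q m
  map_add' x y := by ext p q; exact map_add (f p q) x y
  map_smul' c x := by ext p q; exact map_smul (f p q) c x

@[simp] lemma Amb.pi_apply {M : Type*} [AddCommGroup M] [Module K M] {X : CosimplicialSpace.{u}}
    (f : ∀ p q, M →ₗ[K] S (X.obj ⦋p⦌) q) (m : M) (p q : ℕ) : Amb.pi f m p q = f p q m := rfl

/-- The conormalization `C^p S_q(X)`, the intersection of the kernels of the codegeneracies of the
cosimplicial vector space `S_q(X^•)`. -/
def conorm (X : CosimplicialSpace.{u}) (p q : ℕ) : Submodule K (S (X.obj ⦋p⦌) q) :=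
  match p with
  | 0 => ⊤
  | p + 1 => ⨅ i : Fin (p + 1), LinearMap.ker (S.map (X.map (SimplexCategory.σ i)) q)

/-- The cosimplicial differential `∑ d^j`. -/
def cobd (X : CosimplicialSpace.{u}) (p q : ℕ) : S (X.obj ⦋p⦌) q →ₗ[K] S (X.obj ⦋p + 1⦌) q :=
  ∑ j : Fin (p + 2), S.map (X.map (SimplexCategory.δ j)) q

lemma cobd_apply (X : CosimplicialSpace.{u}) (p q : ℕ) (x : S (X.obj ⦋p⦌) q) :
    cobd X p q x = ∑ j : Fin (p + 2), S.map (X.map (SimplexCategory.δ j)) q x := by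
  simp [cobd]

/-- The horizontal part of the total differential, landing in bidegree `(-p, q)`. -/
def hor (X : CosimplicialSpace.{u}) (p q : ℕ) : Amb X →ₗ[K] S (X.obj ⦋p⦌) q :=
  match p with
  | 0 => 0
  | p + 1 => cobd X p q ∘ₗ Amb.proj X p q

/-- The total differential, the sum of the vertical and the horizontal one. -/
def D (X : CosimplicialSpace.{u}) : Amb X →ₗ[K] Amb X :=
  Amb.pi fun p q => bd (X.obj ⦋p⦌) q ∘ₗ Amb.proj X p (q + 1) + hor X p q

lemma D_zero (X : CosimplicialSpace.{u}) (x : Amb X) (q : ℕ) :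
    D X x 0 q = bd (X.obj ⦋0⦌) q (x 0 (q + 1)) := by
  simp [D, hor]

lemma D_succ (X : CosimplicialSpace.{u}) (x : Amb X) (p q : ℕ) :
    D X x (p + 1) q = bd (X.obj ⦋p + 1⦌) q (x (p + 1) (q + 1)) + cobd X p q (x p q) := by
  simp [D, hor]

lemma cobd_cobd (X : CosimplicialSpace.{u}) (p q : ℕ) (x : S (X.obj ⦋p⦌) q) :
    cobd X (p + 1) q (cobd X p q x) = 0 := by
  rw [cobd_apply, cobd_apply, ← sum_δδ (fun α => S.map (X.map α) q x)]
  refine Finset.sum_congr rfl fun j _ => ?_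
  rw [map_sum]
  refine Finset.sum_congr rfl fun i _ => ?_
  rw [X.map_comp, S.map_comp]

lemma bd_cobd (X : CosimplicialSpace.{u}) (p q : ℕ) (x : S (X.obj ⦋p⦌) (q + 1)) :
    bd _ q (cobd X p (q + 1) x) = cobd X p q (bd _ q x) := by
  rw [cobd_apply, cobd_apply, map_sum]
  exact Finset.sum_congr rfl fun j _ => bd_map _ _ _

/-- The total differential squares to zero. -/
lemma D_D (X : CosimplicialSpace.{u}) (x : Amb X) : D X (D X x) = 0 := by
  ext p q
  rcases p with _ | _ | p
  · rw [D_zero, D_zero, bd_bd]; rfl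
  · rw [D_succ, D_succ, D_zero, map_add, bd_bd, bd_cobd, zero_add (cobd X 0 q _)]; exact add_self_K _
  · rw [D_succ, D_succ, D_succ, map_add, map_add, bd_bd, bd_cobd, cobd_cobd,
      zero_add (cobd X (p + 1) q _), add_zero (cobd X (p + 1) q _)]
    exact add_self_K _

/-- The filtration `F^k (T CN)_m` of the total complex: families of conormalized chains in the
bidegrees `(-p, q)` with `q - p = m` (a product over all `p`), which vanish unless `-p ≤ k`. For
`k = 0` this is everything, and `T / F^{-s}` is the total complex `T_{s-1}` of the columns
`p ≤ s - 1`. -/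
def Fil (X : CosimplicialSpace.{u}) (k m : ℤ) : Submodule K (Amb X) where
  carrier := {x | (∀ p q, x p q ∈ conorm X p q) ∧ (∀ p q : ℕ, (q : ℤ) - p ≠ m → x p q = 0) ∧
    ∀ p q : ℕ, k < -(p : ℤ) → x p q = 0}
  zero_mem' := ⟨fun _ _ => zero_mem _, fun _ _ _ => rfl, fun _ _ _ => rfl⟩
  add_mem' {x y} hx hy := ⟨fun p q => add_mem (hx.1 p q) (hy.1 p q),
    fun p q h => by simp [hx.2.1 p q h, hy.2.1 p q h],
    fun p q h => by simp [hx.2.2 p q h, hy.2.2 p q h]⟩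
  smul_mem' c x hx := ⟨fun p q => Submodule.smul_mem _ c (hx.1 p q),
    fun p q h => by simp [hx.2.1 p q h],
    fun p q h => by simp [hx.2.2 p q h]⟩

/-- The total complex `(T CN)_m`, formed with products. -/
abbrev TCN (X : CosimplicialSpace.{u}) (m : ℤ) : Submodule K (Amb X) := Fil X 0 m

lemma Fil_mono (X : CosimplicialSpace.{u}) {k k' : ℤ} (h : k ≤ k') (m : ℤ) :
    Fil X k m ≤ Fil X k' m :=
  fun _ hx => ⟨hx.1, hx.2.1, fun p q hp => hx.2.2 p q (by omega)⟩

lemma Fil_le_TCN (X : CosimplicialSpace.{u}) (k m : ℤ) : Fil X k m ≤ TCN X m :=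
  fun _ hx => ⟨hx.1, hx.2.1, fun p q hp => absurd hp (by omega)⟩

lemma conorm_map_eq_zero (X : CosimplicialSpace.{u}) {p q m : ℕ} {a : S (X.obj ⦋p⦌) q}
    (ha : a ∈ conorm X p q) (α : ⦋p⦌ ⟶ ⦋m⦌) (i : ℕ) (hi : i < p) (h : ev α i = ev α (i + 1)) :
    S.map (X.map α) q a = 0 := by
  obtain ⟨p, rfl⟩ : ∃ p', p = p' + 1 := ⟨p - 1, by omega⟩
  rw [← factor_σ α ⟨i, hi⟩ h, X.map_comp, S.map_comp]
  have : a ∈ ⨅ i : Fin (p + 1), LinearMap.ker (S.map (X.map (SimplexCategory.σ i)) q) := ha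
  rw [Submodule.mem_iInf] at this
  rw [LinearMap.mem_ker.mp (this ⟨i, hi⟩), map_zero]

lemma mem_conorm_succ (X : CosimplicialSpace.{u}) {p q : ℕ} {a : S (X.obj ⦋p + 1⦌) q} :
    a ∈ conorm X (p + 1) q ↔ ∀ i : Fin (p + 1), S.map (X.map (SimplexCategory.σ i)) q a = 0 := by
  change a ∈ ⨅ i : Fin (p + 1), LinearMap.ker (S.map (X.map (SimplexCategory.σ i)) q) ↔ _
  simp [Submodule.mem_iInf]

lemma bd_mem_conorm (X : CosimplicialSpace.{u}) {p q : ℕ} {a : S (X.obj ⦋p⦌) (q + 1)}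
    (ha : a ∈ conorm X p (q + 1)) : bd _ q a ∈ conorm X p q := by
  cases p with
  | zero => exact Submodule.mem_top
  | succ p =>
    rw [mem_conorm_succ] at ha ⊢
    intro i
    rw [← bd_map, ha i, map_zero]

lemma cobd_mem_conorm (X : CosimplicialSpace.{u}) {p q : ℕ} {a : S (X.obj ⦋p⦌) q}
    (ha : a ∈ conorm X p q) : cobd X p q a ∈ conorm X (p + 1) q := by
  rw [mem_conorm_succ]
  intro i
  rw [cobd_apply, map_sum, Finset.sum_eq_add i.castSucc i.succ (by simp [Fin.ext_iff])]
  · rw [← S.map_comp, ← S.map_comp, ← X.map_comp, ← X.map_comp, SimplexCategory.δ_comp_σ_self,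
      SimplexCategory.δ_comp_σ_succ]
    exact add_self_K _
  · intro k _ hk
    obtain ⟨j, hj, hj'⟩ := ev_δσ_aux i k hk.1 hk.2
    rw [← S.map_comp, ← X.map_comp]
    exact conorm_map_eq_zero X ha _ j hj hj'
  · simp
  · simp

lemma D_mem_Fil (X : CosimplicialSpace.{u}) {k m m' : ℤ} (hm : m' + 1 = m) {x : Amb X}
    (hx : x ∈ Fil X k m) : D X x ∈ Fil X k m' := by
  refine ⟨fun p q => ?_, fun p q h => ?_, fun p q h => ?_⟩
  · cases p with
    | zero => rw [D_zero]; exact bd_mem_conorm X (hx.1 _ _)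
    | succ p =>
      rw [D_succ]; exact add_mem (bd_mem_conorm X (hx.1 _ _)) (cobd_mem_conorm X (hx.1 _ _))
  · cases p with
    | zero => rw [D_zero, hx.2.1 _ _ (by push_cast at h ⊢; omega), map_zero]
    | succ p =>
      rw [D_succ, hx.2.1 _ _ (by push_cast at h ⊢; omega),
        hx.2.1 _ _ (by push_cast at h ⊢; omega), map_zero, map_zero, add_zero]
  · cases p with
    | zero => rw [D_zero, hx.2.2 _ _ (by push_cast at h ⊢; omega), map_zero]
    | succ p =>
      rw [D_succ, hx.2.2 _ _ (by push_cast at h ⊢; omega), hx.2.2 _ _ (by push_cast at h ⊢; omega),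
        map_zero, map_zero, add_zero]

/-! ### The product -/

/-- The front face `[p] → [n]`, `i ↦ i` (for `p ≤ n`). -/
def front (p n : ℕ) : ⦋p⦌ ⟶ ⦋n⦌ :=
  homOfEv (fun i => min i n) (fun i j h _ => by omega) (fun i _ => by omega)

/-- The back face `[p] → [n]`, `i ↦ i + (n - p)` (for `p ≤ n`). -/
def back (p n : ℕ) : ⦋p⦌ ⟶ ⦋n⦌ :=
  homOfEv (fun i => min (i + (n - p)) n) (fun i j h _ => by omega) (fun i _ => by omega)

lemma ev_front {p n : ℕ} (h : p ≤ n) (i : ℕ) (hi : i ≤ p) : ev (front p n) i = i := by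
  unfold front
  rw [ev_homOfEv _ _ _ _ hi]; omega

lemma ev_back {p n : ℕ} (h : p ≤ n) (i : ℕ) (hi : i ≤ p) : ev (back p n) i = i + (n - p) := by
  unfold back
  rw [ev_homOfEv _ _ _ _ hi]; omega

lemma front_δ_lt {p n : ℕ} (h : p ≤ n) (j : ℕ) (hj : j ≤ p) :
    front p n ≫ SimplexCategory.δ (⟨j, by omega⟩ : Fin (n + 2)) =
      SimplexCategory.δ (⟨j, by omega⟩ : Fin (p + 2)) ≫ front (p + 1) (n + 1) := by
  refine hom_ext_ev fun i hi => ?_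
  rw [ev_comp, ev_comp, ev_front h _ hi, ev_δ _ _ (by omega), ev_δ _ _ hi,
    ev_front (by omega) _ (by split_ifs <;> omega)]

lemma front_δ_gt {p n : ℕ} (h : p ≤ n) (j : ℕ) (hj : p < j) (hj' : j < n + 2) :
    front p n ≫ SimplexCategory.δ (⟨j, hj'⟩ : Fin (n + 2)) = front p (n + 1) := by
  refine hom_ext_ev fun i hi => ?_
  rw [ev_comp, ev_front h _ hi, ev_δ _ _ (by omega), ev_front (by omega) _ hi, if_pos]
  simp only; omega

lemma front_δ_last {p n : ℕ} (h : p ≤ n) :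
    SimplexCategory.δ (Fin.last (p + 1)) ≫ front (p + 1) (n + 1) = front p (n + 1) := by
  refine hom_ext_ev fun i hi => ?_
  rw [ev_comp, ev_δ _ _ hi, if_pos (by simp; omega), ev_front (by omega) _ (by omega),
    ev_front (by omega) _ hi]

lemma back_δ_le {p n : ℕ} (h : p ≤ n) (j : ℕ) (hj : j ≤ n - p) :
    back p n ≫ SimplexCategory.δ (⟨j, by omega⟩ : Fin (n + 2)) = back p (n + 1) := by
  refine hom_ext_ev fun i hi => ?_
  rw [ev_comp, ev_back h _ hi, ev_δ _ _ (by omega), ev_back (by omega) _ hi,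
    if_neg (by simp only; omega)]
  omega

lemma back_δ_gt {p n : ℕ} (h : p ≤ n) (j : ℕ) (hj : j < p + 2) :
    back p n ≫ SimplexCategory.δ (⟨j + (n - p), by omega⟩ : Fin (n + 2)) =
      SimplexCategory.δ (⟨j, hj⟩ : Fin (p + 2)) ≫ back (p + 1) (n + 1) := by
  refine hom_ext_ev fun i hi => ?_
  rw [ev_comp, ev_comp, ev_back h _ hi, ev_δ _ _ (by omega), ev_δ _ _ hi,
    ev_back (by omega) _ (by split_ifs <;> omega)]
  simp only
  split_ifs <;> omega

lemma sum_front_back {M : Type*} [AddCommGroup M] [Module K M] {p q n : ℕ} (h : p + q = n)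
    (G : (⦋p⦌ ⟶ ⦋n + 1⦌) → (⦋q⦌ ⟶ ⦋n + 1⦌) → M) :
    ∑ j : Fin (n + 2), G (front p n ≫ SimplexCategory.δ j) (back q n ≫ SimplexCategory.δ j) =
      ∑ j : Fin (p + 2), G (SimplexCategory.δ j ≫ front (p + 1) (n + 1)) (back q (n + 1)) +
      ∑ j : Fin (q + 2), G (front p (n + 1)) (SimplexCategory.δ j ≫ back (q + 1) (n + 1)) := by
  subst h
  have hp : p ≤ p + q := by omega
  have hq : q ≤ p + q := by omega
  rw [Fin.sum_univ_castSucc (n := p + 1), Fin.sum_univ_succ (n := q + 1), front_δ_last hp]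
  have e0 : SimplexCategory.δ (0 : Fin (q + 2)) ≫ back (q + 1) (p + q + 1) = back q (p + q + 1) := by
    refine hom_ext_ev fun i hi => ?_
    rw [ev_comp, ev_δ _ _ hi, if_neg (by simp), ev_back (by omega) _ (by omega),
      ev_back (by omega) _ hi]
    omega
  rw [e0]
  have e1 : ∑ j : Fin (p + q + 2), G (front p (p + q) ≫ SimplexCategory.δ j)
      (back q (p + q) ≫ SimplexCategory.δ j) =
      ∑ j : Fin (p + 1 + (q + 1)), G (front p (p + q) ≫ SimplexCategory.δ (j.cast (by omega)))
      (back q (p + q) ≫ SimplexCategory.δ (j.cast (by omega))) :=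
    (Fintype.sum_equiv (finCongr (by omega)) _ _ fun j => rfl)
  rw [e1, Fin.sum_univ_add]
  have e2 : ∀ j : Fin (p + 1), G (front p (p + q) ≫
      SimplexCategory.δ ((Fin.castAdd (q + 1) j).cast (by omega)))
      (back q (p + q) ≫ SimplexCategory.δ ((Fin.castAdd (q + 1) j).cast (by omega))) =
      G (SimplexCategory.δ j.castSucc ≫ front (p + 1) (p + q + 1)) (back q (p + q + 1)) := by
    intro j
    congr 1
    · exact front_δ_lt hp j (by omega)
    · exact back_δ_le hq j (by omega)
  have e3 : ∀ j : Fin (q + 1), G (front p (p + q) ≫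
      SimplexCategory.δ ((Fin.natAdd (p + 1) j).cast (by omega)))
      (back q (p + q) ≫ SimplexCategory.δ ((Fin.natAdd (p + 1) j).cast (by omega))) =
      G (front p (p + q + 1)) (SimplexCategory.δ j.succ ≫ back (q + 1) (p + q + 1)) := by
    intro j
    congr 1
    · exact front_δ_gt hp (p + 1 + j) (by omega) (by omega)
    · refine Eq.trans ?_ (back_δ_gt hq (j + 1) (by omega))
      congr 2
      ext
      simp
      omega
  rw [Finset.sum_congr rfl fun j _ => e2 j, Finset.sum_congr rfl fun j _ => e3 j]
  have := add_self_K (G (front p (p + q + 1)) (back q (p + q + 1)))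
  generalize ∑ j : Fin (p + 1), G (SimplexCategory.δ j.castSucc ≫ front (p + 1) (p + q + 1)) _ = a
  generalize ∑ j : Fin (q + 1), G _ (SimplexCategory.δ j.succ ≫ back (q + 1) (p + q + 1)) = b
  generalize G (front p (p + q + 1)) (back q (p + q + 1)) = c at this
  calc a + b = a + (c + c) + b := by rw [this, add_zero]
    _ = a + c + (c + b) := by abel

variable {X X' : CosimplicialSpace.{u}}

/-- The levelwise product of two cosimplicial spaces. -/
abbrev prodC (X X' : CosimplicialSpace.{u}) : CosimplicialSpace.{u} where
  obj p := X.obj p ⊗ X'.obj p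
  map α := X.map α ⊗ₘ X'.map α

/-- The summand `∇(front_* a ⊗ back_* b)` of the product. -/
def prodTerm (X X' : CosimplicialSpace.{u}) (n l p p' q q' : ℕ) :
    S (X.obj ⦋p⦌) q →ₗ[K] S (X'.obj ⦋p'⦌) q' →ₗ[K] S ((prodC X X').obj ⦋n⦌) l :=
  (cross (X.obj ⦋n⦌) (X'.obj ⦋n⦌) q q' l).compl₁₂ (S.map (X.map (front p n)) q)
    (S.map (X'.map (back p' n)) q')

/-- The external product of total complexes: the Alexander-Whitney product in the cosimplicial
direction and the shuffle map in the simplicial direction. -/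
def totMul (X X' : CosimplicialSpace.{u}) : Amb X →ₗ[K] Amb X' →ₗ[K] Amb (prodC X X') :=
  LinearMap.mk₂ K (fun x y => Amb.mk fun n l => ∑ i ∈ Finset.HasAntidiagonal.antidiagonal n, ∑ j ∈ Finset.HasAntidiagonal.antidiagonal l,
      prodTerm X X' n l i.1 i.2 j.1 j.2 (x i.1 j.1) (y i.2 j.2))
    (fun x x' y => by ext n l; simp [Finset.sum_add_distrib])
    (fun c x y => by ext n l; simp [Finset.smul_sum])
    (fun x y y' => by ext n l; simp [Finset.sum_add_distrib])
    (fun c x y => by ext n l; simp [Finset.smul_sum])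

lemma totMul_apply (x : Amb X) (y : Amb X') (n l : ℕ) :
    totMul X X' x y n l = ∑ i ∈ Finset.HasAntidiagonal.antidiagonal n, ∑ j ∈ Finset.HasAntidiagonal.antidiagonal l,
      prodTerm X X' n l i.1 i.2 j.1 j.2 (x i.1 j.1) (y i.2 j.2) := rfl

lemma bd_prodTerm {n l p p' q q' : ℕ} (h : q + q' = l + 1) (a : S (X.obj ⦋p⦌) q)
    (b : S (X'.obj ⦋p'⦌) q') :
    bd _ l (prodTerm X X' n (l + 1) p p' q q' a b) =
      prodTerm X X' n l p p' (q - 1) q' (dd _ q a) b +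
      prodTerm X X' n l p p' q (q' - 1) a (dd _ q' b) := by
  unfold prodTerm
  simp only [LinearMap.compl₁₂_apply]
  refine (bd_cross h _ _).trans ?_
  rw [dd_map, dd_map]

lemma map_prodTerm {n n' l p p' q q' : ℕ} (α : ⦋n⦌ ⟶ ⦋n'⦌) (a : S (X.obj ⦋p⦌) q)
    (b : S (X'.obj ⦋p'⦌) q') :
    S.map ((prodC X X').map α) l (prodTerm X X' n l p p' q q' a b) =
      cross (X.obj ⦋n'⦌) (X'.obj ⦋n'⦌) q q' l (S.map (X.map (front p n ≫ α)) q a)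
        (S.map (X'.map (back p' n ≫ α)) q' b) := by
  unfold prodTerm
  simp only [LinearMap.compl₁₂_apply]
  rw [X.map_comp, X'.map_comp, S.map_comp, S.map_comp]
  exact cross_map _ _ _ _ _ _ _

lemma cobd_prodTerm {n l p p' q q' : ℕ} (h : p + p' = n) (a : S (X.obj ⦋p⦌) q)
    (b : S (X'.obj ⦋p'⦌) q') :
    cobd (prodC X X') n l (prodTerm X X' n l p p' q q' a b) =
      prodTerm X X' (n + 1) l (p + 1) p' q q' (cobd X p q a) b +
      prodTerm X X' (n + 1) l p (p' + 1) q q' a (cobd X' p' q' b) := by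
  rw [cobd_apply]
  refine (Finset.sum_congr rfl fun j _ => map_prodTerm (SimplexCategory.δ j) a b).trans ?_
  rw [sum_front_back h (fun α β => cross (X.obj ⦋n + 1⦌) (X'.obj ⦋n + 1⦌) q q' l
    (S.map (X.map α) q a) (S.map (X'.map β) q' b))]
  unfold prodTerm
  simp only [LinearMap.compl₁₂_apply, cobd_apply, map_sum, LinearMap.sum_apply]
  congr 1
  · refine Finset.sum_congr rfl fun j _ => ?_
    rw [X.map_comp, S.map_comp]
  · refine Finset.sum_congr rfl fun j _ => ?_
    rw [X'.map_comp, S.map_comp]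

/-- The vertical part of the total differential. -/
def ver (X : CosimplicialSpace.{u}) (x : Amb X) (p q : ℕ) : S (X.obj ⦋p⦌) q :=
  bd (X.obj ⦋p⦌) q (x p (q + 1))

lemma D_eq (x : Amb X) (p q : ℕ) : D X x p q = ver X x p q + hor X p q x := rfl

lemma bd_totMul (x : Amb X) (y : Amb X') (n l : ℕ) :
    bd _ l (totMul X X' x y n (l + 1)) =
      ∑ i ∈ Finset.HasAntidiagonal.antidiagonal n, ∑ j ∈ Finset.HasAntidiagonal.antidiagonal l,
        prodTerm X X' n l i.1 i.2 j.1 j.2 (ver X x i.1 j.1) (y i.2 j.2) +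
      ∑ i ∈ Finset.HasAntidiagonal.antidiagonal n, ∑ j ∈ Finset.HasAntidiagonal.antidiagonal l,
        prodTerm X X' n l i.1 i.2 j.1 j.2 (x i.1 j.1) (ver X' y i.2 j.2) := by
  rw [totMul_apply, map_sum, ← Finset.sum_add_distrib]
  refine Finset.sum_congr rfl fun i _ => ?_
  rw [map_sum, Finset.sum_congr rfl fun j hj =>
    bd_prodTerm (Finset.HasAntidiagonal.mem_antidiagonal.mp hj) (x i.1 j.1) (y i.2 j.2), Finset.sum_add_distrib]
  congr 1
  · rw [Finset.Nat.sum_antidiagonal_succ]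
    simp [dd, ver]
  · rw [Finset.Nat.sum_antidiagonal_succ']
    simp [dd, ver]

lemma hor_totMul (x : Amb X) (y : Amb X') (n l : ℕ) :
    hor (prodC X X') n l (totMul X X' x y) =
      ∑ i ∈ Finset.HasAntidiagonal.antidiagonal n, ∑ j ∈ Finset.HasAntidiagonal.antidiagonal l,
        prodTerm X X' n l i.1 i.2 j.1 j.2 (hor X i.1 j.1 x) (y i.2 j.2) +
      ∑ i ∈ Finset.HasAntidiagonal.antidiagonal n, ∑ j ∈ Finset.HasAntidiagonal.antidiagonal l,
        prodTerm X X' n l i.1 i.2 j.1 j.2 (x i.1 j.1) (hor X' i.2 j.2 y) := by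
  cases n with
  | zero => simp [hor]
  | succ n =>
    rw [Finset.Nat.sum_antidiagonal_succ, Finset.Nat.sum_antidiagonal_succ' (n := n)]
    change cobd (prodC X X') n l (totMul X X' x y n l) = _
    rw [totMul_apply, map_sum]
    have e : ∀ i ∈ Finset.HasAntidiagonal.antidiagonal n, cobd (prodC X X') n l (∑ j ∈ Finset.HasAntidiagonal.antidiagonal l,
        prodTerm X X' n l i.1 i.2 j.1 j.2 (x i.1 j.1) (y i.2 j.2)) =
        ∑ j ∈ Finset.HasAntidiagonal.antidiagonal l, prodTerm X X' (n + 1) l (i.1 + 1) i.2 j.1 j.2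
          (cobd X i.1 j.1 (x i.1 j.1)) (y i.2 j.2) +
        ∑ j ∈ Finset.HasAntidiagonal.antidiagonal l, prodTerm X X' (n + 1) l i.1 (i.2 + 1) j.1 j.2
          (x i.1 j.1) (cobd X' i.2 j.2 (y i.2 j.2)) := by
      intro i hi
      rw [map_sum, ← Finset.sum_add_distrib]
      exact Finset.sum_congr rfl fun j _ => cobd_prodTerm (Finset.HasAntidiagonal.mem_antidiagonal.mp hi) _ _
    rw [Finset.sum_congr rfl e, Finset.sum_add_distrib]
    simp [hor]

/-- The Leibniz rule. -/
lemma D_totMul (x : Amb X) (y : Amb X') :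
    D (prodC X X') (totMul X X' x y) = totMul X X' (D X x) y + totMul X X' x (D X' y) := by
  ext n l
  rw [Amb.add_apply, totMul_apply, totMul_apply, D_eq, ver, bd_totMul, hor_totMul]
  simp only [D_eq, map_add, LinearMap.add_apply, Finset.sum_add_distrib]
  abel

lemma totMul_mem_Fil {k k' m m' : ℤ} {x : Amb X} {y : Amb X'} (hx : x ∈ Fil X k m)
    (hy : y ∈ Fil X' k' m') : totMul X X' x y ∈ Fil (prodC X X') (k + k') (m + m') := by
  refine ⟨fun n l => ?_, fun n l h => ?_, fun n l h => ?_⟩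
  · rw [totMul_apply]
    refine Submodule.sum_mem _ fun i hi => Submodule.sum_mem _ fun j _ => ?_
    have hi' := Finset.HasAntidiagonal.mem_antidiagonal.mp hi
    cases n with
    | zero => exact Submodule.mem_top
    | succ n =>
      rw [mem_conorm_succ]
      intro k
      rw [map_prodTerm]
      by_cases hk : (k : ℕ) < i.1
      · rw [conorm_map_eq_zero X (hx.1 _ _) _ k hk, map_zero, LinearMap.zero_apply]
        rw [ev_comp, ev_comp, ev_front (by omega) _ (by omega), ev_front (by omega) _ (by omega),
          ev_σ _ _ (by omega), ev_σ _ _ (by omega)]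
        split_ifs <;> omega
      · rw [conorm_map_eq_zero X' (hy.1 _ _) _ (k - i.1) (by omega), map_zero]
        rw [ev_comp, ev_comp, ev_back (by omega) _ (by omega), ev_back (by omega) _ (by omega),
          ev_σ _ _ (by omega), ev_σ _ _ (by omega)]
        split_ifs <;> omega
  · rw [totMul_apply]
    refine Finset.sum_eq_zero fun i hi => Finset.sum_eq_zero fun j hj => ?_
    have hi' := Finset.HasAntidiagonal.mem_antidiagonal.mp hi
    have hj' := Finset.HasAntidiagonal.mem_antidiagonal.mp hj
    by_cases h' : (j.1 : ℤ) - i.1 = m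
    · rw [hy.2.1 _ _ (by omega), map_zero]
    · rw [hx.2.1 _ _ h', map_zero, LinearMap.zero_apply]
  · rw [totMul_apply]
    refine Finset.sum_eq_zero fun i hi => Finset.sum_eq_zero fun j hj => ?_
    have hi' := Finset.HasAntidiagonal.mem_antidiagonal.mp hi
    by_cases h' : k < -(i.1 : ℤ)
    · rw [hx.2.2 _ _ h', map_zero, LinearMap.zero_apply]
    · rw [hy.2.2 _ _ (by omega), map_zero]

/-! ### Functoriality -/

/-- The map induced by a map of cosimplicial spaces. -/
def Amb.map {X Y : CosimplicialSpace.{u}} (f : X ⟶ Y) : Amb X →ₗ[K] Amb Y :=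
  Amb.pi fun p q => S.map (f.app ⦋p⦌) q ∘ₗ Amb.proj X p q

lemma Amb.map_apply {X Y : CosimplicialSpace.{u}} (f : X ⟶ Y) (x : Amb X) (p q : ℕ) :
    Amb.map f x p q = S.map (f.app ⦋p⦌) q (x p q) := rfl

lemma S.map_nat {X Y : CosimplicialSpace.{u}} (f : X ⟶ Y) {p p' : ℕ} (α : ⦋p⦌ ⟶ ⦋p'⦌) (q : ℕ)
    (a : S (X.obj ⦋p⦌) q) :
    S.map (f.app ⦋p'⦌) q (S.map (X.map α) q a) = S.map (Y.map α) q (S.map (f.app ⦋p⦌) q a) := by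
  rw [← S.map_comp, ← S.map_comp, f.naturality]

lemma D_map {X Y : CosimplicialSpace.{u}} (f : X ⟶ Y) (x : Amb X) :
    D Y (Amb.map f x) = Amb.map f (D X x) := by
  ext p q
  cases p with
  | zero => rw [Amb.map_apply, D_zero, D_zero, Amb.map_apply, bd_map]
  | succ p =>
    rw [Amb.map_apply, D_succ, D_succ, map_add, Amb.map_apply, Amb.map_apply, bd_map, cobd_apply,
      cobd_apply, map_sum]
    simp only [S.map_nat]

lemma Amb.map_mem_Fil {X Y : CosimplicialSpace.{u}} (f : X ⟶ Y) {k m : ℤ} {x : Amb X}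
    (hx : x ∈ Fil X k m) : Amb.map f x ∈ Fil Y k m := by
  refine ⟨fun p q => ?_, fun p q h => ?_, fun p q h => ?_⟩
  · rw [Amb.map_apply]
    have := hx.1 p q
    cases p with
    | zero => exact Submodule.mem_top
    | succ p =>
      rw [mem_conorm_succ] at this ⊢
      intro i
      rw [← S.map_nat, this i, map_zero]
  · rw [Amb.map_apply, hx.2.1 _ _ h, map_zero]
  · rw [Amb.map_apply, hx.2.2 _ _ h, map_zero]

end

section

variable {X X' Y : CosimplicialSpace.{u}}

/-! ### Homology of the total complex -/

/-- The homology `H_m(T CN)` of the total complex. -/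
abbrev HT (X : CosimplicialSpace.{u}) (m : ℤ) : Type u :=
  SubQ (TCN X m ⊓ LinearMap.ker (D X)) ((TCN X (m + 1)).map (D X))

/-- The homology `H_m(T CN / F^k)`, in terms of lifted chains: cycles are chains with boundary in
`F^k`, and they are taken modulo boundaries and `F^k`. For `k = -s` this is `H_m(T_{s-1} CN)`. -/
abbrev HTq (X : CosimplicialSpace.{u}) (k m : ℤ) : Type u :=
  SubQ (TCN X m ⊓ (Fil X k (m - 1)).comap (D X)) ((TCN X (m + 1)).map (D X) ⊔ Fil X k m)

/-- The map `H_m(T CN) → H_m(T CN / F^k)`. -/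
def HT.toQuot (X : CosimplicialSpace.{u}) (k m : ℤ) : HT X m →ₗ[K] HTq X k m :=
  SubQ.map LinearMap.id
    (fun x hx => ⟨hx.1, by
      rw [SetLike.mem_coe, Submodule.mem_comap, LinearMap.id_apply, LinearMap.mem_ker.mp hx.2]; exact zero_mem _⟩)
    (fun _ _ hx => Submodule.mem_sup_left hx)

/-! ### The spectral sequence -/

/-- `Z^r_{-s,t} = {x ∈ F^{-s} T_{t-s} | ∂ x ∈ F^{-s-r}}`. -/
def Zr (X : CosimplicialSpace.{u}) (r s t : ℤ) : Submodule K (Amb X) :=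
  Fil X (-s) (t - s) ⊓ (Fil X (-s - r) (t - s - 1)).comap (D X)

/-- `B^r_{-s,t} = ∂ Z^{r-1}_{-s+r-1,t-r+2} + Z^{r-1}_{-s-1,t+1}`, so that the page `E^r_{-s,t}` is
`Z^r_{-s,t} / B^r_{-s,t}`. -/
def Br (X : CosimplicialSpace.{u}) (r s t : ℤ) : Submodule K (Amb X) :=
  (Zr X (r - 1) (s - r + 1) (t - r + 2)).map (D X) ⊔ Zr X (r - 1) (s + 1) (t + 1)

/-- The elements of `F^{-s}` whose class modulo `F^{-s-1}` survives to every page. -/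
def Zinf (X : CosimplicialSpace.{u}) (s t : ℤ) : Submodule K (Amb X) :=
  ⨅ r : ℕ, Zr X r s t ⊔ Fil X (-s - 1) (t - s)

/-- The elements of `F^{-s}` whose class modulo `F^{-s-1}` is hit on some page. -/
def Binf (X : CosimplicialSpace.{u}) (s t : ℤ) : Submodule K (Amb X) :=
  ⨆ r : ℕ, Br X r s t ⊔ Fil X (-s - 1) (t - s)

/-- `E^∞_{-s,t} = (⋂_r (Z^r + F^{-s-1})) / (⋃_r (B^r + F^{-s-1}))`. The submodules
`B^r + F^{-s-1}` increase with `r`, and `E^r = (Z^r + F^{-s-1}) / (B^r + F^{-s-1})`. -/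
abbrev Einf (X : CosimplicialSpace.{u}) (s t : ℤ) : Type u := SubQ (Zinf X s t) (Binf X s t)

lemma TCN_le_Fil (X : CosimplicialSpace.{u}) {k : ℤ} (hk : 0 ≤ k) (m : ℤ) : TCN X m ≤ Fil X k m :=
  Fil_mono X hk m

lemma Fil_cast {k k' m m' : ℤ} (hk : k' = k) (hm : m' = m) {x : Amb X} (hx : x ∈ Fil X k m) :
    x ∈ Fil X k' m' := by subst hk hm; exact hx

lemma mem_Zinf {s t : ℤ} {x : Amb X} :
    x ∈ Zinf X s t ↔ ∀ r : ℕ, ∃ z ∈ Zr X r s t, ∃ f ∈ Fil X (-s - 1) (t - s), z + f = x := by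
  simp only [Zinf, Submodule.mem_iInf, Submodule.mem_sup]

lemma Binf_eq (X : CosimplicialSpace.{u}) (s t : ℤ) :
    Binf X s t = ((TCN X (t - s + 1)).map (D X) ⊓ Fil X (-s) (t - s)) ⊔ Fil X (-s - 1) (t - s) := by
  apply le_antisymm
  · refine iSup_le fun r => sup_le (sup_le ?_ ?_) le_sup_right
    · rintro _ ⟨z, hz, rfl⟩
      exact Submodule.mem_sup_left ⟨⟨z, Fil_cast rfl (by ring) (Fil_le_TCN X _ _ hz.1), rfl⟩,
        Fil_cast (by ring) (by ring) (Submodule.mem_comap.mp hz.2)⟩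
    · exact le_trans (fun z hz => Fil_cast (by ring) (by ring) hz.1) le_sup_right
  · refine sup_le ?_ (le_trans le_sup_right (le_iSup (fun r : ℕ => Br X r s t ⊔ _) 0))
    rintro _ ⟨⟨w, hw, rfl⟩, hw'⟩
    refine le_iSup (fun r : ℕ => Br X r s t ⊔ Fil X (-s - 1) (t - s)) (s.toNat + 1)
      (Submodule.mem_sup_left (Submodule.mem_sup_left ⟨w, ⟨?_, ?_⟩, rfl⟩))
    · exact Fil_cast rfl (by ring)
        (TCN_le_Fil X (k := -(s - ((s.toNat + 1 : ℕ) : ℤ) + 1)) (by push_cast; omega) _ hw)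
    · exact Submodule.mem_comap.mpr (Fil_cast (by ring) (by ring) hw')

lemma totMul_mem_Fil' {k k' m m' k'' m'' : ℤ} (hk : k + k' ≤ k'') (hm : m + m' = m'')
    {x : Amb X} {y : Amb X'} (hx : x ∈ Fil X k m) (hy : y ∈ Fil X' k' m') :
    totMul X X' x y ∈ Fil (prodC X X') k'' m'' := by
  subst hm
  exact Fil_mono _ hk _ (totMul_mem_Fil hx hy)

lemma Zinf_le_Fil (X : CosimplicialSpace.{u}) (s t : ℤ) : Zinf X s t ≤ Fil X (-s) (t - s) := by
  intro x hx
  obtain ⟨z, hz, f, hf, rfl⟩ := mem_Zinf.mp hx 0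
  exact add_mem hz.1 (Fil_mono X (by omega) _ hf)

lemma totMul_mem_Zinf {s t s' t' : ℤ} {x : Amb X} {y : Amb X'} (hx : x ∈ Zinf X s t)
    (hy : y ∈ Zinf X' s' t') : totMul X X' x y ∈ Zinf (prodC X X') (s + s') (t + t') := by
  rw [mem_Zinf]
  intro r
  obtain ⟨z, hz, f, hf, rfl⟩ := mem_Zinf.mp hx r
  obtain ⟨w, hw, g, hg, rfl⟩ := mem_Zinf.mp hy r
  refine ⟨totMul X X' z w, ⟨?_, ?_⟩, totMul X X' z g + totMul X X' f (w + g), ?_, ?_⟩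
  · exact totMul_mem_Fil' (by omega) (by omega) hz.1 hw.1
  · rw [SetLike.mem_coe, Submodule.mem_comap, D_totMul]
    exact add_mem (totMul_mem_Fil' (by omega) (by omega) hz.2 hw.1)
      (totMul_mem_Fil' (by omega) (by omega) hz.1 hw.2)
  · exact add_mem (totMul_mem_Fil' (by omega) (by omega) hz.1 hg)
      (totMul_mem_Fil' (by omega) (by omega) hf (Zinf_le_Fil _ _ _ hy))
  · simp only [map_add, LinearMap.add_apply]; abel

lemma totMul_mem_Binf {s t s' t' : ℤ} {x : Amb X} {y : Amb X'} (hx : x ∈ Binf X s t)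
    (hy : y ∈ Zinf X' s' t') : totMul X X' x y ∈ Binf (prodC X X') (s + s') (t + t') := by
  rw [Binf_eq] at hx ⊢
  obtain ⟨_, ⟨⟨w, hw, rfl⟩, hw'⟩, f, hf, rfl⟩ := Submodule.mem_sup.mp hx
  obtain ⟨y', hy', g, hg, rfl⟩ := mem_Zinf.mp hy (s.toNat + 1)
  have e : totMul X X' (D X w + f) (y' + g) = D _ (totMul X X' w y') +
      (totMul X X' w (D X' y') + totMul X X' (D X w) g + totMul X X' f (y' + g)) := by
    rw [D_totMul]
    have := add_self_K (totMul X X' w (D X' y'))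
    simp only [map_add, LinearMap.add_apply]
    generalize totMul X X' w (D X' y') = c at *
    calc _ = totMul X X' (D X w) y' + (c + c) + (totMul X X' (D X w) g +
          (totMul X X' f y' + totMul X X' f g)) := by rw [this]; abel
      _ = _ := by abel
  have hwy : totMul X X' w (D X' y') ∈ Fil (prodC X X') (-(s + s') - 1) (t + t' - (s + s')) :=
    totMul_mem_Fil' (by push_cast; omega) (by omega) hw hy'.2
  rw [e]
  refine Submodule.add_mem_sup ⟨⟨_, ?_, rfl⟩, ?_⟩ (add_mem (add_mem hwy ?_) ?_)
  · exact totMul_mem_Fil' (k := 0) (k' := 0) (by omega) (by omega) hw (Fil_le_TCN _ _ _ hy'.1)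
  · rw [D_totMul]
    exact add_mem (totMul_mem_Fil' (by omega) (by omega) hw' hy'.1)
      (Fil_mono _ (by omega) _ hwy)
  · exact totMul_mem_Fil' (by omega) (by omega) hw' hg
  · exact totMul_mem_Fil' (by omega) (by omega) hf (Zinf_le_Fil _ _ _ hy)

lemma totMul_mem_Binf' {s t s' t' : ℤ} {x : Amb X} {y : Amb X'} (hx : x ∈ Zinf X s t)
    (hy : y ∈ Binf X' s' t') : totMul X X' x y ∈ Binf (prodC X X') (s + s') (t + t') := by
  rw [Binf_eq] at hy ⊢
  obtain ⟨_, ⟨⟨w, hw, rfl⟩, hw'⟩, f, hf, rfl⟩ := Submodule.mem_sup.mp hy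
  obtain ⟨x', hx', g, hg, rfl⟩ := mem_Zinf.mp hx (s'.toNat + 1)
  have e : totMul X X' (x' + g) (D X' w + f) = D _ (totMul X X' x' w) +
      (totMul X X' (D X x') w + totMul X X' g (D X' w) + totMul X X' (x' + g) f) := by
    rw [D_totMul]
    have := add_self_K (totMul X X' (D X x') w)
    simp only [map_add, LinearMap.add_apply]
    generalize totMul X X' (D X x') w = c at *
    calc _ = totMul X X' x' (D X' w) + (c + c) + (totMul X X' g (D X' w) +
          (totMul X X' x' f + totMul X X' g f)) := by rw [this]; abel
      _ = _ := by abel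
  have hwy : totMul X X' (D X x') w ∈ Fil (prodC X X') (-(s + s') - 1) (t + t' - (s + s')) :=
    totMul_mem_Fil' (by push_cast; omega) (by omega) hx'.2 hw
  rw [e]
  refine Submodule.add_mem_sup ⟨⟨_, ?_, rfl⟩, ?_⟩ (add_mem (add_mem hwy ?_) ?_)
  · exact totMul_mem_Fil' (k := 0) (k' := 0) (by omega) (by omega) (Fil_le_TCN _ _ _ hx'.1) hw
  · rw [D_totMul]
    exact add_mem (Fil_mono _ (by omega) _ hwy)
      (totMul_mem_Fil' (by omega) (by omega) hx'.1 hw')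
  · exact totMul_mem_Fil' (by omega) (by omega) hg hw'
  · exact totMul_mem_Fil' (by omega) (by omega) (Zinf_le_Fil _ _ _ hx) hf

/-- The external multiplication on `E^∞`, induced by the product of total complexes. -/
def Einf.cross (X X' : CosimplicialSpace.{u}) (s t s' t' : ℤ) :
    Einf X s t →ₗ[K] Einf X' s' t' →ₗ[K] Einf (prodC X X') (s + s') (t + t') :=
  SubQ.map₂ (totMul X X') (fun _ hx _ hy => totMul_mem_Zinf hx hy)
    (fun _ _ hx _ hy => totMul_mem_Binf hx hy) (fun _ hx _ _ hy => totMul_mem_Binf' hx hy)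

/-- The map induced on `E^∞` by a map of cosimplicial spaces. -/
def Einf.map (f : X ⟶ Y) (s t : ℤ) : Einf X s t →ₗ[K] Einf Y s t :=
  SubQ.map (Amb.map f)
    (fun x hx => by
      rw [mem_Zinf] at hx ⊢
      intro r
      obtain ⟨z, hz, g, hg, rfl⟩ := hx r
      refine ⟨_, ⟨Amb.map_mem_Fil f hz.1, ?_⟩, _, Amb.map_mem_Fil f hg, (map_add _ _ _).symm⟩
      rw [SetLike.mem_coe, Submodule.mem_comap, D_map]
      exact Amb.map_mem_Fil f hz.2)
    (fun x _ hx => by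
      rw [Binf_eq] at hx ⊢
      obtain ⟨_, ⟨⟨w, hw, rfl⟩, hw'⟩, g, hg, rfl⟩ := Submodule.mem_sup.mp hx
      rw [map_add]
      refine Submodule.add_mem_sup ⟨⟨_, Amb.map_mem_Fil f hw, D_map f w⟩, ?_⟩
        (Amb.map_mem_Fil f hg)
      exact Amb.map_mem_Fil f hw')

end

section

variable {X X' Y : CosimplicialSpace.{u}}

/-! ### Totalization -/

lemma std_map_id (p : SimplexCategory) :
    SSet.stdSimplex.{u}.map (𝟙 p) = 𝟙 (SSet.stdSimplex.{u}.obj p) :=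
  CategoryTheory.Functor.map_id (D := SSet.{u}) SSet.stdSimplex p

lemma std_map_comp {p q r : SimplexCategory} (α : p ⟶ q) (β : q ⟶ r) :
    SSet.stdSimplex.{u}.map (α ≫ β) = SSet.stdSimplex.{u}.map α ≫ SSet.stdSimplex.{u}.map β :=
  CategoryTheory.Functor.map_comp (D := SSet.{u}) SSet.stdSimplex α β

/-- The cosimplicial space `Δ^• × Δ^q`. -/
def totDom (q : SimplexCategory) : CosimplicialSpace.{u} where
  obj p := SSet.stdSimplex.obj p ⊗ SSet.stdSimplex.obj q
  map α := SSet.stdSimplex.map α ▷ SSet.stdSimplex.obj q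
  map_id p := by rw [std_map_id, id_whiskerRight]
  map_comp α β := by rw [std_map_comp, comp_whiskerRight]

/-- The functoriality of `Δ^• × Δ^q` in `q`. -/
def totDomMap {q q' : SimplexCategory} (θ : q ⟶ q') : totDom.{u} q ⟶ totDom q' where
  app p := SSet.stdSimplex.obj p ◁ SSet.stdSimplex.map θ
  naturality _ _ α := (whisker_exchange (SSet.stdSimplex.map α) (SSet.stdSimplex.map θ)).symm

lemma totDomMap_id (q : SimplexCategory) : totDomMap (𝟙 q) = 𝟙 (totDom.{u} q) := by
  refine NatTrans.ext (funext fun p => ?_)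
  change SSet.stdSimplex.obj p ◁ SSet.stdSimplex.map (𝟙 q) = 𝟙 (SSet.stdSimplex.obj p ⊗ _)
  rw [std_map_id, whiskerLeft_id]

lemma totDomMap_comp {q q' q'' : SimplexCategory} (θ : q ⟶ q') (θ' : q' ⟶ q'') :
    totDomMap.{u} (θ ≫ θ') = totDomMap θ ≫ totDomMap θ' := by
  refine NatTrans.ext (funext fun p => ?_)
  change SSet.stdSimplex.obj p ◁ SSet.stdSimplex.map (θ ≫ θ') =
    SSet.stdSimplex.obj p ◁ SSet.stdSimplex.map θ ≫ SSet.stdSimplex.obj p ◁ SSet.stdSimplex.map θ'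
  rw [std_map_comp, whiskerLeft_comp]

/-- `Tot X`: its `q`-simplices are the maps `Δ^• × Δ^q → X` of cosimplicial spaces. -/
def Tot (X : CosimplicialSpace.{u}) : SSet.{u} where
  obj q := totDom q.unop ⟶ X
  map θ := ↾fun f => totDomMap θ.unop ≫ f
  map_id q := by
    refine ConcreteCategory.hom_ext _ _ fun f => ?_
    change totDomMap (𝟙 q.unop) ≫ f = f
    rw [totDomMap_id, Category.id_comp]
  map_comp θ θ' := by
    refine ConcreteCategory.hom_ext _ _ fun f => ?_
    change totDomMap (θ'.unop ≫ θ.unop) ≫ f = totDomMap θ'.unop ≫ totDomMap θ.unop ≫ f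
    rw [totDomMap_comp, Category.assoc]

lemma Tot.map_eq (X : CosimplicialSpace.{u}) {q q' : SimplexCategoryᵒᵖ} (θ : q ⟶ q')
    (f : (Tot X).obj q) : (Tot X).map θ f = totDomMap θ.unop ≫ f := rfl

/-- The component of a simplex of `Tot X`. -/
def Tot.comp {X : CosimplicialSpace.{u}} {n : ℕ} (f : (Tot X) _⦋n⦌) (p : ℕ) :
    (Δ[p] ⊗ Δ[n] : SSet.{u}) ⟶ X.obj ⦋p⦌ := NatTrans.app (F := totDom ⦋n⦌) f ⦋p⦌

lemma Tot.comp_map {X : CosimplicialSpace.{u}} {n m : ℕ} (θ : ⦋n⦌ ⟶ ⦋m⦌) (f : (Tot X) _⦋m⦌)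
    (p : ℕ) : Tot.comp ((Tot X).map θ.op f) p =
      (Δ[p] ◁ SSet.stdSimplex.map θ) ≫ Tot.comp f p := rfl

lemma Tot.comp_nat {X : CosimplicialSpace.{u}} {n : ℕ} (f : (Tot X) _⦋n⦌) {p p' : ℕ}
    (α : ⦋p⦌ ⟶ ⦋p'⦌) : (SSet.stdSimplex.map α ▷ Δ[n]) ≫ Tot.comp f p' =
      Tot.comp f p ≫ X.map α :=
  NatTrans.naturality (F := totDom ⦋n⦌) f α

/-- The class of the top dimensional simplex of `Δ^k`. -/
def fund (k : ℕ) : S (Δ[k] : SSet.{u}) k := sm (SSet.stdSimplex.objEquiv.symm (𝟙 ⦋k⦌))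

lemma map_fund_eq_zero {k m : ℕ} (h : m < k) (γ : ⦋k⦌ ⟶ ⦋m⦌) :
    S.map (SSet.stdSimplex.map γ) k (fund.{u} k) = 0 := by
  rw [fund, S.map_sm]
  refine sm_degenerate ⟨m, h, γ, SSet.stdSimplex.objEquiv.symm (𝟙 ⦋m⦌), ?_⟩
  rw [SSet.stdSimplex.map_objEquiv_symm, ← SSet.stdSimplex.objEquiv_symm_comp]
  rfl

lemma bd_fund (k : ℕ) : bd _ k (fund.{u} (k + 1)) =
    ∑ j : Fin (k + 2), S.map (SSet.stdSimplex.map (SimplexCategory.δ j)) k (fund k) := by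
  rw [fund, bd_sm]
  refine Finset.sum_congr rfl fun j _ => ?_
  rw [fund, S.map_sm, ← SSet.stdSimplex.objEquiv_symm_comp]
  congr 1

/-- The image `ι_k ∧ ι_n` of `ι_k ⊗ ι_n` under the shuffle map. -/
def wedge (k n l : ℕ) : S (Δ[k] ⊗ Δ[n] : SSet.{u}) l :=
  cross Δ[k] Δ[n] k n l (fund k) (fund n)

/-- The composite `S_n(Tot X) → N_n Tot(𝔽₂ X) → (T CN)_n`, which sends a simplex `f` to the family
with components `f_*(ι_p ∧ ι_n)`. -/
def phi (X : CosimplicialSpace.{u}) (n : ℕ) : S (Tot X) n →ₗ[K] Amb X :=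
  S.lift (fun f => Amb.mk fun p q => S.map (Tot.comp f p) q (wedge p n q)) (by
    rintro _ ⟨m, hm, γ, g, rfl⟩
    ext p q
    change S.map (Tot.comp ((Tot X).map γ.op g) p) q _ = 0
    rw [Tot.comp_map, S.map_comp, wedge, ← id_tensorHom, cross_map, map_fund_eq_zero hm,
      map_zero, map_zero])

lemma phi_sm (n : ℕ) (f : (Tot X) _⦋n⦌) (p q : ℕ) :
    phi X n (sm f) p q = S.map (Tot.comp f p) q (wedge p n q) := by
  unfold phi
  rw [S.lift_sm, Amb.mk_apply]

lemma phi_mem_TCN (n : ℕ) (x : S (Tot X) n) : phi X n x ∈ TCN X n := by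
  have : (⊤ : Submodule K (S (Tot X) n)) ≤ (TCN X n).comap (phi X n) := by
    have hs : Submodule.span K (Set.range (sm (Z := Tot X) (n := n))) = ⊤ := by
      rw [eq_top_iff]
      rintro y -
      have : Submodule.mkQ (Submodule.span K (Set.range (sm (Z := Tot X) (n := n)))) = 0 :=
        S.hom_ext fun x => by
          rw [Submodule.mkQ_apply, LinearMap.zero_apply, Submodule.Quotient.mk_eq_zero]
          exact Submodule.subset_span ⟨x, rfl⟩
      rw [← Submodule.Quotient.mk_eq_zero, ← Submodule.mkQ_apply, this, LinearMap.zero_apply]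
    rw [← hs, Submodule.span_le]
    rintro _ ⟨f, rfl⟩
    change phi X n (sm f) ∈ TCN X n
    refine ⟨fun p q => ?_, fun p q h => ?_, fun p q h => absurd h (by omega)⟩
    · rw [phi_sm]
      cases p with
      | zero => exact Submodule.mem_top
      | succ p =>
        rw [mem_conorm_succ]
        intro i
        rw [← S.map_comp, ← Tot.comp_nat, S.map_comp, wedge, ← tensorHom_id, cross_map,
          map_fund_eq_zero (Nat.lt_succ_self p), map_zero, LinearMap.zero_apply, map_zero]
    · rw [phi_sm, wedge, cross_eq_zero (by omega), map_zero]
  exact this Submodule.mem_top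

lemma bd_cross' {Z Z' : SSet.{u}} (p q n : ℕ) (x : S Z p) (y : S Z' q) :
    bd (Z ⊗ Z') n (cross Z Z' p q (n + 1) x y) =
      cross Z Z' (p - 1) q n (dd Z p x) y + cross Z Z' p (q - 1) n x (dd Z' q y) := by
  by_cases h : p + q = n + 1
  · exact bd_cross h x y
  · rw [cross_eq_zero h, map_zero]
    rcases p with _ | p <;> rcases q with _ | q
    · simp [dd]
    · rw [cross_eq_zero (p := 0) (q := q + 1 - 1) (by omega)]; simp [dd]
    · rw [cross_eq_zero (p := p + 1 - 1) (q := 0) (by omega)]; simp [dd]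
    · rw [cross_eq_zero (p := p + 1 - 1) (by omega), cross_eq_zero (q := q + 1 - 1) (by omega),
        add_zero]

/-- `phi` is a chain map. -/
lemma D_phi (n : ℕ) (x : S (Tot X) n) : D X (phi X n x) = phi X (n - 1) (dd (Tot X) n x) := by
  have : D X ∘ₗ phi X n = phi X (n - 1) ∘ₗ dd (Tot X) n := by
    refine S.hom_ext fun f => ?_
    simp only [LinearMap.comp_apply]
    ext p q
    have e1 : ver X (phi X n (sm f)) p q =
        S.map (Tot.comp f p) q (cross _ _ (p - 1) n q (dd _ p (fund p)) (fund n)) +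
        S.map (Tot.comp f p) q (cross _ _ p (n - 1) q (fund p) (dd _ n (fund n))) := by
      rw [ver, phi_sm, bd_map, wedge, bd_cross', map_add]
    have e2 : hor X p q (phi X n (sm f)) =
        S.map (Tot.comp f p) q (cross _ _ (p - 1) n q (dd _ p (fund p)) (fund n)) := by
      cases p with
      | zero => simp [hor, dd]
      | succ p =>
        change cobd X p q (phi X n (sm f) p q) =
          S.map (Tot.comp f (p + 1)) q (cross _ _ p n q (bd _ p (fund (p + 1))) (fund n))
        rw [cobd_apply, bd_fund, map_sum, LinearMap.sum_apply, map_sum]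
        refine Finset.sum_congr rfl fun j _ => ?_
        rw [phi_sm, ← S.map_comp, ← Tot.comp_nat, S.map_comp, wedge, ← tensorHom_id, cross_map,
          S.map_id]
    have e3 : S.map (Tot.comp f p) q (cross _ _ p (n - 1) q (fund p) (dd _ n (fund n))) =
        phi X (n - 1) (dd (Tot X) n (sm f)) p q := by
      cases n with
      | zero => simp [dd]
      | succ n =>
        change S.map (Tot.comp f p) q (cross _ _ p n q (fund p) (bd _ n (fund (n + 1)))) =
          phi X n (bd (Tot X) n (sm f)) p q
        rw [bd_sm, bd_fund, map_sum, map_sum, map_sum,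
          ← Amb.proj_apply (∑ j : Fin (n + 2), phi X n (sm ((Tot X).δ j f))), map_sum]
        refine Finset.sum_congr rfl fun j _ => ?_
        rw [Amb.proj_apply, phi_sm]
        change _ = S.map (Tot.comp ((Tot X).map (SimplexCategory.δ j).op f) p) q _
        rw [Tot.comp_map, S.map_comp, wedge, ← id_tensorHom, cross_map, S.map_id]
    rw [D_eq, e1, e2, e3, add_comm, ← add_assoc, add_self_K, zero_add]
  exact congrArg (fun g => g x) this

/-- The induced map `H_n(Tot X) → H_n(T CN)`. -/
def Hphi (X : CosimplicialSpace.{u}) (n : ℕ) : H (Tot X) n →ₗ[K] HT X n :=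
  SubQ.map (phi X n)
    (fun x hx => ⟨phi_mem_TCN n x, by
      rw [LinearMap.mem_ker] at hx
      rw [SetLike.mem_coe, LinearMap.mem_ker, D_phi, hx, map_zero]⟩)
    (fun x _ hx => by
      obtain ⟨w, rfl⟩ := hx
      refine ⟨phi X (n + 1) w, ?_, D_phi (n + 1) w⟩
      have := phi_mem_TCN (n + 1) w
      push_cast at this
      exact this)

/-- `F^{-s} H_n(Tot X)`, the kernel of `H_n(Tot X) → H_n(T CN) → H_n(T_{s-1} CN)`. -/
def FH (X : CosimplicialSpace.{u}) (s : ℤ) (n : ℕ) : Submodule K (H (Tot X) n) :=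
  LinearMap.ker (HT.toQuot X (-s) n ∘ₗ Hphi X n)

/-- The filtration quotient `(F^{-s} / F^{-s-1}) H_n(Tot X)`. -/
abbrev GrH (X : CosimplicialSpace.{u}) (s : ℤ) (n : ℕ) : Type u := SubQ (FH X s n) (FH X (s + 1) n)

lemma exists_rep_of_toQuot {k m : ℤ} (a : HT X m) (ha : HT.toQuot X k m a = 0) :
    ∃ z ∈ Fil X k m, ∃ h : z ∈ TCN X m ⊓ LinearMap.ker (D X), SubQ.mk _ z h = a := by
  obtain ⟨x, hx, rfl⟩ := SubQ.exists_rep a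
  have h1 : x ∈ (TCN X (m + 1)).map (D X) ⊔ Fil X k m := SubQ.mk_eq_zero.mp ha
  obtain ⟨_, ⟨w, hw, rfl⟩, z, hz, rfl⟩ := Submodule.mem_sup.mp h1
  refine ⟨z, hz, ⟨Fil_le_TCN X _ _ hz, ?_⟩, ?_⟩
  · have h2 := LinearMap.mem_ker.mp hx.2
    rw [map_add, D_D, zero_add] at h2
    exact h2
  · refine SubQ.mk_eq_mk.mpr (Submodule.mem_map.mpr ⟨-w, neg_mem hw, ?_⟩)
    rw [map_neg]; abel

end

section

variable {X X' Y : CosimplicialSpace.{u}}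

lemma mem_Zinf_of_cycle {s t : ℤ} {z : Amb X} (hz : z ∈ Fil X (-s) (t - s)) (h : D X z = 0) :
    z ∈ Zinf X s t :=
  mem_Zinf.mpr fun r => ⟨z, ⟨hz, by
    rw [SetLike.mem_coe, Submodule.mem_comap, h]; exact zero_mem _⟩, 0, zero_mem _, add_zero z⟩

/-- A class in the kernel of `H_m(T) → H_m(T / F^{-s})` has a representative in `F^{-s}`. -/
lemma exists_rep_Einf {s t m : ℤ} (hm : m = t - s)
    (a : LinearMap.ker (HT.toQuot X (-s) m)) :
    ∃ (z : Amb X) (h : z ∈ TCN X m ⊓ LinearMap.ker (D X)) (h' : z ∈ Zinf X s t),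
      z ∈ Fil X (-s) m ∧ SubQ.mk _ z h = (a : HT X m) := by
  obtain ⟨z, hz, h, e⟩ := exists_rep_of_toQuot a.1 (LinearMap.mem_ker.mp a.2)
  exact ⟨z, h, mem_Zinf_of_cycle (hm ▸ hz) (LinearMap.mem_ker.mp h.2), hz, e⟩

lemma rep_Einf_unique {s t m : ℤ} (hm : m = t - s) {z z' : Amb X}
    (h : z ∈ TCN X m ⊓ LinearMap.ker (D X)) (h' : z' ∈ TCN X m ⊓ LinearMap.ker (D X))
    (hz : z ∈ Fil X (-s) m) (hz' : z' ∈ Fil X (-s) m)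
    (e : SubQ.mk ((TCN X (m + 1)).map (D X)) z h = SubQ.mk _ z' h') : z - z' ∈ Binf X s t := by
  subst hm
  rw [Binf_eq]
  exact Submodule.mem_sup_left ⟨SubQ.mk_eq_mk.mp e, sub_mem hz hz'⟩

/-- The map `ι` on a class of `H_m(T)` coming from filtration `-s`: choose a cycle in `F^{-s}`
representing it, and take the class of that cycle in `E^∞_{-s,t}`. -/
def iotaT (X : CosimplicialSpace.{u}) (s t m : ℤ) (hm : m = t - s) :
    LinearMap.ker (HT.toQuot X (-s) m) →ₗ[K] Einf X s t where
  toFun a := SubQ.mk _ (exists_rep_Einf hm a).choose (exists_rep_Einf hm a).choose_spec.choose_spec.choose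
  map_add' a b := by
    obtain ⟨h1, h2, h3, h4⟩ := (exists_rep_Einf hm a).choose_spec
    obtain ⟨k1, k2, k3, k4⟩ := (exists_rep_Einf hm b).choose_spec
    obtain ⟨l1, l2, l3, l4⟩ := (exists_rep_Einf hm (a + b)).choose_spec
    refine SubQ.mk_eq_mk.mpr (rep_Einf_unique hm l1 (add_mem h1 k1) l3 (add_mem h3 k3) ?_)
    exact l4.trans (congrArg₂ (· + ·) h4.symm k4.symm)
  map_smul' c a := by
    obtain ⟨h1, h2, h3, h4⟩ := (exists_rep_Einf hm a).choose_spec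
    obtain ⟨l1, l2, l3, l4⟩ := (exists_rep_Einf hm (c • a)).choose_spec
    refine SubQ.mk_eq_mk.mpr (rep_Einf_unique hm l1 (Submodule.smul_mem _ c h1) l3
      (Submodule.smul_mem _ c h3) ?_)
    exact l4.trans (congrArg (c • ·) h4.symm)

lemma iotaT_eq {s t m : ℤ} (hm : m = t - s) (a : LinearMap.ker (HT.toQuot X (-s) m)) {z : Amb X}
    (h : z ∈ TCN X m ⊓ LinearMap.ker (D X)) (h' : z ∈ Zinf X s t) (hz : z ∈ Fil X (-s) m)
    (e : SubQ.mk _ z h = (a : HT X m)) : iotaT X s t m hm a = SubQ.mk _ z h' := by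
  obtain ⟨h1, h2, h3, h4⟩ := (exists_rep_Einf hm a).choose_spec
  exact SubQ.mk_eq_mk.mpr (rep_Einf_unique hm h1 h h3 hz (h4.trans e.symm))

/-- The map `ι : (F^{-s} / F^{-s-1}) H_{t-s}(Tot X) → E^∞_{-s,t}`. -/
def iota (X : CosimplicialSpace.{u}) (s t : ℤ) (n : ℕ) (h : (n : ℤ) = t - s) :
    GrH X s n →ₗ[K] Einf X s t :=
  Submodule.liftQ _
    (iotaT X s t n h ∘ₗ (Hphi X n).restrict (p := FH X s n) fun a ha => ha)
    (by
      intro a ha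
      have ha' : (Hphi X n) a.1 ∈ LinearMap.ker (HT.toQuot X (-(s + 1)) n) := ha
      obtain ⟨z, hz, h1, e⟩ := exists_rep_of_toQuot _ (LinearMap.mem_ker.mp ha')
      have hz' : z ∈ Fil X (-s) n := Fil_mono X (by omega) _ hz
      rw [LinearMap.mem_ker, LinearMap.comp_apply,
        iotaT_eq h _ h1 (mem_Zinf_of_cycle (h ▸ hz') (LinearMap.mem_ker.mp h1.2)) hz' e,
        SubQ.mk_eq_zero, Binf_eq]
      exact Submodule.mem_sup_right (Fil_cast (by ring) h.symm hz))

/-- `ι` sends the class of `a` to the class of any cycle in `F^{-s}` which represents the image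
of `a` in the homology of the total complex. -/
lemma iota_mk {s t : ℤ} {n : ℕ} (h : (n : ℤ) = t - s) (a : H (Tot X) n) (ha : a ∈ FH X s n)
    {z : Amb X} (h1 : z ∈ TCN X n ⊓ LinearMap.ker (D X)) (h2 : z ∈ Zinf X s t)
    (hz : z ∈ Fil X (-s) n) (e : SubQ.mk _ z h1 = Hphi X n a) :
    iota X s t n h (SubQ.mk _ a ha) = SubQ.mk _ z h2 :=
  iotaT_eq h ⟨Hphi X n a, ha⟩ h1 h2 hz e

end

section

/-! ### Operads of simplicial sets and their algebras -/

/-- The blocks of sizes `j 0, …, j (k - 1)`, put one after the other, as a single block. -/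
abbrev flat {k : ℕ} (j : Fin k → ℕ) : (Σ i, Fin (j i)) ≃ Fin (∑ i, j i) := finSigmaFinEquiv

lemma sum_flat {k : ℕ} (j : Fin k → ℕ) (m : ∀ i, Fin (j i) → ℕ) :
    ∑ r, m ((flat j).symm r).1 ((flat j).symm r).2 = ∑ i, ∑ l, m i l := by
  exact (Equiv.sum_comp (flat j).symm fun x : Σ i, Fin (j i) => m x.1 x.2).trans
    (Fintype.sum_sigma fun x : Σ i, Fin (j i) => m x.1 x.2)

/-- A symmetric operad in simplicial sets. The symmetric groups act from the left: `map σ`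
relabels the input `i` as the input `σ i`, so `map σ` is the right action of `σ⁻¹`. The
composition `comp j a b` is `γ(a; b_0, …, b_{k - 1})`. -/
structure SSetOperad : Type (u + 1) where
  obj : ℕ → SSet.{u}
  map {m n : ℕ} (σ : Fin m ≃ Fin n) : obj m ⟶ obj n
  map_refl (n : ℕ) : map (Equiv.refl (Fin n)) = 𝟙 (obj n)
  map_trans {l m n : ℕ} (σ : Fin l ≃ Fin m) (τ : Fin m ≃ Fin n) :
    map (σ.trans τ) = map σ ≫ map τ
  one (q : SimplexCategoryᵒᵖ) : (obj 1).obj q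
  one_nat {q q' : SimplexCategoryᵒᵖ} (θ : q ⟶ q') : (obj 1).map θ (one q) = one q'
  comp {k : ℕ} (j : Fin k → ℕ) {q : SimplexCategoryᵒᵖ} (a : (obj k).obj q)
    (b : ∀ i, (obj (j i)).obj q) : (obj (∑ i, j i)).obj q
  comp_nat {k : ℕ} (j : Fin k → ℕ) {q q' : SimplexCategoryᵒᵖ} (θ : q ⟶ q') (a : (obj k).obj q)
    (b : ∀ i, (obj (j i)).obj q) :
    (obj (∑ i, j i)).map θ (comp j a b) =
      comp j ((obj k).map θ a) (fun i => (obj (j i)).map θ (b i))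
  one_comp {n : ℕ} {q : SimplexCategoryᵒᵖ} (a : (obj n).obj q) :
    comp (fun _ : Fin 1 => n) (one q) (fun _ => a) = (map (finCongr (by simp))).app q a
  comp_one {n : ℕ} {q : SimplexCategoryᵒᵖ} (a : (obj n).obj q) :
    comp (fun _ : Fin n => 1) a (fun _ => one q) = (map (finCongr (by simp))).app q a
  assoc {k : ℕ} (j : Fin k → ℕ) (m : ∀ i, Fin (j i) → ℕ) {q : SimplexCategoryᵒᵖ}
    (a : (obj k).obj q) (b : ∀ i, (obj (j i)).obj q) (c : ∀ i l, (obj (m i l)).obj q) :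
    comp (fun i => ∑ l, m i l) a (fun i => comp (m i) (b i) (c i)) =
      (map (finCongr (sum_flat j m))).app q
        (comp (fun r => m ((flat j).symm r).1 ((flat j).symm r).2) (comp j a b)
          (fun r => c ((flat j).symm r).1 ((flat j).symm r).2))
  comp_map_inner {k : ℕ} (j j' : Fin k → ℕ) (τ : ∀ i, Fin (j i) ≃ Fin (j' i))
    {q : SimplexCategoryᵒᵖ} (a : (obj k).obj q) (b : ∀ i, (obj (j i)).obj q) :
    comp j' a (fun i => (map (τ i)).app q (b i)) =
      (map (((flat j).symm.trans (Equiv.sigmaCongrRight τ)).trans (flat j'))).app q (comp j a b)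
  comp_map_outer {k k' : ℕ} (σ : Fin k ≃ Fin k') (j : Fin k' → ℕ) {q : SimplexCategoryᵒᵖ}
    (a : (obj k).obj q) (b : ∀ i, (obj (j i)).obj q) :
    comp j ((map σ).app q a) b =
      (map (((flat (fun i => j (σ i))).symm.trans
        (Equiv.sigmaCongrLeft (β := fun i => Fin (j i)) σ)).trans (flat j))).app q
        (comp (fun i => j (σ i)) a (fun i => b (σ i)))

/-- An `E_∞` operad: every `C(n)` is contractible, with a free action of the symmetric group. -/
structure SSetOperad.IsEInfinity (C : SSetOperad.{u}) : Prop where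
  contractible (n : ℕ) : ContractibleSpace (SSet.toTop.obj (C.obj n))
  free {n : ℕ} {q : SimplexCategoryᵒᵖ} (σ : Equiv.Perm (Fin n)) (a : (C.obj n).obj q) :
    (C.map σ).app q a = a → σ = 1

/-- The structure of an algebra over `C` on a simplicial set: `act a x` is `θ(a; x_0, …)`. -/
structure OperadAlgebra (C : SSetOperad.{u}) (Z : SSet.{u}) : Type u where
  act {n : ℕ} {q : SimplexCategoryᵒᵖ} (a : (C.obj n).obj q) (x : Fin n → Z.obj q) : Z.obj q
  act_nat {n : ℕ} {q q' : SimplexCategoryᵒᵖ} (θ : q ⟶ q') (a : (C.obj n).obj q)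
    (x : Fin n → Z.obj q) :
    Z.map θ (act a x) = act ((C.obj n).map θ a) (fun i => Z.map θ (x i))
  act_one {q : SimplexCategoryᵒᵖ} (x : Fin 1 → Z.obj q) : act (C.one q) x = x 0
  act_comp {k : ℕ} (j : Fin k → ℕ) {q : SimplexCategoryᵒᵖ} (a : (C.obj k).obj q)
    (b : ∀ i, (C.obj (j i)).obj q) (x : Fin (∑ i, j i) → Z.obj q) :
    act (C.comp j a b) x = act a (fun i => act (b i) (fun l => x (flat j ⟨i, l⟩)))
  act_map {m n : ℕ} (σ : Fin m ≃ Fin n) {q : SimplexCategoryᵒᵖ} (a : (C.obj m).obj q)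
    (x : Fin n → Z.obj q) : act ((C.map σ).app q a) x = act a (fun i => x (σ i))

/-- A cosimplicial space with the structure of a cosimplicial `C`-space: every `X^p` is an algebra
over `C`, and every cosimplicial operator is a map of algebras. -/
structure CosimplicialAlgebra (C : SSetOperad.{u}) (X : CosimplicialSpace.{u}) : Type u where
  alg (p : SimplexCategory) : OperadAlgebra C (X.obj p)
  map_act {p p' : SimplexCategory} (α : p ⟶ p') {n : ℕ} {q : SimplexCategoryᵒᵖ}
    (a : (C.obj n).obj q) (x : Fin n → (X.obj p).obj q) :
    (X.map α).app q ((alg p).act a x) = (alg p').act a (fun i => (X.map α).app q (x i))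

variable {C : SSetOperad.{u}} {Z : SSet.{u}} {X : CosimplicialSpace.{u}}

/-- A simplex of `Tot X` from its values on the simplices of `Δ^p × Δ^q`. -/
def Tot.mk {q : SimplexCategory}
    (f : ∀ (p : SimplexCategory) (r : SimplexCategoryᵒᵖ),
      ((totDom.{u} q).obj p).obj r → (X.obj p).obj r)
    (h1 : ∀ p (r r' : SimplexCategoryᵒᵖ) (θ : r ⟶ r') (x : ((totDom.{u} q).obj p).obj r),
      f p r' (((totDom q).obj p).map θ x) = (X.obj p).map θ (f p r x))
    (h2 : ∀ (p p' : SimplexCategory) (α : p ⟶ p') (r : SimplexCategoryᵒᵖ)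
      (x : ((totDom.{u} q).obj p).obj r),
      f p' r (((totDom q).map α).app r x) = (X.map α).app r (f p r x)) : totDom.{u} q ⟶ X where
  app p :=
    { app := fun r => ↾(f p r)
      naturality := fun r r' θ => ConcreteCategory.hom_ext _ _ fun x => h1 p r r' θ x }
  naturality p p' α := NatTrans.ext (funext fun r =>
    ConcreteCategory.hom_ext _ _ fun x => h2 p p' α r x)

/-- The structure of a `C`-algebra on `Tot X`: the value of `θ(a; f_0, …)` at `(x, y)`
is `θ(y^* a; f_0(x, y), …)`. -/
def CosimplicialAlgebra.tot (A : CosimplicialAlgebra C X) : OperadAlgebra C (Tot X) where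
  act {n q} a f := Tot.mk (fun p r x => (A.alg p).act
      ((C.obj n).map (SSet.stdSimplex.objEquiv x.2).op a) (fun i => ((f i).app p).app r x))
    (fun p r r' θ x => by
      rw [(A.alg p).act_nat]
      congr 1
      · rw [← Functor.map_comp_apply]; rfl
      · funext i
        exact NatTrans.naturality_apply ((f i).app p) θ x)
    (fun p p' α r x => by
      rw [A.map_act]
      congr 1
      funext i
      exact congrArg (fun g => g.app r x) ((f i).naturality α))
  act_nat {n q q'} θ a x := NatTrans.ext (funext fun p => NatTrans.ext (funext fun r =>
    ConcreteCategory.hom_ext _ _ fun y => by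
      change (A.alg p).act _ _ = (A.alg p).act _ _
      congr 1
      rw [← Functor.map_comp_apply]; rfl))
  act_one x := NatTrans.ext (funext fun p => NatTrans.ext (funext fun r =>
    ConcreteCategory.hom_ext _ _ fun y => by
      change (A.alg p).act _ _ = _
      rw [C.one_nat, (A.alg p).act_one]))
  act_comp {k} j {q} a b x := NatTrans.ext (funext fun p => NatTrans.ext (funext fun r =>
    ConcreteCategory.hom_ext _ _ fun y => by
      change (A.alg p).act _ _ = (A.alg p).act _ _
      rw [C.comp_nat, (A.alg p).act_comp]; rfl))
  act_map {m n} σ {q} a x := NatTrans.ext (funext fun p => NatTrans.ext (funext fun r =>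
    ConcreteCategory.hom_ext _ _ fun y => by
      change (A.alg p).act _ _ = (A.alg p).act _ _
      rw [← NatTrans.naturality_apply, (A.alg p).act_map]))

/-- The multiplication `Z × Z → Z` given by a vertex of `C(2)`. -/
def OperadAlgebra.mul (A : OperadAlgebra C Z) (c : (C.obj 2) _⦋0⦌) : Z ⊗ Z ⟶ Z where
  app q := ↾fun x : (Z ⊗ Z : SSet.{u}).obj q =>
    A.act ((C.obj 2).map (SimplexCategory.const q.unop ⦋0⦌ 0).op c) ![x.1, x.2]
  naturality q q' θ := ConcreteCategory.hom_ext _ _ fun x => by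
    change A.act _ _ = Z.map θ (A.act _ _)
    rw [A.act_nat, ← Functor.map_comp_apply]
    congr 1
    funext i
    fin_cases i <;> rfl

/-- The multiplication `X × X → X` given by a vertex of `C(2)`. -/
def CosimplicialAlgebra.mul (A : CosimplicialAlgebra C X) (c : (C.obj 2) _⦋0⦌) :
    prodC X X ⟶ X where
  app p := (A.alg p).mul c
  naturality p p' α := NatTrans.ext (funext fun q => ConcreteCategory.hom_ext _ _ fun x => by
    change (A.alg p').act _ _ = (X.map α).app q ((A.alg p).act _ _)
    rw [A.map_act]
    congr 1
    funext i
    fin_cases i <;> rfl)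

/-- The multiplication `μ` on the homology of a `C`-algebra: the cross product followed by the
map induced by `Z × Z → Z`. -/
def OperadAlgebra.muH (A : OperadAlgebra C Z) (c : (C.obj 2) _⦋0⦌) (n n' : ℕ) :
    H Z n →ₗ[K] H Z n' →ₗ[K] H Z (n + n') :=
  (H.cross Z Z n n').compr₂ (H.map (A.mul c) (n + n'))

/-- The multiplication `μ` on `E^∞` of a cosimplicial `C`-space: the external product followed by
the map induced by `X × X → X`. -/
def CosimplicialAlgebra.muE (A : CosimplicialAlgebra C X) (c : (C.obj 2) _⦋0⦌) (s t s' t' : ℤ) :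
    Einf X s t →ₗ[K] Einf X s' t' →ₗ[K] Einf X (s + s') (t + t') :=
  (Einf.cross X X s t s' t').compr₂ (Einf.map (A.mul c) (s + s') (t + t'))

end

end

end CosimplicialSS

/-!
The filtration, the product on `E^∞` and the product of total complexes are all defined on chains,
so everything follows once the comparison map `φ : S_*(Tot X) → T(CN X)` is known to be
multiplicative on homology: for cycles `x` and `y`, the chain `φ(x · y)` is homologous to the image
of `φ(x) ⊗ φ(y)` under the product of `T(CN X)` (`phi_tot_mul_sub_mem`).

Both products come from chains on the cosimplicial space `Δ^• × Δ^•`. Any family of chains `w` in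
its total complex gives a pairing (`pairing`): a simplex `f` of `Tot X` and a simplex `g` of
`Tot X'`, of dimensions `n` and `n'`, are sent to the image of `w ∧ (ι_n ∧ ι_n')` under
`((a, a'), (b, b')) ↦ (f (a, b), g (a', b'))`. The differential of this pairing is governed by that
of `w` (`D_pairing`). If `w` is the image of the fundamental cycle `ι` of `Δ^•` under the diagonal,
the pairing followed by `X × X → X` is `φ` of the product in `Tot X` (`phi_tot_mul`); if `w` is the
Alexander-Whitney product `ι · ι`, the pairing is the external product of `φ(f)` and `φ(g)`
(`pairing_totMul_fundC`). The latter needs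
that the shuffle map is compatible with the interchange of factors (`interchange_cross`), which
holds since both ways around are the sum over all lattice paths in four dimensions.

It remains to see that the two cycles `w` are homologous (`exists_D_eq_diag`). They agree in the
column `0`, so their difference can be filled in one column after the other with the cone operator
of `Δ^p × Δ^p` with vertex `(0, 0)`. The codegeneracies preserve that vertex, whence the cone
operator preserves conormalized chains.
-/

namespace CosimplicialSS

noncomputable section

/-! ### Fourfold shuffles -/

/-- The fourfold shuffles: quadruples of monotone maps out of `[n]` whose values at `i` add up
to `i`, that is, lattice paths with unit steps in four dimensions. -/
def shuffles₄ (n a b c d : ℕ) :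
    Finset (((⦋n⦌ ⟶ ⦋a⦌) × (⦋n⦌ ⟶ ⦋b⦌)) × ((⦋n⦌ ⟶ ⦋c⦌) × (⦋n⦌ ⟶ ⦋d⦌))) :=
  (Set.toFinite {v | ∀ i ≤ n, ev v.1.1 i + ev v.1.2 i + (ev v.2.1 i + ev v.2.2 i) = i}).toFinset

lemma mem_shuffles₄ {n a b c d : ℕ}
    {v : ((⦋n⦌ ⟶ ⦋a⦌) × (⦋n⦌ ⟶ ⦋b⦌)) × ((⦋n⦌ ⟶ ⦋c⦌) × (⦋n⦌ ⟶ ⦋d⦌))} :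
    v ∈ shuffles₄ n a b c d ↔
      ∀ i ≤ n, ev v.1.1 i + ev v.1.2 i + (ev v.2.1 i + ev v.2.2 i) = i := by
  simp [shuffles₄]

/-- A component of a lattice path with unit steps takes every value. -/
lemma exists_ev_eq {n p q : ℕ} (h : p + q = n) {α : ⦋n⦌ ⟶ ⦋p⦌} {β : ⦋n⦌ ⟶ ⦋q⦌}
    (hs : ∀ i ≤ n, ev α i + ev β i = i) {k : ℕ} (hk : k ≤ p) : ∃ i ≤ n, ev α i = k := by
  rcases hk.eq_or_lt with rfl | hk
  · have h1 := hs n le_rfl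
    have h2 := ev_le α n
    have h3 := ev_le β n
    exact ⟨n, le_rfl, by omega⟩
  · obtain ⟨i, hi, h1, -, -⟩ := exists_step h α β hs k hk
    exact ⟨i, hi.le, h1⟩

/-- A pair of operators factors through a shuffle of its targets, if the sum of the two is one
component of a lattice path with unit steps. -/
lemma exists_factor_shuffle {n a b q : ℕ} (h : a + b + q = n) {α : ⦋n⦌ ⟶ ⦋a⦌} {β : ⦋n⦌ ⟶ ⦋b⦌}
    {σ : ⦋n⦌ ⟶ ⦋a + b⦌} {τ : ⦋n⦌ ⟶ ⦋q⦌} (hs : ∀ i ≤ n, ev σ i + ev τ i = i)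
    (hσ : ∀ i ≤ n, ev σ i = ev α i + ev β i) :
    ∃ t ∈ shuffles (a + b) a b, σ ≫ t.1 = α ∧ σ ≫ t.2 = β := by
  have hex := fun (k : ℕ) (hk : k ≤ a + b) => exists_ev_eq h hs hk
  choose! g hg1 hg2 using hex
  have hg : ∀ k l, k ≤ l → l ≤ a + b → ev α (g k) ≤ ev α (g l) ∧ ev β (g k) ≤ ev β (g l) := by
    intro k l hkl hl
    rcases hkl.eq_or_lt with rfl | hkl
    · exact ⟨le_rfl, le_rfl⟩
    · have : g k ≤ g l := by
        by_contra hc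
        have := ev_mono σ (le_of_not_ge hc)
        rw [hg2 k (by omega), hg2 l hl] at this
        omega
      exact ⟨ev_mono α this, ev_mono β this⟩
  -- The values of `α` and `β` at `i` depend only on their sum, since both are monotone.
  have hu : ∀ i ≤ n, ev α (g (ev σ i)) = ev α i ∧ ev β (g (ev σ i)) = ev β i := by
    intro i hi
    have h1 := hg2 _ (ev_le σ i)
    have h2 := hg1 _ (ev_le σ i)
    have h3 := hσ i hi
    have h4 := hσ _ h2
    rcases le_total i (g (ev σ i)) with h5 | h5
    · have := ev_mono α h5
      have := ev_mono β h5
      omega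
    · have := ev_mono α h5
      have := ev_mono β h5
      omega
  refine ⟨(homOfEv (fun k => ev α (g k)) (fun k l hkl hl => (hg k l hkl hl).1)
      (fun k _ => ev_le α _), homOfEv (fun k => ev β (g k)) (fun k l hkl hl => (hg k l hkl hl).2)
      (fun k _ => ev_le β _)), mem_shuffles_ev.mpr fun k hk => ?_, hom_ext_ev fun i hi => ?_,
      hom_ext_ev fun i hi => ?_⟩
  · rw [ev_homOfEv _ _ _ _ hk, ev_homOfEv _ _ _ _ hk, ← hσ _ (hg1 k hk), hg2 k hk]
  · rw [ev_comp, ev_homOfEv _ _ _ _ (ev_le _ _)]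
    exact (hu i hi).1
  · rw [ev_comp, ev_homOfEv _ _ _ _ (ev_le _ _)]
    exact (hu i hi).2

/-- A component of a lattice path with unit steps is an epimorphism. -/
lemma eq_of_factor {n p q m : ℕ} (h : p + q = n) {σ : ⦋n⦌ ⟶ ⦋p⦌} {τ : ⦋n⦌ ⟶ ⦋q⦌}
    (hs : ∀ i ≤ n, ev σ i + ev τ i = i) {α β : ⦋p⦌ ⟶ ⦋m⦌} (e : σ ≫ α = σ ≫ β) : α = β := by
  refine hom_ext_ev fun k hk => ?_
  obtain ⟨i, hi, rfl⟩ := exists_ev_eq h hs hk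
  rw [← ev_comp, ← ev_comp, e]

/-- A fourfold shuffle is a shuffle followed by shuffles of both of its components. -/
lemma sum_shuffles_shuffles {M : Type*} [AddCommMonoid M] {n a b c d : ℕ}
    (h : a + b + (c + d) = n)
    (G : ((⦋n⦌ ⟶ ⦋a⦌) × (⦋n⦌ ⟶ ⦋b⦌)) × ((⦋n⦌ ⟶ ⦋c⦌) × (⦋n⦌ ⟶ ⦋d⦌)) → M) :
    ∑ s ∈ shuffles n (a + b) (c + d), ∑ t ∈ shuffles (a + b) a b, ∑ r ∈ shuffles (c + d) c d,
      G ((s.1 ≫ t.1, s.1 ≫ t.2), (s.2 ≫ r.1, s.2 ≫ r.2)) = ∑ v ∈ shuffles₄ n a b c d, G v := by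
  have hsw : ∀ s ∈ shuffles n (a + b) (c + d), ∀ i ≤ n, ev s.2 i + ev s.1 i = i :=
    fun s hs i hi => (add_comm _ _).trans (mem_shuffles_ev.mp hs i hi)
  have hsum : ∀ {p q m : ℕ} (σ : ⦋n⦌ ⟶ ⦋m⦌) (t : (⦋m⦌ ⟶ ⦋p⦌) × (⦋m⦌ ⟶ ⦋q⦌)),
      t ∈ shuffles m p q → ∀ i, ev (σ ≫ t.1) i + ev (σ ≫ t.2) i = ev σ i :=
    fun σ t ht i => by rw [ev_comp, ev_comp]; exact mem_shuffles_ev.mp ht _ (ev_le σ i)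
  simp_rw [← Finset.sum_product']
  refine Finset.sum_bij (fun x _ => ((x.1.1 ≫ x.2.1.1, x.1.1 ≫ x.2.1.2),
    (x.1.2 ≫ x.2.2.1, x.1.2 ≫ x.2.2.2))) ?_ ?_ ?_ fun _ _ => rfl
  · rintro ⟨s, t, r⟩ hx
    simp only [Finset.mem_product] at hx
    obtain ⟨hs, ht, hr⟩ := hx
    refine mem_shuffles₄.mpr fun i hi => ?_
    simp only
    rw [hsum _ _ ht, hsum _ _ hr, mem_shuffles_ev.mp hs i hi]
  · rintro ⟨s, t, r⟩ hx ⟨s', t', r'⟩ hx' e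
    simp only [Finset.mem_product] at hx hx'
    obtain ⟨hs, ht, hr⟩ := hx
    obtain ⟨hs', ht', hr'⟩ := hx'
    simp only [Prod.mk.injEq] at e
    obtain ⟨⟨e1, e2⟩, e3, e4⟩ := e
    have h1 : s.1 = s'.1 := hom_ext_ev fun i _ => by
      rw [← hsum s.1 t ht, ← hsum s'.1 t' ht', e1, e2]
    have h2 : s.2 = s'.2 := hom_ext_ev fun i _ => by
      rw [← hsum s.2 r hr, ← hsum s'.2 r' hr', e3, e4]
    obtain rfl : s = s' := Prod.ext h1 h2
    have hs1 := mem_shuffles_ev.mp hs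
    have hs2 := hsw s hs
    rw [Prod.ext (eq_of_factor h hs1 e1) (eq_of_factor h hs1 e2),
      Prod.ext (eq_of_factor (by omega) hs2 e3) (eq_of_factor (by omega) hs2 e4)]
  · rintro ⟨⟨α, β⟩, γ, ε⟩ hv
    have hv := mem_shuffles₄.mp hv
    simp only at hv
    let σ : ⦋n⦌ ⟶ ⦋a + b⦌ := homOfEv (fun i => ev α i + ev β i)
      (fun i j hij _ => add_le_add (ev_mono α hij) (ev_mono β hij))
      (fun i _ => add_le_add (ev_le α i) (ev_le β i))
    let τ : ⦋n⦌ ⟶ ⦋c + d⦌ := homOfEv (fun i => ev γ i + ev ε i)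
      (fun i j hij _ => add_le_add (ev_mono γ hij) (ev_mono ε hij))
      (fun i _ => add_le_add (ev_le γ i) (ev_le ε i))
    have hσ : ∀ i ≤ n, ev σ i = ev α i + ev β i := fun i hi => ev_homOfEv _ _ _ _ hi
    have hτ : ∀ i ≤ n, ev τ i = ev γ i + ev ε i := fun i hi => ev_homOfEv _ _ _ _ hi
    have hs : ∀ i ≤ n, ev σ i + ev τ i = i := fun i hi => by rw [hσ i hi, hτ i hi, hv i hi]
    have hs' : ∀ i ≤ n, ev τ i + ev σ i = i := fun i hi => (add_comm _ _).trans (hs i hi)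
    obtain ⟨t, ht, e1, e2⟩ := exists_factor_shuffle h hs hσ
    obtain ⟨r, hr, e3, e4⟩ := exists_factor_shuffle (by omega) hs' hτ
    exact ⟨((σ, τ), t, r), Finset.mem_product.mpr ⟨mem_shuffles_ev.mpr hs,
      Finset.mem_product.mpr ⟨ht, hr⟩⟩, Prod.ext (Prod.ext e1 e2) (Prod.ext e3 e4)⟩

lemma sum_shuffles₄_swap {M : Type*} [AddCommMonoid M] {n a b c d : ℕ}
    (G : ((⦋n⦌ ⟶ ⦋a⦌) × (⦋n⦌ ⟶ ⦋b⦌)) × ((⦋n⦌ ⟶ ⦋c⦌) × (⦋n⦌ ⟶ ⦋d⦌)) → M) :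
    ∑ v ∈ shuffles₄ n a b c d, G v =
      ∑ v ∈ shuffles₄ n a c b d, G ((v.1.1, v.2.1), (v.1.2, v.2.2)) := by
  refine Finset.sum_nbij' (fun v => ((v.1.1, v.2.1), (v.1.2, v.2.2)))
    (fun v => ((v.1.1, v.2.1), (v.1.2, v.2.2))) ?_ ?_ ?_ ?_ ?_
  · intro v hv
    refine mem_shuffles₄.mpr fun i hi => ?_
    have := mem_shuffles₄.mp hv i hi
    simp only
    omega
  · intro v hv
    refine mem_shuffles₄.mpr fun i hi => ?_
    have := mem_shuffles₄.mp hv i hi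
    simp only
    omega
  all_goals exact fun _ _ => rfl

/-- The interchange of the two middle factors of a fourfold product. -/
def interchange (Z Z' Y Y' : SSet.{u}) : (Z ⊗ Z') ⊗ (Y ⊗ Y') ⟶ (Z ⊗ Y) ⊗ (Z' ⊗ Y') where
  app n := ↾fun x : ((Z ⊗ Z') ⊗ (Y ⊗ Y') : SSet.{u}).obj n =>
    (pr (pr x.1.1 x.2.1) (pr x.1.2 x.2.2) : ((Z ⊗ Y) ⊗ (Z' ⊗ Y') : SSet.{u}).obj n)
  naturality _ _ _ := rfl

/-- The iterated shuffle map is the sum over all fourfold shuffles, hence is symmetric in the four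
factors. -/
lemma cross_cross_sm {Z Z' Y Y' : SSet.{u}} {a b c d n : ℕ} (h : a + b + (c + d) = n)
    (x : Z _⦋a⦌) (x' : Z' _⦋b⦌) (y : Y _⦋c⦌) (y' : Y' _⦋d⦌) :
    cross (Z ⊗ Z') (Y ⊗ Y') (a + b) (c + d) n (cross Z Z' a b (a + b) (sm x) (sm x'))
        (cross Y Y' c d (c + d) (sm y) (sm y')) =
      ∑ v ∈ shuffles₄ n a b c d, sm (pr (pr (Z.map v.1.1.op x) (Z'.map v.1.2.op x'))
        (pr (Y.map v.2.1.op y) (Y'.map v.2.2.op y'))) := by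
  rw [← sum_shuffles_shuffles h (fun v => sm (pr (pr (Z.map v.1.1.op x) (Z'.map v.1.2.op x'))
        (pr (Y.map v.2.1.op y) (Y'.map v.2.2.op y')))), cross_sm rfl, cross_sm rfl]
  simp only [map_sum, LinearMap.sum_apply, cross_sm h, op_comp, Functor.map_comp_apply]
  refine (Finset.sum_congr rfl fun r _ => Finset.sum_comm).trans (Finset.sum_comm.trans
    (Finset.sum_congr rfl fun s _ => ?_))
  exact Finset.sum_comm

/-- Over `𝔽₂` the classes of simplices generate the normalized chains under addition. -/
lemma S.induction {Z : SSet.{u}} {n : ℕ} {P : S Z n → Prop} (h0 : P 0)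
    (hadd : ∀ x y, P x → P y → P (x + y)) (hsm : ∀ x, P (sm x)) (x : S Z n) : P x := by
  obtain ⟨x, rfl⟩ := Submodule.Quotient.mk_surjective _ x
  induction x using Finsupp.induction_linear with
  | zero => exact h0
  | add x y hx hy => exact hadd _ _ hx hy
  | single x c =>
    obtain rfl | rfl : c = 0 ∨ c = 1 := by revert c; decide
    · rw [Finsupp.single_zero]; exact h0
    · exact hsm x

/-- Over `𝔽₂` the shuffle map commutes with the interchange of the middle factors. -/
lemma interchange_cross {Z Z' Y Y' : SSet.{u}} {a b c d n : ℕ} (x : S Z a) (x' : S Z' b)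
    (y : S Y c) (y' : S Y' d) :
    S.map (interchange Z Z' Y Y') n (cross (Z ⊗ Z') (Y ⊗ Y') (a + b) (c + d) n
      (cross Z Z' a b (a + b) x x') (cross Y Y' c d (c + d) y y')) =
    cross (Z ⊗ Y) (Z' ⊗ Y') (a + c) (b + d) n (cross Z Y a c (a + c) x y)
      (cross Z' Y' b d (b + d) x' y') := by
  -- In all other degrees both sides vanish by the convention for `cross`.
  by_cases h : a + b + (c + d) = n
  swap
  · rw [cross_eq_zero h, cross_eq_zero (by omega), map_zero]
  induction x using S.induction with
  | h0 => simp
  | hadd x₁ x₂ h₁ h₂ => simp only [map_add, LinearMap.add_apply, h₁, h₂]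
  | hsm x => ?_
  induction x' using S.induction with
  | h0 => simp
  | hadd x₁ x₂ h₁ h₂ => simp only [map_add, LinearMap.add_apply, h₁, h₂]
  | hsm x' => ?_
  induction y using S.induction with
  | h0 => simp
  | hadd x₁ x₂ h₁ h₂ => simp only [map_add, LinearMap.add_apply, h₁, h₂]
  | hsm y => ?_
  induction y' using S.induction with
  | h0 => simp
  | hadd x₁ x₂ h₁ h₂ => simp only [map_add, h₁, h₂]
  | hsm y' => ?_
  rw [cross_cross_sm h, cross_cross_sm (by omega), map_sum, sum_shuffles₄_swap]
  refine Finset.sum_congr rfl fun v _ => ?_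
  rw [S.map_sm]
  rfl

/-! ### Families concentrated in one degree -/

/-- The graded family of chains which is `z` in the degree of `z`, and zero in all others. -/
def single {Z : SSet.{u}} {k : ℕ} (z : S Z k) (q : ℕ) : S Z q :=
  if h : k = q then h ▸ z else 0

@[simp] lemma single_self {Z : SSet.{u}} {k : ℕ} (z : S Z k) : single z k = z := by
  simp [single]

lemma single_of_ne {Z : SSet.{u}} {k q : ℕ} (z : S Z k) (h : k ≠ q) : single z q = 0 := by
  simp [single, h]

lemma eq_single {Z : SSet.{u}} {k : ℕ} (f : ∀ q, S Z q) (h : ∀ q, k ≠ q → f q = 0) (q : ℕ) :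
    f q = single (f k) q := by
  by_cases hq : k = q
  · subst hq; simp
  · rw [h q hq, single_of_ne _ hq]

lemma sum_cross_single {Z Z' : SSet.{u}} {k k' : ℕ} (z : S Z k) (z' : S Z' k') (l : ℕ) :
    ∑ j ∈ Finset.HasAntidiagonal.antidiagonal l,
      cross Z Z' j.1 j.2 l (single z j.1) (single z' j.2) = cross Z Z' k k' l z z' := by
  have hne : ∀ j : ℕ × ℕ, j ≠ (k, k') →
      cross Z Z' j.1 j.2 l (single z j.1) (single z' j.2) = 0 := by
    rintro ⟨a, b⟩ hj
    by_cases ha : k = a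
    · rw [single_of_ne z' (fun hb : k' = b => hj (by rw [ha, hb])), map_zero]
    · rw [single_of_ne z ha, map_zero, LinearMap.zero_apply]
  rw [Finset.sum_eq_single (k, k') (fun j _ => hne j)]
  · simp
  · intro h
    exact cross_eq_zero (fun h' => h (Finset.HasAntidiagonal.mem_antidiagonal.mpr h')) _ _

lemma map_single {Z Z' : SSet.{u}} (F : Z ⟶ Z') {k : ℕ} (z : S Z k) (q : ℕ) :
    S.map F q (single z q) = single (S.map F k z) q := by
  by_cases h : k = q
  · subst h; simp
  · rw [single_of_ne _ h, single_of_ne _ h, map_zero]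

lemma cross_eq_single {Z Z' : SSet.{u}} {p q : ℕ} (x : S Z p) (y : S Z' q) (l : ℕ) :
    cross Z Z' p q l x y = single (cross Z Z' p q (p + q) x y) l :=
  eq_single (fun l => cross Z Z' p q l x y) (fun _ h => cross_eq_zero h x y) l

lemma single_sum {ι : Type*} {Z : SSet.{u}} {k : ℕ} (s : Finset ι) (z : ι → S Z k) (q : ℕ) :
    single (∑ i ∈ s, z i) q = ∑ i ∈ s, single (z i) q := by
  by_cases h : k = q
  · subst h; simp
  · simp [single_of_ne _ h]

/-! ### The cone operator -/

/-- The operator which prepends the value `0`. -/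
def coneHom {q p : ℕ} (α : ⦋q⦌ ⟶ ⦋p⦌) : ⦋q + 1⦌ ⟶ ⦋p⦌ :=
  homOfEv (fun i => if i = 0 then 0 else ev α (i - 1))
    (fun i j hij _ => by
      have : ev α (i - 1) ≤ ev α (j - 1) := ev_mono α (by omega)
      split_ifs <;> omega)
    (fun i _ => by
      have := ev_le α (i - 1)
      split_ifs <;> omega)

lemma ev_coneHom {q p : ℕ} (α : ⦋q⦌ ⟶ ⦋p⦌) (i : ℕ) (hi : i ≤ q + 1) :
    ev (coneHom α) i = if i = 0 then 0 else ev α (i - 1) := ev_homOfEv _ _ _ _ hi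

lemma δ_zero_coneHom {q p : ℕ} (α : ⦋q⦌ ⟶ ⦋p⦌) : SimplexCategory.δ 0 ≫ coneHom α = α := by
  refine hom_ext_ev fun i hi => ?_
  rw [ev_comp, ev_δ _ _ hi, ev_coneHom _ _ (by simp; omega)]
  simp

lemma δ_succ_coneHom {q p : ℕ} (α : ⦋q + 1⦌ ⟶ ⦋p⦌) (k : Fin (q + 2)) :
    SimplexCategory.δ k.succ ≫ coneHom α = coneHom (SimplexCategory.δ k ≫ α) := by
  refine hom_ext_ev fun i hi => ?_
  rw [ev_comp, ev_δ _ _ hi, ev_coneHom _ _ (by split_ifs <;> omega), ev_coneHom _ _ hi, ev_comp,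
    ev_δ _ _ (by omega), Fin.val_succ]
  rcases i with _ | i
  · simp
  · simp only [Nat.add_sub_cancel, Nat.add_lt_add_iff_right]
    split_ifs <;> first | omega | rfl

/-- The operator `[q + 1] → [m + 1]` which sends `0` to `0` and is `γ` on the other vertices. -/
def coneExt {q m : ℕ} (γ : ⦋q⦌ ⟶ ⦋m⦌) : ⦋q + 1⦌ ⟶ ⦋m + 1⦌ :=
  coneHom (γ ≫ SimplexCategory.δ 0)

lemma coneExt_coneHom {q m p : ℕ} (γ : ⦋q⦌ ⟶ ⦋m⦌) (α : ⦋m⦌ ⟶ ⦋p⦌) :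
    coneExt γ ≫ coneHom α = coneHom (γ ≫ α) := by
  refine hom_ext_ev fun i hi => ?_
  rw [ev_comp, coneExt, ev_coneHom _ _ hi, ev_coneHom _ _ hi, ev_comp, ev_comp,
    ev_δ _ _ (ev_le _ _), ev_coneHom _ _ (by have := ev_le γ (i - 1); split_ifs <;> omega)]
  simp only [Fin.val_zero]
  split_ifs <;> first | omega | rfl

lemma coneHom_σ {q p : ℕ} (α : ⦋q⦌ ⟶ ⦋p + 1⦌) (k : Fin (p + 1)) :
    coneHom α ≫ SimplexCategory.σ k = coneHom (α ≫ SimplexCategory.σ k) := by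
  refine hom_ext_ev fun i hi => ?_
  rw [ev_comp, ev_coneHom _ _ hi, ev_coneHom _ _ hi, ev_comp]
  by_cases h : i = 0
  · rw [if_pos h, if_pos h, ev_σ _ _ (by omega), if_pos (by omega)]
  · rw [if_neg h, if_neg h]

/-- The cosimplicial space of standard simplices. -/
abbrev Std : CosimplicialSpace.{u} := SSet.stdSimplex

/-- The cone on a simplex of `Δ^p` with vertex `0`. -/
def coneStd {p q : ℕ} (a : (Δ[p] : SSet.{u}) _⦋q⦌) : (Δ[p] : SSet.{u}) _⦋q + 1⦌ :=
  SSet.stdSimplex.objEquiv.symm (coneHom (SSet.stdSimplex.objEquiv a))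

/-- The cone on a simplex of `Δ^p × Δ^p` with vertex `(0, 0)`. -/
def conePr {p q : ℕ} (a : (Δ[p] ⊗ Δ[p] : SSet.{u}) _⦋q⦌) : (Δ[p] ⊗ Δ[p] : SSet.{u}) _⦋q + 1⦌ :=
  pr (coneStd a.1) (coneStd a.2)

lemma map_coneStd {p q q' : ℕ} (a : (Δ[p] : SSet.{u}) _⦋q⦌) (θ : ⦋q'⦌ ⟶ ⦋q + 1⦌) :
    (Δ[p] : SSet.{u}).map θ.op (coneStd a) =
      SSet.stdSimplex.objEquiv.symm (θ ≫ coneHom (SSet.stdSimplex.objEquiv a)) := rfl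

lemma δ_zero_coneStd {p q : ℕ} (a : (Δ[p] : SSet.{u}) _⦋q⦌) :
    (Δ[p] : SSet.{u}).δ 0 (coneStd a) = a := by
  refine (map_coneStd a _).trans ?_
  rw [δ_zero_coneHom, Equiv.symm_apply_apply]

lemma δ_succ_coneStd {p q : ℕ} (a : (Δ[p] : SSet.{u}) _⦋q + 1⦌) (k : Fin (q + 2)) :
    (Δ[p] : SSet.{u}).δ k.succ (coneStd a) = coneStd ((Δ[p] : SSet.{u}).δ k a) := by
  refine (map_coneStd a _).trans ?_
  rw [δ_succ_coneHom]
  rfl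

lemma coneExt_coneStd {p q m : ℕ} (a : (Δ[p] : SSet.{u}) _⦋m⦌) (γ : ⦋q⦌ ⟶ ⦋m⦌) :
    (Δ[p] : SSet.{u}).map (coneExt γ).op (coneStd a) =
      coneStd ((Δ[p] : SSet.{u}).map γ.op a) := by
  refine (map_coneStd a _).trans ?_
  rw [coneExt_coneHom]
  rfl

lemma σ_coneStd {p q : ℕ} (a : (Δ[p + 1] : SSet.{u}) _⦋q⦌) (k : Fin (p + 1)) :
    (SSet.stdSimplex.{u}.map (SimplexCategory.σ k)).app (op ⦋q + 1⦌) (coneStd a) =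
      coneStd ((SSet.stdSimplex.{u}.map (SimplexCategory.σ k)).app (op ⦋q⦌) a) := by
  change SSet.stdSimplex.objEquiv.symm (coneHom (SSet.stdSimplex.objEquiv a) ≫ _) = _
  rw [coneHom_σ]
  rfl

/-- The cone operator on the chains of `Δ^p × Δ^p`. -/
def cone (p q : ℕ) : S (Δ[p] ⊗ Δ[p] : SSet.{u}) q →ₗ[K] S (Δ[p] ⊗ Δ[p] : SSet.{u}) (q + 1) :=
  S.lift (fun a => sm (conePr a)) (by
    rintro _ ⟨m, hm, γ, a, rfl⟩
    refine sm_degenerate ⟨m + 1, by omega, coneExt γ, conePr a, ?_⟩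
    exact Prod.ext (coneExt_coneStd a.1 γ) (coneExt_coneStd a.2 γ))

lemma cone_sm {p q : ℕ} (a : (Δ[p] ⊗ Δ[p] : SSet.{u}) _⦋q⦌) :
    cone p q (sm a) = sm (conePr a) := S.lift_sm _ _ _

/-- The cone operator is a contracting homotopy in positive degrees. -/
lemma bd_cone (p q : ℕ) (x : S (Δ[p] ⊗ Δ[p] : SSet.{u}) (q + 1)) :
    bd _ (q + 1) (cone p (q + 1) x) = x + cone p q (bd _ q x) := by
  have : bd _ (q + 1) ∘ₗ cone.{u} p (q + 1) = LinearMap.id + cone p q ∘ₗ bd _ q := by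
    refine S.hom_ext fun a => ?_
    simp only [LinearMap.comp_apply, LinearMap.add_apply, LinearMap.id_apply, cone_sm, bd_sm,
      map_sum]
    rw [Fin.sum_univ_succ]
    congr 1
    · exact congrArg sm (Prod.ext (δ_zero_coneStd a.1) (δ_zero_coneStd a.2))
    · refine Finset.sum_congr rfl fun k _ => congrArg sm ?_
      exact Prod.ext (δ_succ_coneStd a.1 k) (δ_succ_coneStd a.2 k)
  exact congrArg (fun g => g x) this

/-- The cone operator commutes with the codegeneracies, since these preserve the vertex `0`. -/
lemma cone_mem_conorm {p q : ℕ} {x : S (Δ[p] ⊗ Δ[p] : SSet.{u}) q}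
    (hx : x ∈ conorm (prodC Std.{u} Std) p q) :
    cone p q x ∈ conorm (prodC Std.{u} Std) p (q + 1) := by
  cases p with
  | zero => exact Submodule.mem_top
  | succ p =>
    rw [mem_conorm_succ] at hx ⊢
    intro i
    have : S.map ((prodC Std.{u} Std).map (SimplexCategory.σ i)) (q + 1) ∘ₗ cone (p + 1) q =
        cone p q ∘ₗ S.map ((prodC Std.{u} Std).map (SimplexCategory.σ i)) q := by
      refine S.hom_ext fun a => ?_
      simp only [LinearMap.comp_apply]
      rw [cone_sm, S.map_sm, S.map_sm]
      refine Eq.trans ?_ (cone_sm _).symm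
      exact congrArg sm (Prod.ext (σ_coneStd a.1 i) (σ_coneStd a.2 i))
    refine (congrArg (fun g => g x) this).trans ?_
    rw [LinearMap.comp_apply, hx i, map_zero]

/-- The components of a chain bounding `x`, built by induction over the columns: the cone
operator is applied to the part of `x` not yet accounted for by the previous column. -/
def coneFill (x : Amb (prodC Std.{u} Std)) (p : ℕ) :
    S ((prodC Std.{u} Std).obj ⦋p⦌) (p + 1) :=
  match p with
  | 0 => 0
  | p + 1 => cone (p + 1) (p + 1) (x (p + 1) (p + 1) +
      cobd (prodC Std.{u} Std) p (p + 1) (coneFill x p))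

/-- A cycle of degree `0` in the total complex of `Δ^• × Δ^•` is a boundary, if it vanishes in
the column `0`. -/
lemma exists_D_eq {x : Amb (prodC Std.{u} Std)} (hx : x ∈ TCN _ 0) (hD : D _ x = 0)
    (h0 : x 0 0 = 0) : ∃ h ∈ TCN (prodC Std.{u} Std) 1, D _ h = x := by
  have hc : ∀ p, coneFill x p ∈ conorm _ p (p + 1) := by
    intro p
    induction p with
    | zero => exact zero_mem _
    | succ p ih => exact cone_mem_conorm (add_mem (hx.1 _ _) (cobd_mem_conorm _ ih))
  have hb0 : bd _ 0 (coneFill x 0) = x 0 0 := by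
    rw [coneFill, map_zero, h0]
  have hb : ∀ p, bd _ (p + 1) (coneFill x (p + 1)) + cobd _ p (p + 1) (coneFill x p) =
      x (p + 1) (p + 1) := by
    -- If the vertical boundary in column `p` is right up to the kernel of `cobd`, then the chain
    -- coned off in column `p + 1` is a cycle, so that it is the boundary of its cone.
    have key : ∀ p, cobd _ p p (bd _ p (coneFill x p)) = cobd _ p p (x p p) →
        bd _ (p + 1) (coneFill x (p + 1)) + cobd _ p (p + 1) (coneFill x p) =
          x (p + 1) (p + 1) := by
      intro p hp
      have h1 : bd _ p (x (p + 1) (p + 1)) + cobd _ p p (x p p) = 0 := by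
        rw [← D_succ, hD]; rfl
      have h2 : bd ((prodC Std.{u} Std).obj ⦋p + 1⦌) p (x (p + 1) (p + 1) +
          cobd (prodC Std.{u} Std) p (p + 1) (coneFill x p)) = 0 := by
        rw [map_add, bd_cobd, hp, h1]
      have h3 : bd ((prodC Std.{u} Std).obj ⦋p + 1⦌) (p + 1) (coneFill x (p + 1)) =
          x (p + 1) (p + 1) + cobd (prodC Std.{u} Std) p (p + 1) (coneFill x p) :=
        (bd_cone (p + 1) p _).trans
          ((congrArg (_ + cone (p + 1) p ·) h2).trans (by rw [map_zero, add_zero]))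
      rw [h3, add_assoc, add_self_K, add_zero]
    intro p
    induction p with
    | zero => exact key 0 (by rw [hb0])
    | succ p ih =>
      refine key (p + 1) ?_
      rw [← ih, map_add, cobd_cobd, add_zero]
  refine ⟨Amb.mk fun p q => single (coneFill x p) q, ⟨fun p q => ?_, fun p q h => ?_,
    fun p q h => absurd h (by omega)⟩, ?_⟩
  · rw [Amb.mk_apply]
    by_cases hq : p + 1 = q
    · subst hq; rw [single_self]; exact hc p
    · rw [single_of_ne _ hq]; exact zero_mem _
  · rw [Amb.mk_apply, single_of_ne _ (by omega)]
  · ext p q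
    by_cases hq : p = q
    · subst hq
      cases p with
      | zero => rw [D_zero, Amb.mk_apply, single_self, hb0]
      | succ p => rw [D_succ, Amb.mk_apply, Amb.mk_apply, single_self, single_self, hb]
    · rw [hx.2.1 p q (by omega)]
      cases p with
      | zero => rw [D_zero, Amb.mk_apply, single_of_ne _ (by omega), map_zero]
      | succ p =>
        rw [D_succ, Amb.mk_apply, Amb.mk_apply, single_of_ne _ (by omega),
          single_of_ne _ (by omega), map_zero, map_zero, add_zero]

/-! ### The two diagonals of the standard simplices -/

/-- The fundamental cycle of the total complex of `Δ^•`. -/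
def fundC : Amb Std.{u} := Amb.mk fun p q => single (fund p) q

lemma fundC_apply (p q : ℕ) : fundC.{u} p q = single (fund p) q := rfl

lemma fundC_mem_TCN : fundC.{u} ∈ TCN Std 0 := by
  refine ⟨fun p q => ?_, fun p q h => ?_, fun p q h => absurd h (by omega)⟩
  · rw [fundC_apply]
    by_cases hq : p = q
    · subst hq
      rw [single_self]
      cases p with
      | zero => exact Submodule.mem_top
      | succ p =>
        rw [mem_conorm_succ]
        exact fun i => map_fund_eq_zero (Nat.lt_succ_self p) _
    · rw [single_of_ne _ hq]; exact zero_mem _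
  · rw [fundC_apply, single_of_ne _ (by omega)]

lemma D_fundC : D Std fundC.{u} = 0 := by
  ext p q
  cases p with
  | zero => rw [D_zero, fundC_apply, single_of_ne _ (by omega), map_zero]; rfl
  | succ p =>
    rw [D_succ, fundC_apply, fundC_apply]
    by_cases hq : p = q
    · subst hq
      rw [single_self, single_self, bd_fund, cobd_apply]
      exact add_self_K _
    · rw [single_of_ne _ (by omega), single_of_ne _ hq, map_zero, map_zero, add_zero]; rfl

/-- The diagonal of `Δ^•`. -/
def diag : Std.{u} ⟶ prodC Std Std where
  app _ := { app := fun _ => ↾fun a => pr a a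
             naturality := fun _ _ _ => rfl }
  naturality _ _ _ := rfl

lemma shuffles_zero : shuffles 0 0 0 = {(𝟙 _, 𝟙 _)} := by
  have h : ∀ α : ⦋0⦌ ⟶ ⦋0⦌, α = 𝟙 _ := fun α => hom_ext_ev fun i _ =>
    (Nat.le_zero.mp (ev_le α i)).trans (Nat.le_zero.mp (ev_le (𝟙 ⦋0⦌) i)).symm
  refine Finset.eq_singleton_iff_unique_mem.mpr ⟨mem_shuffles_ev.mpr fun i hi => ?_,
    fun s _ => Prod.ext (h s.1) (h s.2)⟩
  have : ev (𝟙 ⦋0⦌) i ≤ 0 := ev_le _ i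
  simp only
  omega

lemma eq_of_zero {n : ℕ} (a b : (Δ[0] : SSet.{u}) _⦋n⦌) : a = b := by
  refine SSet.stdSimplex.objEquiv.injective (hom_ext_ev fun i hi => ?_)
  have := ev_le (SSet.stdSimplex.objEquiv a) i
  have := ev_le (SSet.stdSimplex.objEquiv b) i
  omega

/-- The Alexander-Whitney decomposition of the diagonal of `Δ^•` is homologous to the diagonal. -/
lemma exists_D_eq_diag : ∃ h ∈ TCN (prodC Std.{u} Std) 1,
    D _ h = Amb.map diag fundC + totMul Std Std fundC fundC := by
  refine exists_D_eq (add_mem (Amb.map_mem_Fil _ fundC_mem_TCN)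
    (totMul_mem_Fil fundC_mem_TCN fundC_mem_TCN)) ?_ ?_
  · rw [map_add, D_map, D_totMul, D_fundC]; simp
  · have e : totMul Std.{u} Std fundC fundC 0 0 = Amb.map diag fundC 0 0 := by
      rw [totMul_apply]
      simp only [Finset.Nat.antidiagonal_zero, Finset.sum_singleton, fundC_apply, single_self,
        prodTerm, LinearMap.compl₁₂_apply, Amb.map_apply]
      refine (congrArg₂ (fun a b => cross Δ[0] Δ[0] 0 0 0 a b) (S.map_sm _ 0 _)
        (S.map_sm _ 0 _)).trans ((cross_sm (n := 0) rfl _ _).trans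
        (Eq.trans ?_ (S.map_sm _ 0 _).symm))
      rw [shuffles_zero, Finset.sum_singleton]
      exact congrArg sm (Prod.ext (eq_of_zero _ _) (eq_of_zero _ _))
    rw [Amb.add_apply, e]; exact add_self_K _

/-! ### Simplices of the totalization paired with chains on their domains -/

/-- The constant cosimplicial space. -/
abbrev constC (Z : SSet.{u}) : CosimplicialSpace.{u} := (Functor.const SimplexCategory).obj Z

/-- A graded family of chains, as a family concentrated in the column `0` of the bicomplex of a
constant cosimplicial space. -/
def col {Z : SSet.{u}} (c : ∀ q, S Z q) : Amb (constC Z) :=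
  Amb.mk fun p q => match p with
    | 0 => c q
    | _ + 1 => 0

lemma col_zero {Z : SSet.{u}} (c : ∀ q, S Z q) (q : ℕ) : col c 0 q = c q := rfl

lemma col_succ {Z : SSet.{u}} (c : ∀ q, S Z q) (p q : ℕ) : col c (p + 1) q = 0 := rfl

lemma D_col {Z : SSet.{u}} (c : ∀ q, S Z q) :
    D (constC Z) (col c) = col fun q => bd Z q (c (q + 1)) := by
  ext p q
  rcases p with _ | _ | p
  · rw [D_zero]; rfl
  · rw [D_succ, col_succ, col_succ, col_zero, map_zero, zero_add (cobd (constC Z) 0 q _),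
      cobd_apply, Fin.sum_univ_two]
    -- The two coface operators of a constant cosimplicial space are equal, so they cancel.
    exact add_self_K _
  · rw [D_succ, col_succ, col_succ, col_succ, map_zero, map_zero, add_zero]

lemma col_mem_TCN {Z : SSet.{u}} {c : ∀ q, S Z q} {m : ℕ} (hc : ∀ q, m ≠ q → c q = 0) :
    col c ∈ TCN (constC Z) m := by
  refine ⟨fun p q => ?_, fun p q h => ?_, fun p q h => absurd h (by omega)⟩
  · cases p with
    | zero => exact Submodule.mem_top
    | succ p => exact zero_mem _
  · cases p with
    | zero => exact hc q (by omega)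
    | succ p => rfl

lemma totMul_col {W : CosimplicialSpace.{u}} {Z : SSet.{u}} (w : Amb W) (c : ∀ q, S Z q)
    (p l : ℕ) : totMul W (constC Z) w (col c) p l =
      ∑ j ∈ Finset.HasAntidiagonal.antidiagonal l,
        cross (W.obj ⦋p⦌) Z j.1 j.2 l (w p j.1) (c j.2) := by
  rw [totMul_apply, Finset.sum_eq_single (p, 0)]
  · refine Finset.sum_congr rfl fun j _ => ?_
    have hf : front p p = 𝟙 _ := hom_ext_ev fun i hi => by
      rw [ev_front le_rfl i hi]
      exact (min_eq_left hi).symm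
    rw [prodTerm, LinearMap.compl₁₂_apply, hf, W.map_id, S.map_id]
    exact congrArg _ (S.map_id _ _)
  · rintro ⟨a, b⟩ hi hne
    have hi := Finset.HasAntidiagonal.mem_antidiagonal.mp hi
    rcases b with _ | b
    · exact absurd (congrArg (·, 0) (show a = p from hi)) hne
    · exact Finset.sum_eq_zero fun j _ => by rw [col_succ, map_zero]
  · intro h
    exact absurd (Finset.HasAntidiagonal.mem_antidiagonal.mpr (add_zero p)) h

variable {X X' : CosimplicialSpace.{u}}

/-- The map `((a, a'), (b, b')) ↦ (f (a, b), g (a', b'))` given by simplices `f` and `g` of the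
totalizations of `X` and `X'`. -/
def evalPair {n n' : ℕ} (f : (Tot X) _⦋n⦌) (g : (Tot X') _⦋n'⦌) :
    prodC (prodC Std.{u} Std) (constC (Δ[n] ⊗ Δ[n'] : SSet.{u})) ⟶ prodC X X' where
  app P := interchange (SSet.stdSimplex.obj P) (SSet.stdSimplex.obj P) Δ[n] Δ[n'] ≫
    (NatTrans.app (F := totDom ⦋n⦌) f P ⊗ₘ NatTrans.app (F := totDom ⦋n'⦌) g P)
  naturality P P' α := by
    refine NatTrans.ext (funext fun r => ConcreteCategory.hom_ext _ _ ?_)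
    rintro ⟨⟨a, a'⟩, b, b'⟩
    exact Prod.ext
      (congrArg (fun h => h.app r (pr a b)) (NatTrans.naturality (F := totDom ⦋n⦌) f α))
      (congrArg (fun h => h.app r (pr a' b')) (NatTrans.naturality (F := totDom ⦋n'⦌) g α))

lemma evalPair_app {n n' : ℕ} (f : (Tot X) _⦋n⦌) (g : (Tot X') _⦋n'⦌) (p : ℕ) :
    (evalPair f g).app ⦋p⦌ = interchange Δ[p] Δ[p] Δ[n] Δ[n'] ≫ (Tot.comp f p ⊗ₘ Tot.comp g p) :=
  rfl

lemma evalPair_map {n n' m m' : ℕ} (θ : ⦋n⦌ ⟶ ⦋m⦌) (θ' : ⦋n'⦌ ⟶ ⦋m'⦌) (f : (Tot X) _⦋m⦌)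
    (g : (Tot X') _⦋m'⦌) (p : ℕ) :
    (evalPair ((Tot X).map θ.op f) ((Tot X').map θ'.op g)).app ⦋p⦌ =
      (𝟙 (Δ[p] ⊗ Δ[p] : SSet.{u}) ⊗ₘ (SSet.stdSimplex.map θ ⊗ₘ SSet.stdSimplex.map θ')) ≫
        (evalPair f g).app ⦋p⦌ := rfl

/-- The chain on `X × X'` given by a family of chains `w` on `Δ^• × Δ^•` and a graded family of
chains on `Δ^n × Δ^n'`. -/
def evalChain {n n' : ℕ} (f : (Tot X) _⦋n⦌) (g : (Tot X') _⦋n'⦌) (w : Amb (prodC Std.{u} Std))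
    (c : ∀ q, S (Δ[n] ⊗ Δ[n'] : SSet.{u}) q) : Amb (prodC X X') :=
  Amb.map (evalPair f g) (totMul _ _ w (col c))

lemma evalChain_apply {n n' : ℕ} (f : (Tot X) _⦋n⦌) (g : (Tot X') _⦋n'⦌)
    (w : Amb (prodC Std.{u} Std)) (c : ∀ q, S (Δ[n] ⊗ Δ[n'] : SSet.{u}) q) (p l : ℕ) :
    evalChain f g w c p l = S.map ((evalPair f g).app ⦋p⦌) l
      (∑ j ∈ Finset.HasAntidiagonal.antidiagonal l,
        cross (Δ[p] ⊗ Δ[p]) (Δ[n] ⊗ Δ[n']) j.1 j.2 l (w p j.1) (c j.2)) := by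
  rw [evalChain, Amb.map_apply, totMul_col]

/-- Simplicial operators applied to `f` and `g` can be moved to the chains on `Δ^n × Δ^n'`. -/
lemma evalChain_map {n n' m m' : ℕ} (θ : ⦋n⦌ ⟶ ⦋m⦌) (θ' : ⦋n'⦌ ⟶ ⦋m'⦌) (f : (Tot X) _⦋m⦌)
    (g : (Tot X') _⦋m'⦌) (w : Amb (prodC Std.{u} Std)) (c : ∀ q, S (Δ[n] ⊗ Δ[n'] : SSet.{u}) q) :
    evalChain ((Tot X).map θ.op f) ((Tot X').map θ'.op g) w c =
      evalChain f g w fun q =>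
        S.map (SSet.stdSimplex.map θ ⊗ₘ SSet.stdSimplex.map θ') q (c q) := by
  ext p l
  rw [evalChain_apply, evalChain_apply, evalPair_map, S.map_comp, map_sum]
  refine congrArg _ (Finset.sum_congr rfl fun j _ => ?_)
  rw [cross_map, S.map_id]

lemma evalChain_zero {n n' : ℕ} (f : (Tot X) _⦋n⦌) (g : (Tot X') _⦋n'⦌)
    (w : Amb (prodC Std.{u} Std)) : evalChain f g w (fun _ => 0) = 0 := by
  ext p l
  rw [evalChain_apply]
  simp

lemma evalChain_add {n n' : ℕ} (f : (Tot X) _⦋n⦌) (g : (Tot X') _⦋n'⦌)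
    (w : Amb (prodC Std.{u} Std)) (c c' : ∀ q, S (Δ[n] ⊗ Δ[n'] : SSet.{u}) q) :
    evalChain f g w (fun q => c q + c' q) = evalChain f g w c + evalChain f g w c' := by
  ext p l
  rw [Amb.add_apply]
  simp only [evalChain_apply, map_add, Finset.sum_add_distrib]

lemma evalChain_sum {ι : Type*} {n n' : ℕ} (f : (Tot X) _⦋n⦌) (g : (Tot X') _⦋n'⦌)
    (w : Amb (prodC Std.{u} Std)) (s : Finset ι) (c : ι → ∀ q, S (Δ[n] ⊗ Δ[n'] : SSet.{u}) q) :
    evalChain f g w (fun q => ∑ i ∈ s, c i q) = ∑ i ∈ s, evalChain f g w (c i) := by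
  classical
  induction s using Finset.induction_on with
  | empty => simp only [Finset.sum_empty, evalChain_zero]
  | insert i s hi ih => simp only [Finset.sum_insert hi, evalChain_add, ih]

lemma evalChain_add_left {n n' : ℕ} (f : (Tot X) _⦋n⦌) (g : (Tot X') _⦋n'⦌)
    (w w' : Amb (prodC Std.{u} Std)) (c : ∀ q, S (Δ[n] ⊗ Δ[n'] : SSet.{u}) q) :
    evalChain f g (w + w') c = evalChain f g w c + evalChain f g w' c := by
  unfold evalChain
  rw [map_add, LinearMap.add_apply, map_add]

lemma D_evalChain {n n' : ℕ} (f : (Tot X) _⦋n⦌) (g : (Tot X') _⦋n'⦌)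
    (w : Amb (prodC Std.{u} Std)) (c : ∀ q, S (Δ[n] ⊗ Δ[n'] : SSet.{u}) q) :
    D _ (evalChain f g w c) = evalChain f g (D _ w) c +
      evalChain f g w (fun q => bd _ q (c (q + 1))) := by
  unfold evalChain
  rw [D_map, D_totMul, map_add, D_col]

lemma tot_map_id {n : ℕ} (f : (Tot X) _⦋n⦌) : (Tot X).map (𝟙 ⦋n⦌ : ⦋n⦌ ⟶ ⦋n⦌).op f = f := by
  rw [op_id, Functor.map_id_apply]

lemma evalChain_map_left {n n' m : ℕ} (θ : ⦋n⦌ ⟶ ⦋m⦌) (f : (Tot X) _⦋m⦌)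
    (g : (Tot X') _⦋n'⦌) (w : Amb (prodC Std.{u} Std)) (z : S (Δ[n] : SSet.{u}) n) :
    evalChain ((Tot X).map θ.op f) g w (fun q => cross _ _ n n' q z (fund n')) =
      evalChain f g w fun q => cross _ _ n n' q (S.map (SSet.stdSimplex.map θ) n z) (fund n') := by
  have h := evalChain_map θ (𝟙 ⦋n'⦌) f g w (fun q => cross _ _ n n' q z (fund n'))
  rw [tot_map_id] at h
  simp only [cross_map, std_map_id, S.map_id] at h
  exact h

lemma evalChain_map_right {n n' m : ℕ} (θ : ⦋n'⦌ ⟶ ⦋m⦌) (f : (Tot X) _⦋n⦌)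
    (g : (Tot X') _⦋m⦌) (w : Amb (prodC Std.{u} Std)) (z : S (Δ[n'] : SSet.{u}) n') :
    evalChain f ((Tot X').map θ.op g) w (fun q => cross _ _ n n' q (fund n) z) =
      evalChain f g w fun q => cross _ _ n n' q (fund n) (S.map (SSet.stdSimplex.map θ) n' z) := by
  have h := evalChain_map (𝟙 ⦋n⦌) θ f g w (fun q => cross _ _ n n' q (fund n) z)
  rw [tot_map_id] at h
  simp only [cross_map, std_map_id, S.map_id] at h
  exact h

/-- The bilinear map `S_n(Tot X) ⊗ S_n'(Tot X') → T(CN (X × X'))` given by a family of chains `w`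
on `Δ^• × Δ^•`. It sends simplices `f` and `g` to the image of `w ∧ (ι_n ∧ ι_n')`. -/
def pairing (X X' : CosimplicialSpace.{u}) (w : Amb (prodC Std.{u} Std)) (n n' : ℕ) :
    S (Tot X) n →ₗ[K] S (Tot X') n' →ₗ[K] Amb (prodC X X') :=
  S.lift (fun f => S.lift (fun g => evalChain f g w (wedge n n')) (by
      rintro _ ⟨m, hm, γ, g, rfl⟩
      refine (evalChain_map_right γ f g w (fund n')).trans ?_
      simp only [map_fund_eq_zero hm, map_zero]
      exact evalChain_zero f g w)) (by
    rintro _ ⟨m, hm, γ, f, rfl⟩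
    refine S.hom_ext fun g => ?_
    rw [S.lift_sm]
    refine (evalChain_map_left γ f g w (fund n)).trans ?_
    simp only [map_fund_eq_zero hm, map_zero, LinearMap.zero_apply]
    exact evalChain_zero f g w)

lemma pairing_sm (w : Amb (prodC Std.{u} Std)) {n n' : ℕ} (f : (Tot X) _⦋n⦌)
    (g : (Tot X') _⦋n'⦌) :
    pairing X X' w n n' (sm f) (sm g) = evalChain f g w (wedge n n') := by
  rw [pairing, S.lift_sm, S.lift_sm]

lemma pairing_add (w w' : Amb (prodC Std.{u} Std)) {n n' : ℕ} (x : S (Tot X) n)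
    (y : S (Tot X') n') :
    pairing X X' (w + w') n n' x y = pairing X X' w n n' x y + pairing X X' w' n n' x y := by
  have : pairing X X' (w + w') n n' = pairing X X' w n n' + pairing X X' w' n n' :=
    S.hom_ext fun f => S.hom_ext fun g => by
      simp only [LinearMap.add_apply, pairing_sm, evalChain_add_left]
  rw [this]; rfl

lemma pairing_mem_TCN {w : Amb (prodC Std.{u} Std)} {m : ℤ} (hw : w ∈ TCN _ m) {n n' : ℕ}
    (x : S (Tot X) n) (y : S (Tot X') n') :
    pairing X X' w n n' x y ∈ TCN (prodC X X') (m + (n + n')) := by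
  induction x using S.induction with
  | h0 => simp
  | hadd x₁ x₂ h₁ h₂ => simpa only [map_add, LinearMap.add_apply] using add_mem h₁ h₂
  | hsm f => ?_
  induction y using S.induction with
  | h0 => simp
  | hadd x₁ x₂ h₁ h₂ => simpa only [map_add] using add_mem h₁ h₂
  | hsm g => ?_
  rw [pairing_sm]
  refine Amb.map_mem_Fil _ (totMul_mem_Fil' (k := 0) (k' := 0) le_rfl ?_ hw
    (col_mem_TCN (m := n + n') fun q hq => cross_eq_zero hq _ _))
  push_cast; rfl

lemma pairing_dd_left (w : Amb (prodC Std.{u} Std)) {n n' : ℕ} (f : (Tot X) _⦋n⦌)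
    (g : (Tot X') _⦋n'⦌) :
    pairing X X' w (n - 1) n' (dd _ n (sm f)) (sm g) =
      evalChain f g w fun q => cross _ _ (n - 1) n' q (dd _ n (fund n)) (fund n') := by
  cases n with
  | zero => simp [dd, evalChain_zero]
  | succ n =>
    change pairing X X' w n n' (bd _ n (sm f)) (sm g) =
      evalChain f g w fun q => cross _ _ n n' q (bd _ n (fund (n + 1))) (fund n')
    simp only [bd_sm, bd_fund, map_sum, LinearMap.sum_apply, evalChain_sum, pairing_sm]
    exact Finset.sum_congr rfl fun k _ => evalChain_map_left (SimplexCategory.δ k) f g w (fund n)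

lemma pairing_dd_right (w : Amb (prodC Std.{u} Std)) {n n' : ℕ} (f : (Tot X) _⦋n⦌)
    (g : (Tot X') _⦋n'⦌) :
    pairing X X' w n (n' - 1) (sm f) (dd _ n' (sm g)) =
      evalChain f g w fun q => cross _ _ n (n' - 1) q (fund n) (dd _ n' (fund n')) := by
  cases n' with
  | zero => simp [dd, evalChain_zero]
  | succ n' =>
    change pairing X X' w n n' (sm f) (bd _ n' (sm g)) =
      evalChain f g w fun q => cross _ _ n n' q (fund n) (bd _ n' (fund (n' + 1)))
    simp only [bd_sm, bd_fund, map_sum, evalChain_sum, pairing_sm]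
    exact Finset.sum_congr rfl fun k _ => evalChain_map_right (SimplexCategory.δ k) f g w (fund n')

/-- The Leibniz rule for the pairing in its three arguments. -/
lemma D_pairing (w : Amb (prodC Std.{u} Std)) {n n' : ℕ} (x : S (Tot X) n) (y : S (Tot X') n') :
    D _ (pairing X X' w n n' x y) = pairing X X' (D _ w) n n' x y +
      (pairing X X' w (n - 1) n' (dd _ n x) y + pairing X X' w n (n' - 1) x (dd _ n' y)) := by
  induction x using S.induction with
  | h0 => simp
  | hadd x₁ x₂ h₁ h₂ => simp only [map_add, LinearMap.add_apply, h₁, h₂]; abel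
  | hsm f => ?_
  induction y using S.induction with
  | h0 => simp
  | hadd x₁ x₂ h₁ h₂ => simp only [map_add, h₁, h₂]; abel
  | hsm g => ?_
  rw [pairing_sm, pairing_sm, pairing_dd_left, pairing_dd_right, D_evalChain, ← evalChain_add]
  simp only [wedge, bd_cross']

/-! ### The pairings given by the two diagonals -/

/-- Both sides are sums over the splittings of the cosimplicial degree. In each summand the shuffle
products of `ι_i`, `ι_i'`, `ι_n` and `ι_n'` are formed in a different order. -/
lemma evalChain_totMul_fundC {n n' : ℕ} (f : (Tot X) _⦋n⦌) (g : (Tot X') _⦋n'⦌) :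
    evalChain f g (totMul Std Std fundC fundC) (wedge n n') =
      totMul X X' (phi X n (sm f)) (phi X' n' (sm g)) := by
  have hphi : ∀ {Y : CosimplicialSpace.{u}} {m : ℕ} (e : (Tot Y) _⦋m⦌) (p q : ℕ),
      phi Y m (sm e) p q = single (S.map (Tot.comp e p) (p + m) (wedge p m (p + m))) q := by
    intro Y m e p q
    rw [phi_sm, ← map_single, wedge, wedge, ← cross_eq_single]
  ext p l
  rw [evalChain_apply, totMul_apply]
  have h1 : ∀ j : ℕ, totMul Std.{u} Std fundC fundC p j =
      ∑ i ∈ Finset.HasAntidiagonal.antidiagonal p,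
        cross Δ[p] Δ[p] i.1 i.2 j (S.map (SSet.stdSimplex.map (front i.1 p)) i.1 (fund i.1))
          (S.map (SSet.stdSimplex.map (back i.2 p)) i.2 (fund i.2)) := by
    intro j
    rw [totMul_apply]
    refine Finset.sum_congr rfl fun i _ => ?_
    refine (Finset.sum_congr rfl fun k _ => ?_).trans (sum_cross_single _ _ _)
    rw [← map_single, ← map_single]
    rfl
  have h2 : ∀ j ∈ Finset.HasAntidiagonal.antidiagonal l,
      cross (Δ[p] ⊗ Δ[p]) (Δ[n] ⊗ Δ[n']) j.1 j.2 l (totMul Std.{u} Std fundC fundC p j.1)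
        (wedge n n' j.2) = ∑ i ∈ Finset.HasAntidiagonal.antidiagonal p,
      cross (Δ[p] ⊗ Δ[p]) (Δ[n] ⊗ Δ[n']) j.1 j.2 l
        (single (cross Δ[p] Δ[p] i.1 i.2 (i.1 + i.2)
          (S.map (SSet.stdSimplex.map (front i.1 p)) i.1 (fund i.1))
          (S.map (SSet.stdSimplex.map (back i.2 p)) i.2 (fund i.2))) j.1)
        (single (cross Δ[n] Δ[n'] n n' (n + n') (fund n) (fund n')) j.2) := by
    intro j _
    rw [h1, map_sum, LinearMap.sum_apply]
    refine Finset.sum_congr rfl fun i _ => ?_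
    rw [← cross_eq_single, ← cross_eq_single]
    rfl
  rw [Finset.sum_congr rfl h2, Finset.sum_comm, map_sum]
  refine Finset.sum_congr rfl fun i _ => ?_
  rw [sum_cross_single, evalPair_app, S.map_comp, interchange_cross, cross_map]
  have h3 : ∀ {Y : CosimplicialSpace.{u}} {m k : ℕ} (e : (Tot Y) _⦋m⦌) (α : ⦋k⦌ ⟶ ⦋p⦌),
      S.map (Tot.comp e p) (k + m) (cross Δ[p] Δ[m] k m (k + m)
        (S.map (SSet.stdSimplex.map α) k (fund k)) (fund m)) =
      S.map (Y.map α) (k + m) (S.map (Tot.comp e k) (k + m) (wedge k m (k + m))) := by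
    intro Y m k e α
    rw [← S.map_comp, ← Tot.comp_nat, S.map_comp, wedge, ← tensorHom_id, cross_map, S.map_id]
  rw [h3, h3, ← sum_cross_single]
  refine Finset.sum_congr rfl fun j _ => ?_
  rw [hphi, hphi, prodTerm, LinearMap.compl₁₂_apply, map_single, map_single]

/-- The Alexander-Whitney diagonal gives the product of total complexes. -/
lemma pairing_totMul_fundC {n n' : ℕ} (x : S (Tot X) n) (y : S (Tot X') n') :
    pairing X X' (totMul Std Std fundC fundC) n n' x y = totMul X X' (phi X n x) (phi X' n' y) := by
  have : pairing X X' (totMul Std Std fundC fundC) n n' =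
      (totMul X X').compl₁₂ (phi X n) (phi X' n') :=
    S.hom_ext fun f => S.hom_ext fun g => by
      rw [pairing_sm, evalChain_totMul_fundC, LinearMap.compl₁₂_apply]
  rw [this]; rfl

lemma map_objEquiv_symm_id {n m : ℕ} (α : ⦋n⦌ ⟶ ⦋m⦌) :
    (Δ[m] : SSet.{u}).map α.op (SSet.stdSimplex.objEquiv.symm (𝟙 ⦋m⦌)) =
      (SSet.stdSimplex.{u}.map α).app (op ⦋n⦌) (SSet.stdSimplex.objEquiv.symm (𝟙 ⦋n⦌)) := rfl

/-- The chain `ι_n ∧ ι_n'` is the sum of the images of the diagonal of `Δ^(n + n')` under all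
shuffles. -/
lemma wedge_eq_sum (n n' q : ℕ) :
    wedge.{u} n n' q = ∑ s ∈ shuffles (n + n') n n',
      S.map (SSet.stdSimplex.map s.1 ⊗ₘ SSet.stdSimplex.map s.2) q
        (single (S.map (diag.app ⦋n + n'⦌) (n + n') (fund (n + n'))) q) := by
  simp only [map_single]
  rw [← single_sum, wedge, cross_eq_single]
  congr 1
  rw [fund, fund, cross_sm rfl]
  refine Finset.sum_congr rfl fun s _ => ?_
  rw [fund, S.map_sm, S.map_sm]
  exact congrArg sm (Prod.ext (map_objEquiv_symm_id s.1) (map_objEquiv_symm_id s.2))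

variable {C : SSetOperad.{u}}

/-- The simplices `f` and `g` have the same dimension here. Their product in `Tot X` is evaluated
along the diagonals of both factors of `Δ^p × Δ^n`. -/
lemma comp_tot_mul (A : CosimplicialAlgebra C X) (c : (C.obj 2) _⦋0⦌) {n : ℕ}
    (f g : (Tot X) _⦋n⦌) (p : ℕ) :
    Tot.comp ((A.tot.mul c).app (op ⦋n⦌) (pr f g)) p =
      (diag.app ⦋p⦌ ⊗ₘ diag.app ⦋n⦌) ≫ (evalPair f g).app ⦋p⦌ ≫ (A.mul c).app ⦋p⦌ := by
  refine NatTrans.ext (funext fun r => ConcreteCategory.hom_ext _ _ ?_)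
  rintro ⟨a, b⟩
  change (A.alg ⦋p⦌).act _ _ = (A.alg ⦋p⦌).act _ _
  congr 1
  · rw [← Functor.map_comp_apply]; rfl
  · funext i
    fin_cases i <;> rfl

lemma phi_tot_mul_sm (A : CosimplicialAlgebra C X) (c : (C.obj 2) _⦋0⦌) {n : ℕ}
    (f g : (Tot X) _⦋n⦌) :
    phi X n (S.map (A.tot.mul c) n (sm (pr f g))) = Amb.map (A.mul c)
      (evalChain f g (Amb.map diag fundC)
        fun q => single (S.map (diag.app ⦋n⦌) n (fund n)) q) := by
  ext p l
  rw [S.map_sm, phi_sm, comp_tot_mul, S.map_comp, S.map_comp, wedge, cross_map, Amb.map_apply,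
    evalChain_apply, ← sum_cross_single]
  refine congrArg _ (congrArg _ (Finset.sum_congr rfl fun j _ => ?_))
  rw [Amb.map_apply, fundC_apply, map_single]

/-- The diagonal of `Δ^•` gives the multiplication of `Tot X`. -/
lemma phi_tot_mul (A : CosimplicialAlgebra C X) (c : (C.obj 2) _⦋0⦌) {n n' : ℕ}
    (x : S (Tot X) n) (y : S (Tot X) n') :
    phi X (n + n') (S.map (A.tot.mul c) (n + n') (cross _ _ n n' (n + n') x y)) =
      Amb.map (A.mul c) (pairing X X (Amb.map diag fundC) n n' x y) := by
  have : (cross _ _ n n' (n + n')).compr₂ (phi X (n + n') ∘ₗ S.map (A.tot.mul c) (n + n')) =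
      (pairing X X (Amb.map diag fundC) n n').compr₂ (Amb.map (A.mul c)) := by
    refine S.hom_ext fun f => S.hom_ext fun g => ?_
    rw [LinearMap.compr₂_apply, LinearMap.compr₂_apply, pairing_sm, cross_sm rfl, map_sum]
    simp only [LinearMap.comp_apply, phi_tot_mul_sm, evalChain_map]
    rw [← map_sum, ← evalChain_sum]
    congr 2
    funext q
    exact (wedge_eq_sum n n' q).symm
  exact congrArg (fun F => F x y) this

/-- On cycles, the comparison map `phi` is multiplicative up to boundaries. -/
lemma phi_tot_mul_sub_mem (A : CosimplicialAlgebra C X) (c : (C.obj 2) _⦋0⦌) {n n' : ℕ}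
    {x : S (Tot X) n} {y : S (Tot X) n'} (hx : dd _ n x = 0) (hy : dd _ n' y = 0) :
    phi X (n + n') (S.map (A.tot.mul c) (n + n') (cross _ _ n n' (n + n') x y)) -
        Amb.map (A.mul c) (totMul X X (phi X n x) (phi X n' y)) ∈
      (TCN X (n + n' + 1)).map (D X) := by
  obtain ⟨h, hh, e⟩ := exists_D_eq_diag.{u}
  refine ⟨Amb.map (A.mul c) (pairing X X h n n' x y),
    Amb.map_mem_Fil _ (Fil_cast rfl (by ring) (pairing_mem_TCN hh x y)), ?_⟩
  rw [D_map, D_pairing, hx, hy, map_zero, map_zero, LinearMap.zero_apply, add_zero, add_zero, e,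
    pairing_add, pairing_totMul_fundC, map_add, phi_tot_mul, eq_sub_iff_add_eq, add_assoc,
    add_self_K, add_zero]

/-- A product of cycles depends only on their homology classes, up to boundaries. -/
lemma totMul_sub_mem {m m' : ℤ} {z z' : Amb X} {w w' : Amb X'}
    (hz' : z' ∈ TCN X m ⊓ LinearMap.ker (D X)) (hw : w ∈ TCN X' m' ⊓ LinearMap.ker (D X'))
    (hzz : z - z' ∈ (TCN X (m + 1)).map (D X)) (hww : w - w' ∈ (TCN X' (m' + 1)).map (D X')) :
    totMul X X' z w - totMul X X' z' w' ∈
      (TCN (prodC X X') (m + m' + 1)).map (D (prodC X X')) := by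
  obtain ⟨a, ha, ea⟩ := hzz
  obtain ⟨b, hb, eb⟩ := hww
  refine ⟨totMul X X' a w + totMul X X' z' b, add_mem
    (totMul_mem_Fil' (k := 0) (k' := 0) le_rfl (by ring) ha hw.1)
    (totMul_mem_Fil' (k := 0) (k' := 0) le_rfl (by ring) hz'.1 hb), ?_⟩
  rw [map_add, D_totMul, D_totMul, LinearMap.mem_ker.mp hw.2, LinearMap.mem_ker.mp hz'.2, ea, eb]
  simp only [map_sub, map_zero, LinearMap.sub_apply, LinearMap.zero_apply]
  abel

/-! ### Multiplicativity in homology -/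

lemma mul_mem_Fil (A : CosimplicialAlgebra C X) (c : (C.obj 2) _⦋0⦌) {k k' m m' : ℤ}
    {z w : Amb X} (hz : z ∈ Fil X k m) (hw : w ∈ Fil X k' m') :
    Amb.map (A.mul c) (totMul X X z w) ∈ Fil X (k + k') (m + m') :=
  Amb.map_mem_Fil _ (totMul_mem_Fil hz hw)

lemma D_mul (A : CosimplicialAlgebra C X) (c : (C.obj 2) _⦋0⦌) {z w : Amb X}
    (hz : D X z = 0) (hw : D X w = 0) : D X (Amb.map (A.mul c) (totMul X X z w)) = 0 := by
  rw [D_map, D_totMul, hz, hw]; simp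

/-- If the cycles `z` and `w` represent the images of `a` and `b`, then their product represents
the image of `μ(a ⊗ b)`. -/
lemma Hphi_muH (A : CosimplicialAlgebra C X) (c : (C.obj 2) _⦋0⦌) {n n' : ℕ}
    {a : H (Tot X) n} {b : H (Tot X) n'} {z w : Amb X}
    (hz : z ∈ TCN X n ⊓ LinearMap.ker (D X)) (hw : w ∈ TCN X n' ⊓ LinearMap.ker (D X))
    (ez : SubQ.mk _ z hz = Hphi X n a) (ew : SubQ.mk _ w hw = Hphi X n' b) :
    ∃ h, SubQ.mk _ (Amb.map (A.mul c) (totMul X X z w)) h =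
      Hphi X (n + n') (A.tot.muH c n n' a b) := by
  obtain ⟨x, hx, rfl⟩ := SubQ.exists_rep a
  obtain ⟨y, hy, rfl⟩ := SubQ.exists_rep b
  have hx0 := LinearMap.mem_ker.mp hx
  have hy0 := LinearMap.mem_ker.mp hy
  have hzx : z - phi X n x ∈ _ := SubQ.mk_eq_mk.mp ez
  have hwy : w - phi X n' y ∈ _ := SubQ.mk_eq_mk.mp ew
  have hphi : phi X n x ∈ TCN X n ⊓ LinearMap.ker (D X) :=
    ⟨phi_mem_TCN n x, LinearMap.mem_ker.mpr (by rw [D_phi, hx0, map_zero])⟩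
  refine ⟨⟨Fil_cast (by simp) (by push_cast; rfl) (mul_mem_Fil A c hz.1 hw.1),
    LinearMap.mem_ker.mpr (D_mul A c (LinearMap.mem_ker.mp hz.2) (LinearMap.mem_ker.mp hw.2))⟩,
    SubQ.mk_eq_mk.mpr ?_⟩
  obtain ⟨v, hv, ev⟩ := totMul_sub_mem hphi hw hzx hwy
  obtain ⟨v', hv', ev'⟩ := phi_tot_mul_sub_mem A c hx0 hy0
  refine ⟨Amb.map (A.mul c) v - v', sub_mem
    (Fil_cast rfl (by push_cast; ring) (Amb.map_mem_Fil (A.mul c) hv))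
    (Fil_cast rfl (by push_cast; ring) hv'), ?_⟩
  rw [map_sub, D_map, ev, ev', map_sub]
  exact sub_sub_sub_cancel_right _ _ _

/-- The filtration of `H_n(Tot X)` in terms of representing cycles. -/
lemma mem_FH {s : ℤ} {n : ℕ} {a : H (Tot X) n} :
    a ∈ FH X s n ↔ ∃ z ∈ Fil X (-s) n, ∃ h : z ∈ TCN X n ⊓ LinearMap.ker (D X),
      SubQ.mk _ z h = Hphi X n a := by
  constructor
  · intro ha
    exact exists_rep_of_toQuot _ (LinearMap.mem_ker.mp ha)
  · rintro ⟨z, hz, h, e⟩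
    refine LinearMap.mem_ker.mpr ?_
    rw [LinearMap.comp_apply, ← e]
    exact SubQ.mk_eq_zero.mpr (Submodule.mem_sup_right hz)

lemma muH_mem_FH (A : CosimplicialAlgebra C X) (c : (C.obj 2) _⦋0⦌) {s s' s'' : ℤ}
    (hs : s + s' = s'') {n n' : ℕ} {a : H (Tot X) n} {b : H (Tot X) n'}
    (ha : a ∈ FH X s n) (hb : b ∈ FH X s' n') :
    A.tot.muH c n n' a b ∈ FH X s'' (n + n') := by
  subst hs
  obtain ⟨z, hz, hz', ez⟩ := mem_FH.mp ha
  obtain ⟨w, hw, hw', ew⟩ := mem_FH.mp hb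
  obtain ⟨h, e⟩ := Hphi_muH A c hz' hw' ez ew
  exact mem_FH.mpr ⟨_, Fil_cast (by ring) (by push_cast; rfl) (mul_mem_Fil A c hz hw), h, e⟩

lemma SubQ.eq_of_forall_mk {M M' M'' : Type*} [AddCommGroup M] [Module K M] [AddCommGroup M']
    [Module K M'] [AddCommGroup M''] [Module K M''] {Z B : Submodule K M} {Z' B' : Submodule K M'}
    {f g : SubQ Z B →ₗ[K] SubQ Z' B' →ₗ[K] M''}
    (h : ∀ x hx y hy, f (SubQ.mk B x hx) (SubQ.mk B' y hy) =
      g (SubQ.mk B x hx) (SubQ.mk B' y hy)) (a : SubQ Z B) (b : SubQ Z' B') : f a b = g a b := by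
  obtain ⟨x, hx, rfl⟩ := SubQ.exists_rep a
  obtain ⟨y, hy, rfl⟩ := SubQ.exists_rep b
  exact h x hx y hy

/-- The multiplication on the filtration quotients of `H_*(Tot X)`. -/
def muGr (A : CosimplicialAlgebra C X) (c : (C.obj 2) _⦋0⦌) (s s' : ℤ) (n n' : ℕ) :
    GrH X s n →ₗ[K] GrH X s' n' →ₗ[K] GrH X (s + s') (n + n') :=
  SubQ.map₂ (A.tot.muH c n n') (fun _ ha _ hb => muH_mem_FH A c rfl ha hb)
    (fun _ _ ha _ hb => muH_mem_FH A c (add_right_comm s 1 s') ha hb)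
    (fun _ ha _ _ hb => muH_mem_FH A c (add_assoc s s' 1).symm ha hb)

lemma muGr_mk (A : CosimplicialAlgebra C X) (c : (C.obj 2) _⦋0⦌) {s s' : ℤ} {n n' : ℕ}
    {a : H (Tot X) n} {b : H (Tot X) n'} (ha : a ∈ FH X s n) (hb : b ∈ FH X s' n') :
    muGr A c s s' n n' (SubQ.mk _ a ha) (SubQ.mk _ b hb) =
      SubQ.mk _ (A.tot.muH c n n' a b) (muH_mem_FH A c rfl ha hb) := rfl

lemma muE_mk (A : CosimplicialAlgebra C X) (c : (C.obj 2) _⦋0⦌) {s t s' t' : ℤ} {z w : Amb X}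
    (hz : z ∈ Zinf X s t) (hw : w ∈ Zinf X s' t')
    (hzw : Amb.map (A.mul c) (totMul X X z w) ∈ Zinf X (s + s') (t + t')) :
    A.muE c s t s' t' (SubQ.mk _ z hz) (SubQ.mk _ w hw) = SubQ.mk _ _ hzw := by
  rw [CosimplicialAlgebra.muE, LinearMap.compr₂_apply, Einf.cross, SubQ.map₂_mk, Einf.map,
    SubQ.map_mk]

lemma iota_muGr_mk (A : CosimplicialAlgebra C X) (c : (C.obj 2) _⦋0⦌) {s t s' t' : ℤ} {n n' : ℕ}
    (h : (n : ℤ) = t - s) (h' : (n' : ℤ) = t' - s')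
    (h'' : ((n + n' : ℕ) : ℤ) = t + t' - (s + s')) {a : H (Tot X) n} {b : H (Tot X) n'}
    (ha : a ∈ FH X s n) (hb : b ∈ FH X s' n') :
    iota X (s + s') (t + t') (n + n') h'' (SubQ.mk _ _ (muH_mem_FH A c rfl ha hb)) =
      A.muE c s t s' t' (iota X s t n h (SubQ.mk _ a ha))
        (iota X s' t' n' h' (SubQ.mk _ b hb)) := by
  have ⟨z, hz, hz', ez⟩ := mem_FH.mp ha
  have ⟨w, hw, hw', ew⟩ := mem_FH.mp hb
  have ⟨k, e⟩ := Hphi_muH A c hz' hw' ez ew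
  have hz'' := mem_Zinf_of_cycle (Fil_cast rfl h.symm hz) (LinearMap.mem_ker.mp hz'.2)
  have hw'' := mem_Zinf_of_cycle (Fil_cast rfl h'.symm hw) (LinearMap.mem_ker.mp hw'.2)
  have hzw : Amb.map (A.mul c) (totMul X X z w) ∈ Fil X (-(s + s')) (n + n' : ℕ) :=
    Fil_cast (by ring) (by push_cast; rfl) (mul_mem_Fil A c hz hw)
  have hzw'' := mem_Zinf_of_cycle (s := s + s') (t := t + t') (Fil_cast rfl h''.symm hzw)
    (LinearMap.mem_ker.mp k.2)
  rw [iota_mk h a ha hz' hz'' hz ez, iota_mk h' b hb hw' hw'' hw ew]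
  exact (iota_mk h'' _ _ k hzw'' hzw e).trans (muE_mk A c hz'' hw'' hzw'').symm

lemma iota_muGr (A : CosimplicialAlgebra C X) (c : (C.obj 2) _⦋0⦌) {s t s' t' : ℤ} {n n' : ℕ}
    (h : (n : ℤ) = t - s) (h' : (n' : ℤ) = t' - s')
    (h'' : ((n + n' : ℕ) : ℤ) = t + t' - (s + s')) (a : GrH X s n) (b : GrH X s' n') :
    iota X (s + s') (t + t') (n + n') h'' (muGr A c s s' n n' a b) =
      A.muE c s t s' t' (iota X s t n h a) (iota X s' t' n' h' b) := by
  refine SubQ.eq_of_forall_mk (f := (muGr A c s s' n n').compr₂ (iota X _ _ _ h''))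
    (g := (A.muE c s t s' t').compl₁₂ (iota X s t n h) (iota X s' t' n' h')) ?_ a b
  intro a ha b hb
  exact iota_muGr_mk A c h h' h'' ha hb

end

end CosimplicialSS


theorem corollaryC (C : CosimplicialSS.SSetOperad.{u}) (hC : C.IsEInfinity)
    (X : CosimplicialSS.CosimplicialSpace.{u}) (A : CosimplicialSS.CosimplicialAlgebra C X)
    (c : (C.obj 2).obj (op (SimplexCategory.mk 0))) :
    (∀ (s s' : ℤ) (n n' : ℕ), ∀ x ∈ CosimplicialSS.FH X s n, ∀ y ∈ CosimplicialSS.FH X s' n',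
      A.tot.muH c n n' x y ∈ CosimplicialSS.FH X (s + s') (n + n')) ∧
    ∀ (s t s' t' : ℤ) (n n' : ℕ) (h : (n : ℤ) = t - s) (h' : (n' : ℤ) = t' - s'),
      ∃ muGr : CosimplicialSS.GrH X s n →ₗ[ZMod 2] CosimplicialSS.GrH X s' n' →ₗ[ZMod 2]
          CosimplicialSS.GrH X (s + s') (n + n'),
        (∀ (x : CosimplicialSS.H (CosimplicialSS.Tot X) n) (hx : x ∈ CosimplicialSS.FH X s n)
          (y : CosimplicialSS.H (CosimplicialSS.Tot X) n') (hy : y ∈ CosimplicialSS.FH X s' n'),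
          ∃ hxy : A.tot.muH c n n' x y ∈ CosimplicialSS.FH X (s + s') (n + n'),
            muGr (CosimplicialSS.SubQ.mk _ x hx) (CosimplicialSS.SubQ.mk _ y hy) =
              CosimplicialSS.SubQ.mk _ (A.tot.muH c n n' x y) hxy) ∧
        ∀ (a : CosimplicialSS.GrH X s n) (b : CosimplicialSS.GrH X s' n'),
          CosimplicialSS.iota X (s + s') (t + t') (n + n') (by push_cast; omega) (muGr a b) =
            A.muE c s t s' t' (CosimplicialSS.iota X s t n h a)
              (CosimplicialSS.iota X s' t' n' h' b) :=
  ⟨fun _ _ _ _ _ hx _ hy => CosimplicialSS.muH_mem_FH A c rfl hx hy,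
    fun s _ s' _ n n' h h' => ⟨CosimplicialSS.muGr A c s s' n n',
      fun _ hx _ hy => ⟨_, CosimplicialSS.muGr_mk A c hx hy⟩,
      fun a b => CosimplicialSS.iota_muGr A c h h' _ a b⟩⟩
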